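/- Let $n \ge k \ge 1$ be integers and write $\bar t := 1-t$. Define the rational function $$f_{n,k}(x_1,\dots,x_k) := \frac{\prod_{i=1}^{k}(1-2x_i)\,\prod_{1\le i<j\le k}(x_j-x_i)(x_j+x_i-1)}{\prod_{i=1}^{k}\bar x_i^{\,n+k+1}\,x_i^{\,n+k-i}\;\prod_{1\le i<j\le k}(1-x_ix_j)} \in \mathbb{Q}(x_1,\dots,x_k).$$ For a rational function $f(x_1,\dots,x_k)$ let $\mathrm{Res}_{x_i} f$ be the coefficient of $x_i^{-1}$ in the formal Laurent expansion of $f$ in powers of $x_i$, where $f$ is viewed as a rational function of the single variable $x_i$ whose coefficients are rational functions of the other variables; and let $\mathrm{Res}_{x_1,\dots,x_k} f := \mathrm{Res}_{x_1}[\mathrm{Res}_{x_2}[\cdots[\mathrm{Res}_{x_k} f]\cdots]]$. A signed permutation $g=(\pi,\varepsilon)\in W(\mathcal B_k)$ consists of a permutation $\pi$ of $\{1,\dots,k\}$ and signs $\varepsilon_1,\dots,\varepsilon_k\in\{+1,-1\}$. It acts on rational functions by $g f := \varepsilon(\pi f)$, where $\pi$ replaces each $x_i$ by $x_{\pi(i)}$,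 and $\varepsilon$ replaces $x_i$ by $\bar x_i = 1-x_i$ for each $i$ with $\varepsilon_i=-1$ (leaving the other variables unchanged). Let $b_k(n)$ be the number of $n\times k$ Magog trapezoids, i.e. arrays of integers $(c_{i,j})$, $1\le i\le k$, $1\le j\le n-i+1$, with $1\le c_{i,j}\le j$, $c_{i,j}\ge c_{i+1,j}$ and $c_{i,j}\le c_{i,j+1}$ (whenever both entries are defined). Then for every signed permutation $g\in W(\mathcal B_k)$, $$\mathrm{Res}_{x_1,\dots,x_k}[\,g f_{n,k}\,] = \mathrm{Res}_{x_1,\dots,x_k}[\,f_{n,k}\,] = b_k(n).$$ Moreover, $g f_{n,k}$ need not have a Laurent expansion: if $k\ge 2$, there is a $g\in W(\mathcal B_k)$ such that $g f_{n,k}$ is not equal to any formal Laurent series $\sum_{\alpha_1,\dots,\alpha_k\ge L} a_{\alpha_1,\dots,\alpha_k}\,x_1^{\alpha_1}\cdots x_k^{\alpha_k}$ with $L\in\mathbb Z$ and rational coefficients. -/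

import Mathlib

/-- The field `ℚ(x_1, …, x_k)` of rational functions in `k` variables. The variables are indexed
by `Fin k`, so `x_i` of the mathematical text is the variable with index `i - 1`. -/
abbrev RatField (k : ℕ) : Type := FractionRing (MvPolynomial (Fin k) ℚ)

/-- The variable `x_i`, as a rational function. -/
noncomputable def ratVar {k : ℕ} (i : Fin k) : RatField k :=
  algebraMap (MvPolynomial (Fin k) ℚ) (RatField k) (MvPolynomial.X i)

/-! ### Iterated residues -/

/-- A polynomial in `x_1, …, x_k` viewed as a polynomial in a new variable `T` that takes the
place of `x_i`; its coefficients are functions of the variables other than `x_i`. -/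
noncomputable def polyInVar {k : ℕ} (i : Fin k) :
    MvPolynomial (Fin k) ℚ →ₐ[ℚ] Polynomial (RatField k) :=
  MvPolynomial.aeval fun j => if j = i then Polynomial.X else Polynomial.C (ratVar j)

theorem polyInVar_injective {k : ℕ} (i : Fin k) :
    Function.Injective (polyInVar i : MvPolynomial (Fin k) ℚ →ₐ[ℚ] Polynomial (RatField k)) := by
  have h : ∀ p : MvPolynomial (Fin k) ℚ,
      Polynomial.aeval (R := RatField k) (ratVar i) (polyInVar i p) =
        algebraMap (MvPolynomial (Fin k) ℚ) (RatField k) p := by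
    intro p
    have e : ((Polynomial.aeval (R := RatField k) (ratVar i)).restrictScalars ℚ).comp
        (polyInVar i) = Algebra.algHom ℚ (MvPolynomial (Fin k) ℚ) (RatField k) := by
      apply MvPolynomial.algHom_ext
      intro j
      by_cases hj : j = i
      · subst hj
        simp [polyInVar, ratVar]
        rfl
      · simp [polyInVar, ratVar, hj]
        rfl
    exact DFunLike.congr_fun e p
  intro p q hpq
  apply IsFractionRing.injective (MvPolynomial (Fin k) ℚ) (RatField k)
  rw [← h p, ← h q, hpq]

/-- A rational function in `x_1, …, x_k` viewed as a rational function of the single variable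
`T = x_i`, whose coefficients are rational functions of the other variables. -/
noncomputable def ratInVar {k : ℕ} (i : Fin k) : RatField k →+* RatFunc (RatField k) :=
  IsFractionRing.lift (A := MvPolynomial (Fin k) ℚ) (K := RatField k)
    (g := (algebraMap (Polynomial (RatField k)) (RatFunc (RatField k))).comp
      (polyInVar i : MvPolynomial (Fin k) ℚ →+* Polynomial (RatField k)))
    ((IsFractionRing.injective (Polynomial (RatField k)) (RatFunc (RatField k))).comp
      (polyInVar_injective i))

/-- The residue `Res_{x_i} f`: the coefficient of `x_i ^ (-1)` in the Laurent expansion of `f`,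
viewed as a rational function of the single variable `x_i`. It is a rational function of the
other variables. -/
noncomputable def residue {k : ℕ} (i : Fin k) (f : RatField k) : RatField k :=
  HahnSeries.coeff ((ratInVar i f : RatFunc (RatField k)) : LaurentSeries (RatField k)) (-1)

/-- The iterated residue
`Res_{x_1, …, x_k} f = Res_{x_1} [Res_{x_2} [ … [Res_{x_k} f] … ]]`, where the residue in `x_k`
is taken first. -/
noncomputable def iteratedResidue {k : ℕ} (f : RatField k) : RatField k :=
  (List.finRange k).foldr residue f

/-! ### Signed permutations and their action on rational functions -/

/-- Signed permutations, the elements of `W(B_k)`: pairs `(π, ε)` of a permutation of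
`{1, …, k}` and a sign assignment. -/
abbrev SignedPerm (k : ℕ) : Type := Equiv.Perm (Fin k) × (Fin k → ℤˣ)

/-- `π f` is obtained from `f` by replacing each `x_i` by `x_{π(i)}`. -/
noncomputable def permAct {k : ℕ} (π : Equiv.Perm (Fin k)) : RatField k ≃+* RatField k :=
  IsFractionRing.ringEquivOfRingEquiv (MvPolynomial.renameEquiv ℚ π).toRingEquiv

/-- The substitution of `ε_i(x_i)` for each `x_i` in a polynomial, where `ε_i(t) = t` if
`ε_i = 1` and `ε_i(t) = 1 - t` if `ε_i = -1`. -/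
noncomputable def signPoly {k : ℕ} (ε : Fin k → ℤˣ) :
    MvPolynomial (Fin k) ℚ →ₐ[ℚ] MvPolynomial (Fin k) ℚ :=
  MvPolynomial.aeval fun i => if ε i = 1 then MvPolynomial.X i else 1 - MvPolynomial.X i

theorem signPoly_comp_self {k : ℕ} (ε : Fin k → ℤˣ) :
    (signPoly ε).comp (signPoly ε) = AlgHom.id ℚ (MvPolynomial (Fin k) ℚ) := by
  apply MvPolynomial.algHom_ext
  intro i
  by_cases h : ε i = 1 <;> simp [signPoly, h]

/-- `ε f (x_1, …, x_k) = f (ε_1(x_1), …, ε_k(x_k))`. -/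
noncomputable def signAct {k : ℕ} (ε : Fin k → ℤˣ) : RatField k ≃+* RatField k :=
  IsFractionRing.ringEquivOfRingEquiv
    (AlgEquiv.ofAlgHom (signPoly ε) (signPoly ε) (signPoly_comp_self ε)
      (signPoly_comp_self ε)).toRingEquiv

/-- The action of a signed permutation `g = (π, ε)` on rational functions: `g f = ε (π f)`. -/
noncomputable def signedAct {k : ℕ} (g : SignedPerm k) (f : RatField k) : RatField k :=
  signAct g.2 (permAct g.1 f)

/-! ### Laurent expansions -/

/-- `f` possesses a (genuine, multivariate) Laurent expansion: there are an integer `N` and a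
formal power series `S` in `x_1, …, x_k` such that `f = S / (x_1 ⋯ x_k) ^ N`. Writing `f = P / Q`
with polynomials `P` and `Q ≠ 0`, this means that `(x_1 ⋯ x_k) ^ N P = Q S` as power series. -/
def HasLaurentExpansion {k : ℕ} (f : RatField k) : Prop :=
  ∃ (P Q : MvPolynomial (Fin k) ℚ) (N : ℕ) (S : MvPowerSeries (Fin k) ℚ), Q ≠ 0 ∧
    f = algebraMap _ (RatField k) P / algebraMap _ (RatField k) Q ∧
    (∏ i : Fin k, MvPowerSeries.X i) ^ N * (P : MvPowerSeries (Fin k) ℚ) =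
      (Q : MvPowerSeries (Fin k) ℚ) * S

/-! ### The Magog residuand and Magog trapezoids -/

/-- `Δ_k = ∏_i (1 - 2 x_i) ∏_{i < j} (x_j - x_i) (x_j + x_i - 1)`. -/
noncomputable def magogDelta (k : ℕ) : RatField k :=
  (∏ i : Fin k, (1 - 2 * ratVar i)) *
    ∏ i : Fin k, ∏ j ∈ Finset.Ioi i, (ratVar j - ratVar i) * (ratVar j + ratVar i - 1)

/-- The residuand
`f_{n,k} = Δ_k / (∏_i (1 - x_i)^(n+k+1) x_i^(n+k-i) ∏_{i < j} (1 - x_i x_j))`, where `i` and `j`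
run through `1, …, k`; the variable with index `i : Fin k` is the `(i + 1)`-st one. -/
noncomputable def magogResiduand (n k : ℕ) : RatField k :=
  magogDelta k /
    ((∏ i : Fin k, (1 - ratVar i) ^ (n + k + 1) * ratVar i ^ (n + k - (i.val + 1))) *
      ∏ i : Fin k, ∏ j ∈ Finset.Ioi i, (1 - ratVar i * ratVar j))

/-- `c` is an `n × k` Magog trapezoid: an array of integers `c_{i,j}`, `1 ≤ i ≤ k`,
`1 ≤ j ≤ n - i + 1`, with `1 ≤ c_{i,j} ≤ j`, `c_{i,j} ≥ c_{i+1,j}` and `c_{i,j} ≤ c_{i,j+1}`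
(whenever both entries exist). The row index `i : Fin k` and the column index `j : Fin (n - i)`
start from `0` here. -/
structure IsMagogTrapezoid (n k : ℕ) (c : (i : Fin k) → Fin (n - i.val) → ℤ) : Prop where
  bounds : ∀ (i : Fin k) (j : Fin (n - i.val)), 1 ≤ c i j ∧ c i j ≤ (j.val : ℤ) + 1
  column : ∀ (i i' : Fin k) (j : Fin (n - i.val)) (j' : Fin (n - i'.val)),
    i'.val = i.val + 1 → j'.val = j.val → c i' j' ≤ c i j
  row : ∀ (i : Fin k) (j j' : Fin (n - i.val)), j'.val = j.val + 1 → c i j ≤ c i j'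

/-- `b_k(n)`, the number of `n × k` Magog trapezoids. -/
noncomputable def magogCount (n k : ℕ) : ℕ :=
  Nat.card {c : (i : Fin k) → Fin (n - i.val) → ℤ // IsMagogTrapezoid n k c}

namespace MagogResidue

/-! ### Laurent expansions in one variable -/

open HahnSeries

variable {k : ℕ}

/-! Invariance under permutations: all functions involved lie in the algebras `poleAlg`, with poles
only along `x_i = 0`, `x_i = 1` and `∏_{i ∈ T} x_i = 1`. A factor of the last kind is regular at
`x_i = 0`, and setting `x_i = 1` in it gives a factor of an allowed kind. The algebras are therefore
stable under residues, and a residue at `x_i = 0` commutes with the residues in the other variables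
(`res_comm`). Permuting the variables then only reorders the residues.

Invariance under signs: a sign change at `x_i` replaces the residue at `x_i = 0` by the one at `x_i
= 1` in the coordinate `1 - x_i`. Since `d(1 - x_i) = -dx_i`, the difference `resDiff i` is, by the
residue theorem, minus the sum of the residues at infinity and at the points `x_i = 1 / x_j`. For
`f_{n,k}` the residue at infinity vanishes. At `x_i = 1 / x_j` the numerator cancels every factor
that couples `x_j` to a further variable; because `k ≤ n`, what remains has no pole at `x_j = 0` and
no residue at infinity, hence no residue at `x_j = 1`. So every choice of point for `x_j` gives zero
(`iterRes_resDiff_magogResiduand`).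

The count: the trapezoids are sorted by the vector `a` of last entries of their rows. Removing these
entries gives a recursion over interlacing vectors, which a determinant `ballotDet n a` of ballot
numbers also satisfies. This determinant is the iterated residue of a monomial expression times a
Vandermonde product in the `x_i (1 - x_i)`. Summing over all `a` produces geometric series in the
products `x_i ⋯ x_k`, that is, the function `tailResiduand`. It differs from `f_{n,k}`, but both
have the same sum over the symmetric group (`sum_perm_prod_inv_one_sub`); since the iterated residue
ignores permutations, the two residues agree after division by `k!`.

Absence of an expansion: when all signs are flipped, the denominator contains `1 - (1 - x_1)(1 -
x_2)`, which vanishes on a formal curve through the origin on which neither the numerator nor any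
coordinate vanishes. -/

theorem ratField_hom_ext {L : Type*} [Field L] {f g : RatField k →+* L}
    (h : ∀ j, f (ratVar j) = g (ratVar j)) : f = g := by
  apply IsFractionRing.ringHom_ext (A := MvPolynomial (Fin k) ℚ)
  intro p
  have : f.comp (algebraMap (MvPolynomial (Fin k) ℚ) (RatField k)) =
      g.comp (algebraMap (MvPolynomial (Fin k) ℚ) (RatField k)) :=
    MvPolynomial.ringHom_ext (fun r => by
      have := Subsingleton.elim
        ((f.comp (algebraMap (MvPolynomial (Fin k) ℚ) (RatField k))).comp MvPolynomial.C)
        ((g.comp (algebraMap (MvPolynomial (Fin k) ℚ) (RatField k))).comp MvPolynomial.C)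
      exact RingHom.congr_fun this r) h
  exact RingHom.congr_fun this p

section

open scoped RatFunc

/-- Expansion of a rational function of one variable as a Laurent series. -/
noncomputable def ratFuncToLaurent (F : Type*) [Field F] : RatFunc F →+* LaurentSeries F :=
  algebraMap (RatFunc F) (LaurentSeries F)

theorem ratFuncToLaurent_X {F : Type*} [Field F] :
    ratFuncToLaurent F RatFunc.X = single 1 1 := RatFunc.coe_X

theorem ratFuncToLaurent_C {F : Type*} [Field F] (a : F) :
    ratFuncToLaurent F (RatFunc.C a) = C a := by
  rw [ratFuncToLaurent, ← RatFunc.algebraMap_C, ← IsScalarTower.algebraMap_apply]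
  simp

end

/-- Expansion of a rational function as a Laurent series in the variable `x_i`. -/
noncomputable def laurentIn (i : Fin k) : RatField k →+* LaurentSeries (RatField k) :=
  (ratFuncToLaurent (RatField k)).comp (ratInVar i)

theorem residue_eq_coeff (i : Fin k) (f : RatField k) :
    residue i f = (laurentIn i f).coeff (-1) := rfl

theorem ratInVar_ratVar (i j : Fin k) :
    ratInVar i (ratVar j) = if j = i then RatFunc.X else RatFunc.C (ratVar j) := by
  rw [ratInVar, ratVar, IsFractionRing.lift_algebraMap]
  by_cases h : j = i <;> simp [polyInVar, h, ratVar]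

theorem laurentIn_self (i : Fin k) : laurentIn i (ratVar i) = single 1 1 := by
  simp [laurentIn, ratInVar_ratVar, ratFuncToLaurent_X]

theorem laurentIn_of_ne {i j : Fin k} (h : j ≠ i) : laurentIn i (ratVar j) = C (ratVar j) := by
  simp only [laurentIn, RingHom.comp_apply, ratInVar_ratVar, h, if_false]
  exact ratFuncToLaurent_C _

theorem permAct_ratVar (π : Equiv.Perm (Fin k)) (i : Fin k) :
    permAct π (ratVar i) = ratVar (π i) := by
  simp only [permAct, ratVar, IsFractionRing.ringEquivOfRingEquiv_algebraMap]
  congr 1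
  exact MvPolynomial.rename_X _ _

theorem signAct_ratVar (ε : Fin k → ℤˣ) (i : Fin k) :
    signAct ε (ratVar i) = if ε i = 1 then ratVar i else 1 - ratVar i := by
  simp only [signAct, ratVar, IsFractionRing.ringEquivOfRingEquiv_algebraMap]
  have : (AlgEquiv.ofAlgHom (signPoly ε) (signPoly ε) (signPoly_comp_self ε)
      (signPoly_comp_self ε)).toRingEquiv (MvPolynomial.X i) =
      if ε i = 1 then MvPolynomial.X i else 1 - MvPolynomial.X i := by
    change signPoly ε (MvPolynomial.X i) = _
    simp [signPoly]
  rw [this]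
  split_ifs <;> simp

theorem ratVar_ne_zero (i : Fin k) : ratVar i ≠ 0 := by
  simp [ratVar]

/-- Coefficientwise application of a ring homomorphism to Laurent series. -/
noncomputable def laurentMap {K L : Type*} [Field K] [Field L] (τ : K →+* L) :
    LaurentSeries K →+* LaurentSeries L where
  toFun x := x.map τ
  map_one' := HahnSeries.map_one τ.toMonoidWithZeroHom
  map_mul' x y := HahnSeries.map_mul τ.toNonUnitalRingHom
  map_zero' := by ext; simp
  map_add' x y := HahnSeries.map_add τ.toAddMonoidHom

theorem laurentMap_coeff {K L : Type*} [Field K] [Field L] (τ : K →+* L) (x : LaurentSeries K)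
    (n : ℤ) : (laurentMap τ x).coeff n = τ (x.coeff n) := rfl

theorem laurentMap_single {K L : Type*} [Field K] [Field L] (τ : K →+* L) (n : ℤ) (a : K) :
    laurentMap τ (single n a) = single n (τ a) :=
  HahnSeries.map_single (τ : ZeroHom K L)

theorem residue_permAct (π : Equiv.Perm (Fin k)) (i : Fin k) (f : RatField k) :
    residue (π i) (permAct π f) = permAct π (residue i f) := by
  have : (laurentIn (π i)).comp (permAct π : RatField k →+* RatField k) =
      (laurentMap (permAct π : RatField k →+* RatField k)).comp (laurentIn i) := by
    apply ratField_hom_ext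
    intro j
    by_cases h : j = i
    · subst h
      simp [permAct_ratVar, laurentIn_self, laurentMap_single]
    · have h' : π j ≠ π i := fun e => h (π.injective e)
      simp [permAct_ratVar, laurentIn_of_ne h, laurentIn_of_ne h', laurentMap_single]
  rw [residue_eq_coeff, residue_eq_coeff]
  have e := RingHom.congr_fun this f
  simp only [RingHom.comp_apply, RingHom.coe_coe] at e
  rw [e, laurentMap_coeff]
  rfl

/-- With `ε i = 1` the expansion stays centred at `x_i = 0`, and the other signs only act on its
coefficients. -/
theorem residue_signAct {ε : Fin k → ℤˣ} {i : Fin k} (hε : ε i = 1) (f : RatField k) :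
    residue i (signAct ε f) = signAct ε (residue i f) := by
  have : (laurentIn i).comp (signAct ε : RatField k →+* RatField k) =
      (laurentMap (signAct ε : RatField k →+* RatField k)).comp (laurentIn i) := by
    apply ratField_hom_ext
    intro j
    by_cases h : j = i
    · subst h
      simp [signAct_ratVar, laurentIn_self, laurentMap_single, hε]
    · by_cases hj : ε j = 1 <;>
      simp [signAct_ratVar, laurentIn_of_ne h, laurentMap_single, hj]
  rw [residue_eq_coeff, residue_eq_coeff]
  have e := RingHom.congr_fun this f
  simp only [RingHom.comp_apply, RingHom.coe_coe] at e
  rw [e, laurentMap_coeff]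
  rfl

theorem signAct_mul (ε δ : Fin k → ℤˣ) (f : RatField k) :
    signAct ε (signAct δ f) = signAct (ε * δ) f := by
  have : (signAct ε : RatField k →+* RatField k).comp (signAct δ : RatField k →+* RatField k) =
      (signAct (ε * δ) : RatField k →+* RatField k) := by
    apply ratField_hom_ext
    intro j
    rcases Int.units_eq_one_or (ε j) with h | h <;>
      rcases Int.units_eq_one_or (δ j) with h' | h' <;>
      simp [signAct_ratVar, h, h']
  exact RingHom.congr_fun this f

theorem signAct_one (f : RatField k) : signAct 1 f = f := by
  have : ((signAct 1 : RatField k ≃+* RatField k) : RatField k →+* RatField k) = RingHom.id _ := by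
    apply ratField_hom_ext
    intro j
    simp [signAct_ratVar]
  exact RingHom.congr_fun this f

/-- Laurent expansion at `x_i = 0` (`s = 1`) or at `x_i = 1` (`s = -1`), in the local
coordinate `x_i` or `1 - x_i`. -/
noncomputable def localExp (p : Fin k × ℤˣ) : RatField k →+* LaurentSeries (RatField k) :=
  (laurentIn p.1).comp (signAct (Pi.mulSingle p.1 p.2) : RatField k →+* RatField k)

/-- The local coordinate at `x_i = 0` or at `x_i = 1`. -/
noncomputable def localVar (p : Fin k × ℤˣ) : RatField k :=
  if p.2 = 1 then ratVar p.1 else 1 - ratVar p.1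

/-- The residue with respect to the local coordinate at `x_i = 0` or at `x_i = 1`. -/
noncomputable def res (p : Fin k × ℤˣ) (f : RatField k) : RatField k :=
  (localExp p f).coeff (-1)

theorem res_one (i : Fin k) (f : RatField k) : res (i, 1) f = residue i f := by
  simp [res, localExp, residue_eq_coeff, signAct_one]

theorem res_eq_residue (p : Fin k × ℤˣ) (f : RatField k) :
    res p f = residue p.1 (signAct (Pi.mulSingle p.1 p.2) f) := rfl

theorem localExp_self (p : Fin k × ℤˣ) :
    localExp p (ratVar p.1) = if p.2 = 1 then single 1 1 else 1 - single 1 1 := by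
  simp only [localExp, RingHom.comp_apply, RingHom.coe_coe, signAct_ratVar, Pi.mulSingle_eq_same]
  split_ifs <;> simp [laurentIn_self]

theorem localExp_of_ne {p : Fin k × ℤˣ} {j : Fin k} (h : j ≠ p.1) :
    localExp p (ratVar j) = C (ratVar j) := by
  simp [localExp, signAct_ratVar, h, laurentIn_of_ne h]

theorem localExp_localVar (p : Fin k × ℤˣ) : localExp p (localVar p) = single 1 1 := by
  unfold localVar
  by_cases h : p.2 = 1 <;> simp [localExp_self, h]

theorem res_add (p : Fin k × ℤˣ) (f g : RatField k) : res p (f + g) = res p f + res p g := by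
  simp [res]

theorem res_sub (p : Fin k × ℤˣ) (f g : RatField k) : res p (f - g) = res p f - res p g := by
  simp [res]

theorem res_zero (p : Fin k × ℤˣ) : res p 0 = 0 := by
  simp [res]

theorem res_neg (p : Fin k × ℤˣ) (f : RatField k) : res p (-f) = -res p f := by
  simp [res]

theorem res_sum {ι : Type*} (p : Fin k × ℤˣ) (s : Finset ι) (f : ι → RatField k) :
    res p (∑ a ∈ s, f a) = ∑ a ∈ s, res p (f a) := by
  classical
  induction s using Finset.induction_on with
  | empty => simp [res_zero]
  | insert a s ha ih => rw [Finset.sum_insert ha, Finset.sum_insert ha, res_add, ih]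

/-- `h` does not involve the variable `x_i`. -/
def IsFree (i : Fin k) (h : RatField k) : Prop :=
  ∀ s : ℤˣ, localExp (i, s) h = C h

theorem res_free_mul {p : Fin k × ℤˣ} {h : RatField k} (hh : IsFree p.1 h) (f : RatField k) :
    res p (h * f) = h * res p f := by
  rw [res, map_mul, hh p.2, HahnSeries.C_mul_eq_smul, HahnSeries.coeff_smul, res]
  rfl

theorem localExp_localVar_zpow (p : Fin k × ℤˣ) (n : ℤ) :
    localExp p (localVar p ^ n) = single n 1 := by
  rw [map_zpow₀, localExp_localVar, ← RatFunc.single_zpow]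

theorem res_localVar_zpow (p : Fin k × ℤˣ) (n : ℤ) :
    res p (localVar p ^ n) = if n = -1 then 1 else 0 := by
  rw [res, localExp_localVar_zpow, HahnSeries.coeff_single]
  simp [eq_comm]

/-- The subring of rational functions without a pole at the point `p`. -/
noncomputable def regular (p : Fin k × ℤˣ) : Subring (RatField k) :=
  (HahnSeries.ofPowerSeries ℤ (RatField k)).range.comap (localExp p)

theorem res_regular {p : Fin k × ℤˣ} {f : RatField k} (hf : f ∈ regular p) : res p f = 0 := by
  obtain ⟨g, hg⟩ := hf
  rw [res, ← hg, HahnSeries.ofPowerSeries_apply]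
  apply HahnSeries.embDomain_of_notMem_range
  simp

theorem localExp_zero_self (i : Fin k) :
    localExp (i, 1) (ratVar i) = HahnSeries.ofPowerSeries ℤ _ PowerSeries.X := by
  rw [localExp_self, if_pos rfl, HahnSeries.ofPowerSeries_X]

theorem localExp_one_self (i : Fin k) :
    localExp (i, -1) (ratVar i) = HahnSeries.ofPowerSeries ℤ _ (1 - PowerSeries.X) := by
  rw [localExp_self, if_neg (by simp), map_sub, RingHom.map_one, HahnSeries.ofPowerSeries_X]

theorem IsFree.localExp_eq {p : Fin k × ℤˣ} {h : RatField k} (hh : IsFree p.1 h) :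
    localExp p h = HahnSeries.ofPowerSeries ℤ _ (PowerSeries.C h) := by
  rw [HahnSeries.ofPowerSeries_C]
  exact hh p.2

theorem regular_inv {p : Fin k × ℤˣ} {f : RatField k} {g : PowerSeries (RatField k)}
    (hf : localExp p f = HahnSeries.ofPowerSeries ℤ _ g) (hg : PowerSeries.constantCoeff g ≠ 0) :
    f⁻¹ ∈ regular p := by
  refine ⟨g⁻¹, ?_⟩
  rw [map_inv₀, hf]
  apply eq_inv_of_mul_eq_one_left
  rw [← map_mul, PowerSeries.inv_mul_cancel g hg, map_one]

theorem IsFree.mem_regular {p : Fin k × ℤˣ} {h : RatField k} (hh : IsFree p.1 h) :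
    h ∈ regular p :=
  ⟨PowerSeries.C h, by rw [HahnSeries.ofPowerSeries_C]; exact (hh p.2).symm⟩

/-- The subfield of rational functions that do not involve `x_i`. -/
noncomputable def freeSubfield (i : Fin k) : Subfield (RatField k) :=
  ⨅ s : ℤˣ, (localExp (i, s)).eqLocusField C

theorem mem_freeSubfield {i : Fin k} {h : RatField k} : h ∈ freeSubfield i ↔ IsFree i h := by
  simp [freeSubfield, IsFree, Subfield.mem_iInf, RingHom.mem_eqLocusField]

theorem isFree_ratVar {i j : Fin k} (h : j ≠ i) : IsFree i (ratVar j) :=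
  fun _ => localExp_of_ne h

end MagogResidue

namespace MagogResidue

/-! ### Functions with prescribed poles -/

open HahnSeries

variable {k : ℕ}

/-- The algebra of rational functions in the variables `x_i`, `i ∈ S`, whose only possible poles
are along `x_i = 0` for `i ∈ P`, along `x_i = 1` for `i ∈ Q`, and along `∏_{i ∈ T} x_i = 1` for
`T ⊆ S` with at least two elements. -/
noncomputable def poleAlg (S P Q : Finset (Fin k)) : Subalgebra ℚ (RatField k) :=
  Algebra.adjoin ℚ ({f | ∃ i ∈ S, f = ratVar i} ∪ {f | ∃ i ∈ P, f = (ratVar i)⁻¹} ∪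
    {f | ∃ i ∈ Q, f = (1 - ratVar i)⁻¹} ∪
    {f | ∃ T ⊆ S, 2 ≤ T.card ∧ f = (1 - ∏ i ∈ T, ratVar i)⁻¹})

section poleAlg

variable {S P Q : Finset (Fin k)}

theorem ratVar_mem {i : Fin k} (h : i ∈ S) : ratVar i ∈ poleAlg S P Q :=
  Algebra.subset_adjoin (Or.inl (Or.inl (Or.inl ⟨i, h, rfl⟩)))

theorem inv_ratVar_mem {i : Fin k} (h : i ∈ P) : (ratVar i)⁻¹ ∈ poleAlg S P Q :=
  Algebra.subset_adjoin (Or.inl (Or.inl (Or.inr ⟨i, h, rfl⟩)))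

theorem inv_one_sub_ratVar_mem {i : Fin k} (h : i ∈ Q) : (1 - ratVar i)⁻¹ ∈ poleAlg S P Q :=
  Algebra.subset_adjoin (Or.inl (Or.inr ⟨i, h, rfl⟩))

theorem inv_one_sub_prod_mem {T : Finset (Fin k)} (h : T ⊆ S) (h2 : 2 ≤ T.card) :
    (1 - ∏ i ∈ T, ratVar i)⁻¹ ∈ poleAlg S P Q :=
  Algebra.subset_adjoin (Or.inr ⟨T, h, h2, rfl⟩)

theorem prod_ratVar_mem {T : Finset (Fin k)} (h : T ⊆ S) :
    ∏ i ∈ T, ratVar i ∈ poleAlg S P Q :=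
  prod_mem fun _ hi => ratVar_mem (h hi)

theorem poleAlg_induction {motive : RatField k → Prop}
    (hC : ∀ r : ℚ, motive (algebraMap ℚ (RatField k) r))
    (hS : ∀ i ∈ S, motive (ratVar i)) (hP : ∀ i ∈ P, motive (ratVar i)⁻¹)
    (hQ : ∀ i ∈ Q, motive (1 - ratVar i)⁻¹)
    (hT : ∀ T ⊆ S, 2 ≤ T.card → motive (1 - ∏ i ∈ T, ratVar i)⁻¹)
    (hadd : ∀ x ∈ poleAlg S P Q, ∀ y ∈ poleAlg S P Q, motive x → motive y → motive (x + y))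
    (hmul : ∀ x ∈ poleAlg S P Q, ∀ y ∈ poleAlg S P Q, motive x → motive y → motive (x * y))
    {f : RatField k} (hf : f ∈ poleAlg S P Q) : motive f := by
  refine Algebra.adjoin_induction (p := fun x _ => motive x) ?_ hC
    (fun x y hx hy => hadd x hx y hy) (fun x y hx hy => hmul x hx y hy) hf
  rintro x (((⟨i, hi, rfl⟩ | ⟨i, hi, rfl⟩) | ⟨i, hi, rfl⟩) | ⟨T, hT1, hT2, rfl⟩)
  · exact hS i hi
  · exact hP i hi
  · exact hQ i hi
  · exact hT T hT1 hT2

theorem poleAlg_mono {S' P' Q' : Finset (Fin k)} (hS : S ⊆ S') (hP : P ⊆ P') (hQ : Q ⊆ Q') :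
    poleAlg S P Q ≤ poleAlg S' P' Q' := by
  intro f hf
  exact poleAlg_induction (fun r => Subalgebra.algebraMap_mem _ r)
    (fun i hi => ratVar_mem (hS hi)) (fun i hi => inv_ratVar_mem (hP hi))
    (fun i hi => inv_one_sub_ratVar_mem (hQ hi))
    (fun T hT h2 => inv_one_sub_prod_mem (hT.trans hS) h2)
    (fun _ _ _ _ => add_mem) (fun _ _ _ _ => mul_mem) hf

theorem isFree_of_mem_poleAlg {i : Fin k} (hS : i ∉ S) (hP : i ∉ P) (hQ : i ∉ Q)
    {f : RatField k} (hf : f ∈ poleAlg S P Q) : IsFree i f := by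
  rw [← mem_freeSubfield]
  have hv : ∀ j, j ≠ i → ratVar j ∈ freeSubfield i := fun _ hj =>
    mem_freeSubfield.2 (isFree_ratVar hj)
  refine poleAlg_induction (motive := fun f => f ∈ freeSubfield i) (fun r => ?_)
    (fun j hj => hv j ?_) (fun j hj => inv_mem (hv j ?_))
    (fun j hj => inv_mem (sub_mem (one_mem _) (hv j ?_)))
    (fun T hT _ => inv_mem (sub_mem (one_mem _) (prod_mem fun j hj => hv j ?_)))
    (fun _ _ _ _ => add_mem) (fun _ _ _ _ => mul_mem) hf
  · rw [eq_ratCast]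
    exact SubfieldClass.ratCast_mem _ r
  · exact fun e => hS (e ▸ hj)
  · exact fun e => hP (e ▸ hj)
  · exact fun e => hQ (e ▸ hj)
  · exact fun e => hS (e ▸ hT hj)

end poleAlg

theorem isFree_ratCast (i : Fin k) (r : ℚ) : IsFree i (algebraMap ℚ (RatField k) r) := by
  rw [← mem_freeSubfield, eq_ratCast]
  exact SubfieldClass.ratCast_mem _ r

theorem one_sub_ratVar_ne_zero (i : Fin k) : (1 : RatField k) - ratVar i ≠ 0 := by
  intro h
  have := congrArg (signAct fun _ => -1) h
  simp only [map_sub, map_one, map_zero, signAct_ratVar] at this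
  norm_num at this
  exact ratVar_ne_zero i this

theorem isFree_prod_erase (T : Finset (Fin k)) (i : Fin k) :
    IsFree i (∏ j ∈ T.erase i, (ratVar j : RatField k)) :=
  mem_freeSubfield.1 (prod_mem fun _ hj =>
    mem_freeSubfield.2 (isFree_ratVar (Finset.ne_of_mem_erase hj)))

theorem localExp_one_sub_mul (i : Fin k) {c : RatField k} (hc : IsFree i c) :
    localExp (i, 1) (1 - ratVar i * c) =
      HahnSeries.ofPowerSeries ℤ _ (1 - PowerSeries.X * PowerSeries.C c) := by
  rw [map_sub, map_mul, IsFree.localExp_eq (p := (i, 1)) hc, localExp_zero_self, map_one, map_sub,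
    map_mul, map_one]

theorem one_sub_prod_ne_zero {T : Finset (Fin k)} (hT : T.Nonempty) :
    (1 : RatField k) - ∏ i ∈ T, ratVar i ≠ 0 := by
  obtain ⟨i, hi⟩ := hT
  intro h
  have h1 := localExp_one_sub_mul i (isFree_prod_erase T i)
  rw [Finset.mul_prod_erase T _ hi, h, map_zero] at h1
  have h2 := HahnSeries.ofPowerSeries_injective (Γ := ℤ)
    (h1.symm.trans (map_zero (HahnSeries.ofPowerSeries ℤ (RatField k))).symm)
  simpa using congrArg PowerSeries.constantCoeff h2

theorem inv_one_sub_mul_mem_regular (i : Fin k) {c : RatField k} (hc : IsFree i c) :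
    (1 - ratVar i * c)⁻¹ ∈ regular (i, 1) :=
  regular_inv (localExp_one_sub_mul i hc) (by simp)

theorem IsFree.sub_inv {i : Fin k} {h : RatField k} (hh : IsFree i h) :
    IsFree i (1 - h)⁻¹ :=
  mem_freeSubfield.1 (inv_mem (sub_mem (one_mem _) (mem_freeSubfield.2 hh)))

theorem IsFree.inv {i : Fin k} {h : RatField k} (hh : IsFree i h) : IsFree i h⁻¹ :=
  mem_freeSubfield.1 (inv_mem (mem_freeSubfield.2 hh))

theorem ratVar_mem_regular_zero (i j : Fin k) : ratVar j ∈ regular (i, 1) := by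
  by_cases h : j = i
  · subst h
    exact ⟨_, (localExp_zero_self j).symm⟩
  · exact IsFree.mem_regular (p := (i, 1)) (isFree_ratVar h)

theorem ratVar_mem_regular_one (i j : Fin k) : ratVar j ∈ regular (i, -1) := by
  by_cases h : j = i
  · subst h
    exact ⟨_, (localExp_one_self j).symm⟩
  · exact IsFree.mem_regular (p := (i, -1)) (isFree_ratVar h)

theorem inv_one_sub_prod_mem_regular_zero (i : Fin k) (T : Finset (Fin k)) :
    (1 - ∏ j ∈ T, ratVar j)⁻¹ ∈ regular (i, 1) := by
  by_cases h : i ∈ T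
  · rw [← Finset.mul_prod_erase T _ h]
    exact inv_one_sub_mul_mem_regular i (isFree_prod_erase T i)
  · rw [← Finset.erase_eq_of_notMem h]
    exact IsFree.mem_regular (p := (i, 1)) (isFree_prod_erase T i).sub_inv

/-- At `x_i = 1` the denominator takes the value `1 - ∏_{j ∈ T \ {i}} x_j`. It is nonzero because `T
\ {i}` is nonempty, which is where the two elements of `T` are needed. -/
theorem inv_one_sub_prod_mem_regular_one (i : Fin k) {T : Finset (Fin k)} (hT : 2 ≤ T.card) :
    (1 - ∏ j ∈ T, ratVar j)⁻¹ ∈ regular (i, -1) := by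
  by_cases h : i ∈ T
  · rw [← Finset.mul_prod_erase T _ h]
    have hne : (T.erase i).Nonempty := by
      rw [← Finset.card_pos, Finset.card_erase_of_mem h]; omega
    refine regular_inv (g := 1 - (1 - PowerSeries.X) *
      PowerSeries.C (∏ j ∈ T.erase i, ratVar j)) ?_ ?_
    · rw [map_sub, map_mul, IsFree.localExp_eq (p := (i, -1)) (isFree_prod_erase T i),
        localExp_one_self]
      simp only [map_sub, map_mul, map_one]
    · simpa using one_sub_prod_ne_zero hne
  · rw [← Finset.erase_eq_of_notMem h]
    exact IsFree.mem_regular (p := (i, -1)) (isFree_prod_erase T i).sub_inv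

theorem mem_regular_zero {S P Q : Finset (Fin k)} {i : Fin k} (hi : i ∉ P)
    {f : RatField k} (hf : f ∈ poleAlg S P Q) : f ∈ regular (i, 1) := by
  refine poleAlg_induction (motive := fun f => f ∈ regular (i, 1))
    (fun r => IsFree.mem_regular (p := (i, 1)) (isFree_ratCast i r))
    (fun j _ => ratVar_mem_regular_zero i j)
    (fun j hj => IsFree.mem_regular (p := (i, 1)) (isFree_ratVar fun e : j = i => hi (e ▸ hj)).inv)
    (fun j _ => ?_) (fun T _ _ => inv_one_sub_prod_mem_regular_zero i T)
    (fun x _ y _ hx hy => (regular (i, 1)).add_mem hx hy)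
    (fun x _ y _ hx hy => (regular (i, 1)).mul_mem hx hy) hf
  simpa using inv_one_sub_prod_mem_regular_zero i {j}

theorem mem_regular_one {S P Q : Finset (Fin k)} {i : Fin k} (hi : i ∉ Q)
    {f : RatField k} (hf : f ∈ poleAlg S P Q) : f ∈ regular (i, -1) := by
  refine poleAlg_induction (motive := fun f => f ∈ regular (i, -1))
    (fun r => IsFree.mem_regular (p := (i, -1)) (isFree_ratCast i r))
    (fun j _ => ratVar_mem_regular_one i j) (fun j _ => ?_)
    (fun j hj => IsFree.mem_regular (p := (i, -1))
      (isFree_ratVar fun e : j = i => hi (e ▸ hj)).sub_inv)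
    (fun T _ h2 => inv_one_sub_prod_mem_regular_one i h2)
    (fun x _ y _ hx hy => (regular (i, -1)).add_mem hx hy)
    (fun x _ y _ hx hy => (regular (i, -1)).mul_mem hx hy) hf
  by_cases h : j = i
  · subst h
    exact regular_inv (localExp_one_self j) (by simp)
  · exact IsFree.mem_regular (p := (i, -1)) (isFree_ratVar h).inv

/-! ### Polar parts -/

/-- The hypothesis `hdiv` plays the role of evaluation at `t = 0`, with values in `B`. Applied to `t
^ (N + 1) * F` it yields the coefficient of the deepest polar term; subtracting that term lowers the
order of the pole by one. -/
theorem exists_polar_part {A B : Subalgebra ℚ (RatField k)} {t : RatField k} (ht : t ≠ 0)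
    (hdiv : ∀ F ∈ A, ∃ h ∈ B, ∃ F' ∈ A, F = h + t * F') (N : ℕ) :
    ∀ F, t ^ (N + 1) * F ∈ A → ∃ h : ℕ → RatField k, (∀ m, h m ∈ B) ∧ ∃ F' ∈ A,
      F = ∑ m ∈ Finset.range (N + 1), h m * t ^ (-(m + 1) : ℤ) + F' := by
  induction N with
  | zero =>
    intro F hF
    obtain ⟨h, hh, F', hF', e⟩ := hdiv _ hF
    refine ⟨fun _ => h, fun _ => hh, F', hF', ?_⟩
    simp only [zero_add, pow_one, Finset.sum_range_one, Nat.cast_zero, zpow_neg, zpow_one] at e ⊢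
    field_simp
    linear_combination e
  | succ N ih =>
    intro F hF
    obtain ⟨h, hh, F', hF', e⟩ := hdiv _ hF
    have key : t ^ (N + 1) * (F - h * t ^ (-((N + 1 : ℕ) + 1) : ℤ)) = F' := by
      have : t ^ (-((N + 1 : ℕ) + 1) : ℤ) = (t ^ (N + 1 + 1))⁻¹ := by
        rw [zpow_neg]; norm_cast
      rw [this]
      apply mul_left_cancel₀ ht
      rw [mul_sub, mul_sub, ← mul_assoc, ← mul_assoc, ← mul_assoc, ← pow_succ', e,
        mul_comm _ h, mul_assoc h, mul_inv_cancel₀ (pow_ne_zero _ ht)]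
      ring
    obtain ⟨g, hg, G, hG, eG⟩ := ih _ (by rw [key]; exact hF')
    refine ⟨Function.update g (N + 1) h, fun m => ?_, G, hG, ?_⟩
    · by_cases hm : m = N + 1
      · subst hm; simpa using hh
      · simpa [hm] using hg m
    · rw [Finset.sum_range_succ, Finset.sum_congr rfl
        (g := fun m : ℕ => g m * t ^ (-(m + 1) : ℤ)) (fun m hm => by
          rw [Function.update_of_ne (Finset.mem_range.1 hm).ne]), Function.update_self]
      linear_combination eG

theorem res_polar_part {p : Fin k × ℤˣ} {h : ℕ → RatField k} (hh : ∀ m, IsFree p.1 (h m))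
    {G : RatField k} (hG : G ∈ regular p) (N : ℕ) :
    res p (∑ m ∈ Finset.range (N + 1), h m * localVar p ^ (-(m + 1) : ℤ) + G) = h 0 := by
  rw [res_add, res_regular hG, res_sum, add_zero, Finset.sum_eq_single 0]
  · rw [res_free_mul (hh 0), res_localVar_zpow]; simp
  · intro m _ hm
    rw [res_free_mul (hh m), res_localVar_zpow, if_neg (by omega), mul_zero]
  · simp

/-- Only the generators with a pole along `t = 0` need a power of `t`, and exponents may be added
for sums and products. -/
theorem exists_pow_mul_mem {A' : Subalgebra ℚ (RatField k)} {S P Q : Finset (Fin k)}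
    {t : RatField k} (htA : t ∈ A')
    (hS : ∀ i ∈ S, ratVar i ∈ A') (hP : ∀ i ∈ P, ∃ N, t ^ N * (ratVar i)⁻¹ ∈ A')
    (hQ : ∀ i ∈ Q, ∃ N, t ^ N * (1 - ratVar i)⁻¹ ∈ A')
    (hT : ∀ T ⊆ S, 2 ≤ T.card → (1 - ∏ i ∈ T, ratVar i)⁻¹ ∈ A')
    {F : RatField k} (hF : F ∈ poleAlg S P Q) : ∃ N, t ^ N * F ∈ A' := by
  refine poleAlg_induction (motive := fun F => ∃ N, t ^ N * F ∈ A')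
    (fun r => ⟨0, by simpa using Subalgebra.algebraMap_mem A' r⟩)
    (fun i hi => ⟨0, by simpa using hS i hi⟩) hP hQ
    (fun T h1 h2 => ⟨0, by simpa using hT T h1 h2⟩) ?_ ?_ hF
  · rintro x - y - ⟨N, hN⟩ ⟨M, hM⟩
    refine ⟨N + M, ?_⟩
    have : t ^ (N + M) * (x + y) = t ^ M * (t ^ N * x) + t ^ N * (t ^ M * y) := by ring
    rw [this]
    exact add_mem (mul_mem (pow_mem htA _) hN) (mul_mem (pow_mem htA _) hM)
  · rintro x - y - ⟨N, hN⟩ ⟨M, hM⟩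
    refine ⟨N + M, ?_⟩
    have : t ^ (N + M) * (x * y) = (t ^ N * x) * (t ^ M * y) := by ring
    rw [this]
    exact mul_mem hN hM

/-- Evaluation at `t = 0` respects sums and products, so it suffices to evaluate the generators. -/
theorem exists_eq_add_mul {S P Q : Finset (Fin k)} {B : Subalgebra ℚ (RatField k)}
    {t : RatField k} (htA : t ∈ poleAlg S P Q)
    (hS : ∀ i ∈ S, ∃ h ∈ B, ∃ F' ∈ poleAlg S P Q, ratVar i = h + t * F')
    (hP : ∀ i ∈ P, ∃ h ∈ B, ∃ F' ∈ poleAlg S P Q, (ratVar i)⁻¹ = h + t * F')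
    (hQ : ∀ i ∈ Q, ∃ h ∈ B, ∃ F' ∈ poleAlg S P Q, (1 - ratVar i)⁻¹ = h + t * F')
    (hT : ∀ T ⊆ S, 2 ≤ T.card →
      ∃ h ∈ B, ∃ F' ∈ poleAlg S P Q, (1 - ∏ i ∈ T, ratVar i)⁻¹ = h + t * F')
    {F : RatField k} (hF : F ∈ poleAlg S P Q) :
    ∃ h ∈ B, ∃ F' ∈ poleAlg S P Q, F = h + t * F' := by
  refine poleAlg_induction (motive := fun F => ∃ h ∈ B, ∃ F' ∈ poleAlg S P Q, F = h + t * F')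
    (fun r => ⟨_, Subalgebra.algebraMap_mem B r, 0, zero_mem _, by simp⟩) hS hP hQ hT ?_ ?_ hF
  · rintro x - y - ⟨h, hh, x', hx', e⟩ ⟨g, hg, y', hy', e'⟩
    exact ⟨h + g, add_mem hh hg, x' + y', add_mem hx' hy', by rw [e, e']; ring⟩
  · rintro x hx y hy ⟨h, hh, x', hx', e⟩ ⟨g, hg, y', hy', e'⟩
    -- The cofactor is `h * y' + x' * y`. Here `h` is written as `x - t * x'`, since `B` is not
    -- assumed to lie in `poleAlg S P Q`.
    refine ⟨h * g, mul_mem hh hg, (x - t * x') * y' + x' * y,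
      add_mem (mul_mem (sub_mem hx (mul_mem htA hx')) hy') (mul_mem hx' hy), ?_⟩
    rw [e, e']; ring

end MagogResidue

namespace MagogResidue

/-! ### Residues of functions with prescribed poles -/

open HahnSeries

variable {k : ℕ}

section PolarPart

variable {S P Q : Finset (Fin k)}

theorem exists_polar_part_zero {i : Fin k} (hi : i ∈ S) {F : RatField k}
    (hF : F ∈ poleAlg S P Q) :
    ∃ (N : ℕ) (h : ℕ → RatField k), (∀ m, h m ∈ poleAlg (S.erase i) (P.erase i) (Q.erase i)) ∧
      ∃ F' ∈ poleAlg S (P.erase i) Q,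
      F = ∑ m ∈ Finset.range (N + 1), h m * ratVar i ^ (-(m + 1) : ℤ) + F' := by
  have ht : ratVar i ∈ poleAlg S (P.erase i) Q := ratVar_mem hi
  obtain ⟨N, hN⟩ := exists_pow_mul_mem (A' := poleAlg S (P.erase i) Q) ht
    (fun j hj => ratVar_mem hj) (fun j hj => by
      by_cases h : j = i
      · subst h
        exact ⟨1, by rw [pow_one, mul_inv_cancel₀ (ratVar_ne_zero j)]; exact one_mem _⟩
      · exact ⟨0, by simpa using inv_ratVar_mem (Finset.mem_erase.2 ⟨h, hj⟩)⟩)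
    (fun j hj => ⟨0, by simpa using inv_one_sub_ratVar_mem hj⟩)
    (fun T h1 h2 => inv_one_sub_prod_mem h1 h2) hF
  refine ⟨N, exists_polar_part (ratVar_ne_zero i) (fun G hG => exists_eq_add_mul ht
    (fun j hj => ?_) (fun j hj => ?_) (fun j hj => ?_) (fun T hT h2 => ?_) hG) N F ?_⟩
  · by_cases h : j = i
    · subst h
      exact ⟨0, zero_mem _, 1, one_mem _, by simp⟩
    · exact ⟨_, ratVar_mem (Finset.mem_erase.2 ⟨h, hj⟩), 0, zero_mem _, by simp⟩
  · exact ⟨_, inv_ratVar_mem hj, 0, zero_mem _, by simp⟩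
  · by_cases h : j = i
    · subst h
      refine ⟨1, one_mem _, _, inv_one_sub_ratVar_mem hj, ?_⟩
      field [one_sub_ratVar_ne_zero j]
    · exact ⟨_, inv_one_sub_ratVar_mem (Finset.mem_erase.2 ⟨h, hj⟩), 0, zero_mem _, by simp⟩
  · by_cases h : i ∈ T
    · refine ⟨1, one_mem _, (∏ j ∈ T.erase i, ratVar j) * (1 - ∏ j ∈ T, ratVar j)⁻¹,
        mul_mem (prod_ratVar_mem ((Finset.erase_subset i T).trans hT))
          (inv_one_sub_prod_mem hT h2), ?_⟩
      have hne : (1 : RatField k) - ∏ j ∈ T, ratVar j ≠ 0 := one_sub_prod_ne_zero ⟨i, h⟩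
      rw [← mul_assoc, Finset.mul_prod_erase T _ h]
      field
    · refine ⟨_, inv_one_sub_prod_mem (Finset.subset_erase.2 ⟨hT, h⟩) h2, 0, zero_mem _, by simp⟩
  · rw [pow_succ', mul_assoc]
    exact mul_mem ht hN

/-- Setting `x_i = 1` in `1 - x_i x_j` leaves `1 - x_j`, a pole at `x_j = 1` for an arbitrary `j ∈
S`. Hence the third set has to be all of `S`. -/
theorem exists_polar_part_one {i : Fin k} (hi : i ∈ S) {F : RatField k}
    (hF : F ∈ poleAlg S P S) :
    ∃ (N : ℕ) (h : ℕ → RatField k), (∀ m, h m ∈ poleAlg (S.erase i) (P.erase i) (S.erase i)) ∧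
      ∃ F' ∈ poleAlg S P (S.erase i),
      F = ∑ m ∈ Finset.range (N + 1), h m * (1 - ratVar i) ^ (-(m + 1) : ℤ) + F' := by
  have ht : 1 - ratVar i ∈ poleAlg S P (S.erase i) := sub_mem (one_mem _) (ratVar_mem hi)
  obtain ⟨N, hN⟩ := exists_pow_mul_mem (A' := poleAlg S P (S.erase i)) ht
    (fun j hj => ratVar_mem hj)
    (fun j hj => ⟨0, by simpa using inv_ratVar_mem hj⟩) (fun j hj => by
      by_cases h : j = i
      · subst h
        exact ⟨1, by rw [pow_one, mul_inv_cancel₀ (one_sub_ratVar_ne_zero j)]; exact one_mem _⟩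
      · exact ⟨0, by simpa using inv_one_sub_ratVar_mem (Finset.mem_erase.2 ⟨h, hj⟩)⟩)
    (fun T h1 h2 => inv_one_sub_prod_mem h1 h2) hF
  refine ⟨N, exists_polar_part (one_sub_ratVar_ne_zero i) (fun G hG => exists_eq_add_mul ht
    (fun j hj => ?_) (fun j hj => ?_) (fun j hj => ?_) (fun T hT h2 => ?_) hG) N F ?_⟩
  · by_cases h : j = i
    · subst h
      exact ⟨1, one_mem _, -1, neg_mem (one_mem _), by ring⟩
    · exact ⟨_, ratVar_mem (Finset.mem_erase.2 ⟨h, hj⟩), 0, zero_mem _, by simp⟩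
  · by_cases h : j = i
    · subst h
      refine ⟨1, one_mem _, _, inv_ratVar_mem hj, ?_⟩
      field [ratVar_ne_zero j]
    · exact ⟨_, inv_ratVar_mem (Finset.mem_erase.2 ⟨h, hj⟩), 0, zero_mem _, by simp⟩
  · exact ⟨_, inv_one_sub_ratVar_mem hj, 0, zero_mem _, by simp⟩
  · by_cases h : i ∈ T
    · have hsub : T.erase i ⊆ S.erase i := Finset.erase_subset_erase i hT
      have hcard := Finset.card_erase_of_mem h
      have hB : ∀ {S' P'}, T.erase i ⊆ S' →
          (1 - ∏ j ∈ T.erase i, ratVar j)⁻¹ ∈ poleAlg S' P' (S.erase i) := by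
        intro S' P' hS'
        by_cases h3 : 2 ≤ (T.erase i).card
        · exact inv_one_sub_prod_mem hS' h3
        · obtain ⟨j, hj⟩ := Finset.card_eq_one.1 (show (T.erase i).card = 1 by omega)
          rw [hj, Finset.prod_singleton]
          exact inv_one_sub_ratVar_mem (hsub (by simp [hj]))
      -- With `c` the product over `T \ {i}`, this is `1/(1 - x c) = 1/(1 - c) - (1 - x) c / ((1 - x
      -- c)(1 - c))`.
      refine ⟨_, hB hsub, -((∏ j ∈ T.erase i, ratVar j) * (1 - ∏ j ∈ T, ratVar j)⁻¹ *
        (1 - ∏ j ∈ T.erase i, ratVar j)⁻¹),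
        neg_mem (mul_mem (mul_mem (prod_ratVar_mem ((Finset.erase_subset i T).trans hT))
          (inv_one_sub_prod_mem hT h2)) (hB ((Finset.erase_subset i T).trans hT))), ?_⟩
      have hne : (1 : RatField k) - ∏ j ∈ T, ratVar j ≠ 0 := one_sub_prod_ne_zero ⟨i, h⟩
      have hne' : (1 : RatField k) - ∏ j ∈ T.erase i, ratVar j ≠ 0 :=
        one_sub_prod_ne_zero (Finset.card_pos.1 (by omega))
      rw [← Finset.mul_prod_erase T _ h] at hne ⊢
      generalize ∏ j ∈ T.erase i, (ratVar j : RatField k) = c at hne hne' ⊢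
      field
    · refine ⟨_, inv_one_sub_prod_mem (Finset.subset_erase.2 ⟨hT, h⟩) h2, 0, zero_mem _, by simp⟩
  · rw [pow_succ', mul_assoc]
    exact mul_mem ht hN

theorem isFree_erase {i : Fin k} {h : RatField k}
    (hh : h ∈ poleAlg (S.erase i) (P.erase i) (Q.erase i)) : IsFree i h :=
  isFree_of_mem_poleAlg (Finset.notMem_erase i S) (Finset.notMem_erase i P)
    (Finset.notMem_erase i Q) hh

theorem res_eq_zero_of_notMem {p : Fin k × ℤˣ} (hS : p.1 ∉ S) (hP : P ⊆ S) {F : RatField k}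
    (hF : F ∈ poleAlg S P S) : res p F = 0 :=
  res_regular (isFree_of_mem_poleAlg hS (fun h => hS (hP h)) hS hF).mem_regular

theorem localVar_zero (i : Fin k) : localVar (i, 1) = ratVar i := if_pos rfl

theorem localVar_one (i : Fin k) : localVar (i, -1) = 1 - ratVar i := if_neg (by simp)

theorem res_polar_zero {i : Fin k} {h : ℕ → RatField k} (hh : ∀ m, IsFree i (h m))
    {G : RatField k} (hG : G ∈ regular (i, 1)) (N : ℕ) :
    res (i, 1) (∑ m ∈ Finset.range (N + 1), h m * ratVar i ^ (-(m + 1) : ℤ) + G) = h 0 := by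
  rw [← localVar_zero]
  exact res_polar_part (p := (i, 1)) hh hG N

theorem res_polar_one {i : Fin k} {h : ℕ → RatField k} (hh : ∀ m, IsFree i (h m))
    {G : RatField k} (hG : G ∈ regular (i, -1)) (N : ℕ) :
    res (i, -1) (∑ m ∈ Finset.range (N + 1), h m * (1 - ratVar i) ^ (-(m + 1) : ℤ) + G) =
      h 0 := by
  rw [← localVar_one]
  exact res_polar_part (p := (i, -1)) hh hG N

theorem res_mem {p : Fin k × ℤˣ} (hP : P ⊆ S) {F : RatField k} (hF : F ∈ poleAlg S P S) :
    res p F ∈ poleAlg (S.erase p.1) (P.erase p.1) (S.erase p.1) := by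
  by_cases hS : p.1 ∈ S
  · obtain ⟨i, s⟩ := p
    rcases Int.units_eq_one_or s with rfl | rfl
    · obtain ⟨N, h, hh, F', hF', e⟩ := exists_polar_part_zero hS hF
      rw [e, res_polar_zero (fun m => isFree_erase (hh m))
        (mem_regular_zero (Finset.notMem_erase i P) hF') N]
      exact hh 0
    · obtain ⟨N, h, hh, F', hF', e⟩ := exists_polar_part_one hS hF
      rw [e, res_polar_one (fun m => isFree_erase (hh m))
        (mem_regular_one (Finset.notMem_erase i S) hF') N]
      exact hh 0
  · rw [res_eq_zero_of_notMem hS hP hF]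
    exact zero_mem _

/-- In the polar part of `F` at `x_i = 0`, the residue at `p` acts on the coefficients alone,
because powers of `x_i` are constants for it. The remainder stays regular at `x_i = 0` since
`res_mem` creates no new poles there. Both orders thus give the residue at `p` of the coefficient of
`x_i⁻¹`. -/
theorem res_comm {i : Fin k} {p : Fin k × ℤˣ} (hip : i ≠ p.1) (hP : P ⊆ S) {F : RatField k}
    (hF : F ∈ poleAlg S P S) : res (i, 1) (res p F) = res p (res (i, 1) F) := by
  by_cases hS : i ∈ S
  · obtain ⟨N, h, hh, F', hF', e⟩ := exists_polar_part_zero hS hF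
    have h1 : res (i, 1) F = h 0 := by
      rw [e]
      exact res_polar_zero (fun m => isFree_erase (hh m))
        (mem_regular_zero (Finset.notMem_erase i P) hF') N
    have h2 : res p F = ∑ m ∈ Finset.range (N + 1), res p (h m) * ratVar i ^ (-(m + 1) : ℤ) +
        res p F' := by
      rw [e, res_add, res_sum]
      congr 1
      refine Finset.sum_congr rfl fun m _ => ?_
      rw [mul_comm, res_free_mul (mem_freeSubfield.1
        (zpow_mem (mem_freeSubfield.2 (isFree_ratVar hip)) _)), mul_comm]
    have hm : ∀ m, IsFree i (res p (h m)) := fun m => by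
      have := res_mem (p := p) (Finset.erase_subset_erase i hP) (hh m)
      exact isFree_of_mem_poleAlg (by simp) (by simp) (by simp) this
    have h3 : res p F' ∈ regular (i, 1) :=
      mem_regular_zero (by simp) (res_mem (p := p) ((Finset.erase_subset i P).trans hP) hF')
    rw [h1, h2]
    exact res_polar_zero hm h3 N
  · rw [res_eq_zero_of_notMem (p := (i, 1)) hS hP hF, res_zero]
    refine res_eq_zero_of_notMem (p := (i, 1)) ?_ (Finset.erase_subset_erase p.1 hP)
      (res_mem hP hF)
    simp [hS]

end PolarPart

/-! ### Iterated residues -/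

/-- Iterated residues at the points of a list; the last point of the list is processed first. -/
noncomputable def iterRes (l : List (Fin k × ℤˣ)) (F : RatField k) : RatField k :=
  l.foldr res F

theorem iterRes_nil (F : RatField k) : iterRes [] F = F := rfl

theorem iterRes_cons (p : Fin k × ℤˣ) (l : List (Fin k × ℤˣ)) (F : RatField k) :
    iterRes (p :: l) F = res p (iterRes l F) := rfl

theorem iterRes_append (l m : List (Fin k × ℤˣ)) (F : RatField k) :
    iterRes (l ++ m) F = iterRes l (iterRes m F) := by
  simp [iterRes]

theorem iterRes_add (l : List (Fin k × ℤˣ)) (F G : RatField k) :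
    iterRes l (F + G) = iterRes l F + iterRes l G := by
  induction l with
  | nil => rfl
  | cons p l ih => simp only [iterRes_cons, ih, res_add]

theorem iterRes_zero (l : List (Fin k × ℤˣ)) : iterRes l (0 : RatField k) = 0 := by
  induction l with
  | nil => rfl
  | cons p l ih => simp only [iterRes_cons, ih, res_zero]

theorem iterRes_sum {ι : Type*} (l : List (Fin k × ℤˣ)) (s : Finset ι) (f : ι → RatField k) :
    iterRes l (∑ a ∈ s, f a) = ∑ a ∈ s, iterRes l (f a) := by
  classical
  induction s using Finset.induction_on with
  | empty => simp [iterRes_zero]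
  | insert a s ha ih => rw [Finset.sum_insert ha, Finset.sum_insert ha, iterRes_add, ih]

theorem iterRes_mem {S P : Finset (Fin k)} (hP : P ⊆ S) (l : List (Fin k × ℤˣ)) {F : RatField k}
    (hF : F ∈ poleAlg S P S) :
    ∃ S' P', P' ⊆ S' ∧ S' ⊆ S ∧ (∀ p ∈ l, p.1 ∉ S') ∧ iterRes l F ∈ poleAlg S' P' S' := by
  induction l with
  | nil => exact ⟨S, P, hP, subset_rfl, by simp, hF⟩
  | cons p l ih =>
    obtain ⟨S', P', h1, h2, h3, h4⟩ := ih
    refine ⟨S'.erase p.1, P'.erase p.1, Finset.erase_subset_erase _ h1,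
      (Finset.erase_subset _ _).trans h2, ?_, res_mem h1 h4⟩
    rintro q hq
    rcases List.mem_cons.1 hq with rfl | hq
    · simp
    · exact fun h => h3 q hq (Finset.mem_of_mem_erase h)

theorem iterRes_res_comm {S P : Finset (Fin k)} (hP : P ⊆ S) {i : Fin k}
    (l : List (Fin k × ℤˣ)) (hl : ∀ p ∈ l, i ≠ p.1) {F : RatField k} (hF : F ∈ poleAlg S P S) :
    iterRes l (res (i, 1) F) = res (i, 1) (iterRes l F) := by
  induction l with
  | nil => rfl
  | cons p l ih =>
    obtain ⟨S', P', h1, h2, h3, h4⟩ := iterRes_mem hP l hF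
    rw [iterRes_cons, iterRes_cons, ih fun q hq => hl q (List.mem_cons_of_mem _ hq),
      res_comm (hl p List.mem_cons_self) h1 h4]

/-- Iterated residues at the origin. -/
noncomputable def iterRes₀ (l : List (Fin k)) (F : RatField k) : RatField k :=
  iterRes (l.map fun i => (i, 1)) F

theorem iterRes₀_cons (i : Fin k) (l : List (Fin k)) (F : RatField k) :
    iterRes₀ (i :: l) F = residue i (iterRes₀ l F) := res_one _ _

theorem iterRes₀_append (l m : List (Fin k)) (F : RatField k) :
    iterRes₀ (l ++ m) F = iterRes₀ l (iterRes₀ m F) := by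
  simp [iterRes₀, iterRes_append]

theorem iterRes₀_finRange (F : RatField k) : iterRes₀ (List.finRange k) F = iteratedResidue F := by
  rw [iteratedResidue]
  induction List.finRange k with
  | nil => rfl
  | cons i l ih => rw [iterRes₀_cons, ih, List.foldr_cons]

theorem iterRes₀_perm {S P : Finset (Fin k)} (hP : P ⊆ S) {l m : List (Fin k)} (h : l.Perm m)
    {F : RatField k} (hF : F ∈ poleAlg S P S) : iterRes₀ l F = iterRes₀ m F := by
  induction h with
  | nil => rfl
  | cons i _ ih => rw [iterRes₀_cons, iterRes₀_cons, ih]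
  | swap i j l =>
    by_cases hij : j = i
    · rw [hij]
    · obtain ⟨S', P', h1, -, -, h4⟩ := iterRes_mem hP (l.map fun i => (i, 1)) hF
      simp only [iterRes₀_cons]
      simp only [← res_one]
      exact res_comm hij h1 h4
  | trans _ _ ih1 ih2 => exact ih1.trans ih2

theorem poleAlg_empty {F : RatField k} (hF : F ∈ poleAlg ∅ ∅ ∅) :
    ∃ r : ℚ, F = algebraMap ℚ (RatField k) r := by
  refine poleAlg_induction (motive := fun F => ∃ r : ℚ, F = algebraMap ℚ (RatField k) r)
    (fun r => ⟨r, rfl⟩) (by simp) (by simp) (by simp) ?_ ?_ ?_ hF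
  · intro T hT h2
    rw [Finset.subset_empty.1 hT] at h2
    simp at h2
  · rintro x - y - ⟨r, rfl⟩ ⟨s, rfl⟩
    exact ⟨r + s, (map_add _ _ _).symm⟩
  · rintro x - y - ⟨r, rfl⟩ ⟨s, rfl⟩
    exact ⟨r * s, (map_mul _ _ _).symm⟩

/-- Each residue removes its variable from the algebra, and without variables only constants are
left. Being constant, the result is fixed by all permutations and signs. -/
theorem iterRes_eq_ratCast {S P : Finset (Fin k)} (hP : P ⊆ S) {l : List (Fin k × ℤˣ)}
    (hl : ∀ i, ∃ p ∈ l, p.1 = i) {F : RatField k} (hF : F ∈ poleAlg S P S) :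
    ∃ r : ℚ, iterRes l F = algebraMap ℚ (RatField k) r := by
  obtain ⟨S', P', h1, -, h3, h4⟩ := iterRes_mem hP l hF
  have hS : S' = ∅ := by
    rw [Finset.eq_empty_iff_forall_notMem]
    intro i hi
    obtain ⟨p, hp, rfl⟩ := hl i
    exact h3 p hp hi
  subst hS
  rw [Finset.subset_empty.1 h1] at h4
  exact poleAlg_empty h4

theorem residue_permAct_symm (π : Equiv.Perm (Fin k)) (i : Fin k) (f : RatField k) :
    residue i (permAct π f) = permAct π (residue (π.symm i) f) := by
  conv_lhs => rw [← π.apply_symm_apply i]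
  exact residue_permAct _ _ _

theorem iterRes₀_permAct (π : Equiv.Perm (Fin k)) (l : List (Fin k)) (F : RatField k) :
    iterRes₀ l (permAct π F) = permAct π (iterRes₀ (l.map π.symm) F) := by
  induction l with
  | nil => rfl
  | cons i l ih => rw [List.map_cons, iterRes₀_cons, iterRes₀_cons, ih, residue_permAct_symm]

theorem permAct_ratCast (π : Equiv.Perm (Fin k)) (r : ℚ) :
    permAct π (algebraMap ℚ (RatField k) r) = algebraMap ℚ (RatField k) r := by
  simp

theorem signAct_ratCast (ε : Fin k → ℤˣ) (r : ℚ) :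
    signAct ε (algebraMap ℚ (RatField k) r) = algebraMap ℚ (RatField k) r := by
  simp

/-- Moving `π` out of the residues reorders them, which is harmless by `iterRes₀_perm`; it then acts
on a constant. -/
theorem iteratedResidue_permAct (π : Equiv.Perm (Fin k)) {S P : Finset (Fin k)} (hP : P ⊆ S)
    {F : RatField k} (hF : F ∈ poleAlg S P S) :
    iteratedResidue (permAct π F) = iteratedResidue F := by
  obtain ⟨r, hr⟩ := iterRes_eq_ratCast (l := (List.finRange k).map fun i => (i, 1)) hP
    (fun i => ⟨(i, 1), by simp, rfl⟩) hF
  have hr' : iterRes₀ (List.finRange k) F = algebraMap ℚ (RatField k) r := hr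
  have hp : ((List.finRange k).map π.symm).Perm (List.finRange k) := by
    refine (List.perm_ext_iff_of_nodup ((List.nodup_finRange k).map π.symm.injective)
      (List.nodup_finRange k)).2 fun i => ?_
    simp only [List.mem_map, List.mem_finRange, true_and, iff_true]
    exact ⟨π i, π.symm_apply_apply i⟩
  rw [← iterRes₀_finRange, ← iterRes₀_finRange, iterRes₀_permAct, iterRes₀_perm hP hp hF, hr',
    permAct_ratCast]

end MagogResidue

namespace MagogResidue

variable {k : ℕ}

/-- Signs before residues at the origin amount to residues at the points `x_i = 0` or `x_i = 1`
selected by `ε`. The signs of the variables not yet processed survive outside. -/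
theorem iterRes₀_signAct (ε : Fin k → ℤˣ) {l : List (Fin k)} (hl : l.Nodup) (F : RatField k) :
    iterRes₀ l (signAct ε F) =
      signAct (fun i => if i ∈ l then 1 else ε i) (iterRes (l.map fun i => (i, ε i)) F) := by
  induction l with
  | nil => simp [iterRes₀, iterRes_nil]
  | cons i l ih =>
    obtain ⟨hi, hl⟩ := List.nodup_cons.1 hl
    -- The sign at `i` is split off: it turns the next residue into one at `(i, ε i)`, and the rest
    -- commutes with the residue in `x_i`.
    have : (fun j => if j ∈ l then 1 else ε j) =
        (fun j => if j ∈ i :: l then 1 else ε j) * Pi.mulSingle i (ε i) := by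
      funext j
      by_cases h : j = i
      · subst h; simp [hi]
      · simp [h]
    rw [iterRes₀_cons, ih hl, this, ← signAct_mul, residue_signAct (by simp), List.map_cons,
      iterRes_cons, res_eq_residue]

/-- Residues in variables other than `x_j` see `φ` as a constant and only change `h`. The first
residue in `x_j` sees `h` as a constant and annihilates `φ`. -/
theorem iterRes_mul_eq_zero {j : Fin k} {φ : RatField k} (hφ : ∀ m, m ≠ j → IsFree m φ)
    (hr : ∀ s, res (j, s) φ = 0) (l : List (Fin k × ℤˣ)) (hl : ∃ p ∈ l, p.1 = j) :
    ∀ {S P : Finset (Fin k)}, P ⊆ S → j ∉ S → ∀ {h : RatField k}, h ∈ poleAlg S P S →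
      iterRes l (h * φ) = 0 := by
  induction l using List.reverseRecOn with
  | nil => simp at hl
  | append_singleton l p ih =>
    intro S P hP hj h hh
    rw [iterRes_append, iterRes_cons, iterRes_nil]
    by_cases hp : p.1 = j
    · obtain ⟨i, s⟩ := p
      subst hp
      rw [res_free_mul (isFree_of_mem_poleAlg hj (fun e => hj (hP e)) hj hh), hr, mul_zero,
        iterRes_zero]
    · rw [mul_comm, res_free_mul (hφ _ hp), mul_comm]
      refine ih ?_ (Finset.erase_subset_erase p.1 hP) (fun e => hj (Finset.mem_of_mem_erase e))
        (res_mem hP hh)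
      obtain ⟨q, hq, rfl⟩ := hl
      rcases List.mem_append.1 hq with hq | hq
      · exact ⟨q, hq, rfl⟩
      · exact absurd (by rw [List.mem_singleton.1 hq]) hp

/-! ### Residues at `0` and at `1` -/

/-- The difference of the residues at `x_i = 0` and at `x_i = 1`. -/
noncomputable def resDiff (i : Fin k) (F : RatField k) : RatField k :=
  res (i, 1) F - res (i, -1) F

theorem resDiff_add (i : Fin k) (F G : RatField k) :
    resDiff i (F + G) = resDiff i F + resDiff i G := by
  simp only [resDiff, res_add]; ring

theorem resDiff_sub (i : Fin k) (F G : RatField k) :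
    resDiff i (F - G) = resDiff i F - resDiff i G := by
  simp only [resDiff, res_sub]; ring

theorem resDiff_free_mul {i : Fin k} {h : RatField k} (hh : IsFree i h) (F : RatField k) :
    resDiff i (h * F) = h * resDiff i F := by
  rw [resDiff, res_free_mul (p := (i, 1)) hh, res_free_mul (p := (i, -1)) hh, resDiff, mul_sub]

theorem resDiff_sum {ι : Type*} (i : Fin k) (s : Finset ι) (f : ι → RatField k) :
    resDiff i (∑ a ∈ s, f a) = ∑ a ∈ s, resDiff i (f a) := by
  simp only [resDiff, res_sum, Finset.sum_sub_distrib]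

theorem zpow_mem_poleAlg {S P Q : Finset (Fin k)} {i : Fin k} (hS : i ∈ S) (hP : i ∈ P) (a : ℤ) :
    ratVar i ^ a ∈ poleAlg S P Q := by
  obtain ⟨n, rfl | rfl⟩ := a.eq_nat_or_neg
  · rw [zpow_natCast]
    exact pow_mem (ratVar_mem hS) n
  · rw [zpow_neg, zpow_natCast, ← inv_pow]
    exact pow_mem (inv_ratVar_mem hP) n

theorem one_sub_zpow_mem_poleAlg {S P Q : Finset (Fin k)} {i : Fin k} (hS : i ∈ S) (hQ : i ∈ Q)
    (b : ℤ) : (1 - ratVar i) ^ b ∈ poleAlg S P Q := by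
  obtain ⟨n, rfl | rfl⟩ := b.eq_nat_or_neg
  · rw [zpow_natCast]
    exact pow_mem (sub_mem (one_mem _) (ratVar_mem hS)) n
  · rw [zpow_neg, zpow_natCast, ← inv_pow]
    exact pow_mem (inv_one_sub_ratVar_mem hQ) n

theorem res_zero_eq_zero {i : Fin k} {a b : ℤ} (ha : 0 ≤ a) :
    res (i, 1) (ratVar i ^ a * (1 - ratVar i) ^ b) = 0 := by
  refine res_regular (mem_regular_zero (S := Finset.univ) (P := ∅) (Q := Finset.univ) (by simp)
    (mul_mem ?_ (one_sub_zpow_mem_poleAlg (by simp) (by simp) b)))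
  lift a to ℕ using ha
  rw [zpow_natCast]
  exact pow_mem (ratVar_mem (by simp)) a

theorem res_one_eq_zero {i : Fin k} {a b : ℤ} (hb : 0 ≤ b) :
    res (i, -1) (ratVar i ^ a * (1 - ratVar i) ^ b) = 0 := by
  refine res_regular (mem_regular_one (S := Finset.univ) (P := Finset.univ) (Q := ∅) (by simp)
    (mul_mem (zpow_mem_poleAlg (by simp) (by simp) a) ?_))
  lift b to ℕ using hb
  rw [zpow_natCast]
  exact pow_mem (sub_mem (one_mem _) (ratVar_mem (by simp))) b

theorem res_zero_zpow (i : Fin k) (a : ℤ) :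
    res (i, 1) (ratVar i ^ a) = if a = -1 then 1 else 0 := by
  rw [← localVar_zero]; exact res_localVar_zpow _ _

theorem res_one_zpow (i : Fin k) (b : ℤ) :
    res (i, -1) ((1 - ratVar i) ^ b) = if b = -1 then 1 else 0 := by
  rw [← localVar_one]; exact res_localVar_zpow _ _

theorem monomial_split (i : Fin k) (a b : ℤ) :
    ratVar i ^ a * (1 - ratVar i) ^ b =
      ratVar i ^ (a + 1) * (1 - ratVar i) ^ b + ratVar i ^ a * (1 - ratVar i) ^ (b + 1) := by
  rw [zpow_add_one₀ (ratVar_ne_zero i), zpow_add_one₀ (one_sub_ratVar_ne_zero i)]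
  ring

theorem resDiff_monomial_natCast_left (i : Fin k) (a : ℕ) : ∀ b : ℤ, a + b ≤ -2 →
    resDiff i (ratVar i ^ (a : ℤ) * (1 - ratVar i) ^ b) = 0 := by
  induction a with
  | zero =>
    intro b hb
    rw [resDiff, res_zero_eq_zero (by simp)]
    simp only [Nat.cast_zero, zpow_zero, one_mul]
    rw [res_one_zpow, if_neg (by omega), sub_zero]
  | succ a ih =>
    intro b hb
    have e := monomial_split i a b
    rw [Nat.cast_succ, eq_sub_iff_add_eq.2 e.symm, resDiff_sub, ih b (by push_cast at hb; omega),
      ih (b + 1) (by push_cast at hb; omega), sub_zero]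

theorem resDiff_monomial_natCast_right (i : Fin k) (b : ℕ) : ∀ a : ℤ, a + b ≤ -2 →
    resDiff i (ratVar i ^ a * (1 - ratVar i) ^ (b : ℤ)) = 0 := by
  induction b with
  | zero =>
    intro a ha
    rw [resDiff, res_one_eq_zero (by simp)]
    simp only [Nat.cast_zero, zpow_zero, mul_one]
    rw [res_zero_zpow, if_neg (by omega), sub_zero]
  | succ b ih =>
    intro a ha
    have e := monomial_split i a b
    rw [Nat.cast_succ, eq_sub_iff_add_eq'.2 e.symm, resDiff_sub, ih a (by push_cast at ha; omega),
      ih (a + 1) (by push_cast at ha; omega), sub_zero]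

/-- This is the residue theorem on the projective line: the bound on `a + b` excludes a residue at
infinity. `monomial_split` raises `a + b` by one, which reduces the claim to `a + b = -2`. -/
theorem resDiff_monomial (i : Fin k) {a b : ℤ} (h : a + b ≤ -2) :
    resDiff i (ratVar i ^ a * (1 - ratVar i) ^ b) = 0 := by
  obtain ⟨n, hn⟩ : ∃ n : ℕ, a + b = -2 - n := ⟨(-2 - (a + b)).toNat, by omega⟩
  induction n generalizing a b with
  | zero =>
    by_cases ha : 0 ≤ a
    · lift a to ℕ using ha
      exact resDiff_monomial_natCast_left i a b h
    by_cases hb : 0 ≤ b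
    · lift b to ℕ using hb
      exact resDiff_monomial_natCast_right i b a h
    -- The only case with poles at both points: `1 / (x (1 - x)) = 1 / x + 1 / (1 - x)` has residue
    -- `1` at each in the local coordinate.
    obtain rfl : a = -1 := by omega
    obtain rfl : b = -1 := by omega
    rw [monomial_split]
    norm_num
    rw [resDiff_add, resDiff, resDiff]
    have h1 := res_zero_zpow i (-1)
    have h2 := res_one_zpow i (-1)
    have h3 := res_zero_eq_zero (i := i) (a := 0) (b := -1) le_rfl
    have h4 := res_one_eq_zero (i := i) (a := -1) (b := 0) le_rfl
    simp only [zpow_neg, zpow_one, zpow_zero, mul_one, one_mul, if_true] at h1 h2 h3 h4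
    rw [h1, h2, h3, h4]
    ring
  | succ n ih =>
    push_cast at hn
    rw [monomial_split, resDiff_add, ih (by omega) (by omega), ih (by omega) (by omega), add_zero]

/-- With no pole at `0` and no residue at infinity, the residue at the single remaining point `1`
vanishes too. -/
theorem res_monomial_eq_zero (j : Fin k) {a b : ℤ} (ha : 0 ≤ a) (h : a + b ≤ -2) (s : ℤˣ) :
    res (j, s) (ratVar j ^ a * (1 - ratVar j) ^ b) = 0 := by
  have h1 := res_zero_eq_zero (i := j) (b := b) ha
  rcases Int.units_eq_one_or s with rfl | rfl
  · exact h1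
  · have := resDiff_monomial j h
    rwa [resDiff, h1, zero_sub, neg_eq_zero] at this

theorem ratVar_injective : Function.Injective (ratVar : Fin k → RatField k) :=
  (IsFractionRing.injective (MvPolynomial (Fin k) ℚ) (RatField k)).comp
    (MvPolynomial.X_injective (R := ℚ))

/-! ### The additional pole at `x_i = 1 / x_j` -/

theorem one_sub_mul_ne_zero {i j : Fin k} (h : i ≠ j) :
    (1 : RatField k) - ratVar j * ratVar i ≠ 0 := by
  have := one_sub_prod_ne_zero (k := k) (T := {j, i}) ⟨j, by simp⟩
  rwa [Finset.prod_pair h.symm] at this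

theorem inv_one_sub_mul_mem {S P Q : Finset (Fin k)} {i j : Fin k} (h : i ≠ j) (hi : i ∈ S)
    (hj : j ∈ S) : (1 - ratVar j * ratVar i)⁻¹ ∈ poleAlg S P Q := by
  have := inv_one_sub_prod_mem (S := S) (P := P) (Q := Q) (T := {j, i})
    (by simp [Finset.insert_subset_iff, hi, hj]) (by rw [Finset.card_pair h.symm])
  rwa [Finset.prod_pair h.symm] at this

theorem ratVar_ne_one (i : Fin k) : ratVar i ≠ 1 := fun h =>
  one_sub_ratVar_ne_zero i (by rw [h, sub_self])

/-- `x_i ^ p (1 - x_i) ^ (-b) (1 - x_j x_i)⁻¹` -/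
noncomputable def cross (i j : Fin k) (p : ℤ) (b : ℕ) : RatField k :=
  ratVar i ^ p * (1 - ratVar i) ^ (-b : ℤ) * (1 - ratVar j * ratVar i)⁻¹

theorem cross_sub {i j : Fin k} (h : i ≠ j) (p : ℤ) (b : ℕ) :
    cross i j p b - ratVar j * cross i j (p + 1) b =
      ratVar i ^ p * (1 - ratVar i) ^ (-b : ℤ) := by
  have := one_sub_mul_ne_zero h
  rw [cross, cross, zpow_add_one₀ (ratVar_ne_zero i)]
  generalize (1 - ratVar i) ^ (-b : ℤ) = u
  generalize ratVar i ^ p = v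
  field

/-- It comes from `1 - x_i = (1 - x_j⁻¹) + x_j⁻¹ (1 - x_j x_i)`, and drives the induction on `b` in
`resDiff_cross`. -/
theorem cross_succ {i j : Fin k} (h : i ≠ j) (p : ℤ) (b : ℕ) :
    cross i j p b = (1 - (ratVar j)⁻¹) * cross i j p (b + 1) +
      (ratVar j)⁻¹ * (ratVar i ^ p * (1 - ratVar i) ^ (-(b + 1 : ℕ) : ℤ)) := by
  have hw := mul_inv_cancel₀ (one_sub_mul_ne_zero h)
  have e : (1 - ratVar i) ^ (-b : ℤ) = (1 - ratVar i) ^ (-(b + 1 : ℕ) : ℤ) * (1 - ratVar i) := by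
    rw [← zpow_add_one₀ (one_sub_ratVar_ne_zero i)]
    congr 1
    push_cast; ring
  rw [cross, cross, e]
  generalize (1 - ratVar i) ^ (-(b + 1 : ℕ) : ℤ) = u
  generalize ratVar i ^ p = v
  have hj := mul_inv_cancel₀ (ratVar_ne_zero j)
  linear_combination v * u * (ratVar j)⁻¹ * hw +
    v * u * ratVar i * (1 - ratVar j * ratVar i)⁻¹ * hj

/-- For `b = 0` the residue picks the coefficient of `x_i ^ n` in the geometric series of `1 / (1 -
x_j x_i)`. -/
theorem res_cross_zero {i j : Fin k} (h : i ≠ j) (n : ℕ) :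
    res (i, 1) (cross i j (-1 - n) 0) = ratVar j ^ n := by
  have hj : IsFree i (ratVar j) := isFree_ratVar h.symm
  induction n with
  | zero =>
    have e := cross_sub h (-1) 0
    rw [sub_eq_iff_eq_add] at e
    have h0 : res (i, 1) (cross i j 0 0) = 0 := by
      refine res_regular (mem_regular_zero (S := Finset.univ) (P := ∅) (Q := ∅) (by simp) ?_)
      simpa [cross] using inv_one_sub_mul_mem h (by simp) (by simp)
    simp only [Nat.cast_zero, sub_zero, e, res_add]
    norm_num
    rw [res_free_mul (p := (i, 1)) hj, h0]
    have := res_zero_zpow i (-1)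
    simp only [zpow_neg, zpow_one, if_true] at this
    rw [this]; ring
  | succ n ih =>
    have e := cross_sub h (-1 - (n + 1 : ℕ)) 0
    rw [sub_eq_iff_eq_add] at e
    have e2 : (-1 - ((n + 1 : ℕ) : ℤ) + 1) = -1 - n := by push_cast; ring
    rw [e, e2, res_add, res_free_mul (p := (i, 1)) hj, ih]
    simp only [Nat.cast_zero, neg_zero, zpow_zero, mul_one]
    rw [res_zero_zpow, if_neg (by push_cast; omega), zero_add, pow_succ']

/-- The right-hand side is minus the residue at `x_i = 1 / x_j`. The function has order `p - b - 1`
at infinity, so `p + 1 ≤ b` is exactly the condition that it decays like `x_i ^ (-2)` or faster. -/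
theorem resDiff_cross {i j : Fin k} (h : i ≠ j) (b : ℕ) : ∀ p : ℤ, p + 1 ≤ b →
    resDiff i (cross i j p b) = ratVar j ^ (-p - 1) * (1 - (ratVar j)⁻¹) ^ (-b : ℤ) := by
  have hj : IsFree i (ratVar j) := isFree_ratVar h.symm
  have hji : IsFree i (ratVar j)⁻¹ := hj.inv
  have hj1 : IsFree i (1 - (ratVar j)⁻¹) := mem_freeSubfield.1
    (sub_mem (one_mem _) (mem_freeSubfield.2 hji))
  have hj0 := ratVar_ne_zero j
  have hne : (1 : RatField k) - (ratVar j)⁻¹ ≠ 0 := by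
    rw [sub_ne_zero, ne_comm, Ne, inv_eq_one]
    exact ratVar_ne_one j
  induction b with
  | zero =>
    intro p hp
    obtain ⟨n, rfl⟩ : ∃ n : ℕ, p = -1 - n := ⟨(-1 - p).toNat, by simp at hp; omega⟩
    rw [resDiff, res_cross_zero h, res_regular (p := (i, -1))]
    · simp
    · refine mem_regular_one (S := Finset.univ) (P := Finset.univ) (Q := ∅) (by simp) ?_
      rw [cross]
      simp only [Nat.cast_zero, neg_zero, zpow_zero, mul_one]
      exact mul_mem (zpow_mem_poleAlg (by simp) (by simp) _)
        (inv_one_sub_mul_mem h (by simp) (by simp))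
  | succ b ih =>
    have main : ∀ p : ℤ, p + 1 ≤ b → resDiff i (cross i j p (b + 1)) =
        ratVar j ^ (-p - 1) * (1 - (ratVar j)⁻¹) ^ (-(b + 1 : ℕ) : ℤ) := by
      intro p hp
      have e := congrArg (resDiff i) (cross_succ h p b)
      rw [ih p hp, resDiff_add, resDiff_free_mul hji, resDiff_free_mul hj1,
        resDiff_monomial i (by push_cast; omega), mul_zero, add_zero] at e
      apply mul_left_cancel₀ hne
      rw [← e, mul_left_comm]
      congr 1
      rw [mul_comm, ← zpow_add_one₀ hne]
      congr 1
      push_cast; ring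
    intro p hp
    rcases lt_or_ge p b with hb | hb
    · exact main p hb
    -- The induction hypothesis does not reach the remaining exponent `p = b`; `cross_sub` shifts it
    -- to `p - 1`.
    · have e := congrArg (resDiff i) (cross_sub h (p - 1) (b + 1))
      rw [resDiff_sub, resDiff_free_mul hj, resDiff_monomial i (by push_cast at hp ⊢; omega),
        main (p - 1) (by push_cast at hp; omega), sub_eq_zero, sub_add_cancel] at e
      apply mul_left_cancel₀ hj0
      rw [← e, ← mul_assoc]
      congr 1
      rw [mul_comm, ← zpow_add_one₀ hj0]
      congr 1
      ring

theorem resDiff_polynomial_mul {i : Fin k} {N : Polynomial (RatField k)}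
    (hN : ∀ d, IsFree i (N.coeff d)) {a b : ℕ} (hd : N.natDegree + 2 ≤ a + b) :
    resDiff i (N.eval (ratVar i) * (ratVar i ^ (-a : ℤ) * (1 - ratVar i) ^ (-b : ℤ))) = 0 := by
  rw [Polynomial.eval_eq_sum_range, Finset.sum_mul, resDiff_sum]
  refine Finset.sum_eq_zero fun d hd' => ?_
  rw [Finset.mem_range] at hd'
  rw [mul_assoc, resDiff_free_mul (hN d), ← mul_assoc, ← zpow_natCast,
    ← zpow_add₀ (ratVar_ne_zero i), resDiff_monomial i (by omega), mul_zero]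

theorem resDiff_polynomial_mul_cross {i j : Fin k} (h : i ≠ j) {N : Polynomial (RatField k)}
    (hN : ∀ d, IsFree i (N.coeff d)) {a b : ℕ} (hd : N.natDegree + 1 ≤ a + b) :
    resDiff i (N.eval (ratVar i) * cross i j (-a) b) =
      N.eval (ratVar j)⁻¹ * (ratVar j ^ ((a : ℤ) - 1) * (1 - (ratVar j)⁻¹) ^ (-b : ℤ)) := by
  rw [Polynomial.eval_eq_sum_range, Polynomial.eval_eq_sum_range, Finset.sum_mul, Finset.sum_mul,
    resDiff_sum]
  refine Finset.sum_congr rfl fun d hd' => ?_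
  rw [Finset.mem_range] at hd'
  have e : ratVar i ^ d * cross i j (-a) b = cross i j (d - a) b := by
    rw [cross, cross, ← mul_assoc, ← mul_assoc, ← zpow_natCast, ← zpow_add₀ (ratVar_ne_zero i),
      ← sub_eq_add_neg]
  rw [mul_assoc, resDiff_free_mul (hN d), e, resDiff_cross h b _ (by omega), mul_assoc,
    ← mul_assoc ((ratVar j)⁻¹ ^ d)]
  congr 3
  rw [inv_pow, ← zpow_natCast, ← zpow_neg, ← zpow_add₀ (ratVar_ne_zero j)]
  congr 1
  ring

end MagogResidue

namespace MagogResidue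

variable {k : ℕ}

/-! ### Products over pairs -/

/-- The product of `Q p q` over the pairs `p < q` in `s`. -/
def pairProd {R : Type*} [CommMonoid R] (Q : Fin k → Fin k → R) (s : Finset (Fin k)) : R :=
  ∏ p ∈ s, ∏ q ∈ s, if p < q then Q p q else 1

theorem pairProd_univ {R : Type*} [CommMonoid R] (Q : Fin k → Fin k → R) :
    pairProd Q Finset.univ = ∏ p, ∏ q ∈ Finset.Ioi p, Q p q := by
  refine Finset.prod_congr rfl fun p _ => ?_
  rw [← Finset.prod_filter]
  refine Finset.prod_congr ?_ fun _ _ => rfl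
  ext q; simp

/-- Reordering the pairs that contain `i` costs a sign `u`. Its value is irrelevant, since the
factorisation only serves to show that something vanishes. -/
theorem pairProd_erase {R : Type*} [CommRing R] (Q : Fin k → Fin k → R)
    (hQ : ∀ p q, Q q p = -Q p q) {s : Finset (Fin k)} {i : Fin k} (hi : i ∈ s) :
    ∃ u : ℤ, pairProd Q s =
      u * ((∏ m ∈ s.erase i, Q i m) * pairProd Q (s.erase i)) := by
  refine ⟨∏ m ∈ s.erase i, if m < i then -1 else 1, ?_⟩
  have hrow : ∀ p, (∏ q ∈ s, if p < q then Q p q else 1) =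
      (if p < i then Q p i else 1) * ∏ q ∈ s.erase i, if p < q then Q p q else 1 := fun p =>
    (Finset.mul_prod_erase s _ hi).symm
  rw [pairProd, ← Finset.mul_prod_erase s _ hi, hrow, if_neg (lt_irrefl i), one_mul]
  simp only [hrow, Finset.prod_mul_distrib]
  rw [← mul_assoc, ← mul_assoc, pairProd]
  congr 1
  rw [← Finset.prod_mul_distrib, Int.cast_prod, ← Finset.prod_mul_distrib]
  refine Finset.prod_congr rfl fun m hm => ?_
  rcases lt_trichotomy i m with h | h | h
  · simp [h, h.not_gt]
  · exact absurd h.symm (Finset.ne_of_mem_erase hm)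
  · rw [if_neg h.not_gt, if_pos h, if_pos h, hQ i m]; simp

/-! ### Factorisation of the residuand -/

/-- `x_i (1 - x_i)` -/
noncomputable def quad (i : Fin k) : RatField k := ratVar i * (1 - ratVar i)

/-- The factor of the residuand that belongs to a pair of variables. -/
noncomputable def pairFactor (p q : Fin k) : RatField k :=
  (quad p - quad q) * (1 - ratVar p * ratVar q)⁻¹

/-- The factor of the residuand that belongs to one variable. -/
noncomputable def varFactor (n : ℕ) (i : Fin k) : RatField k :=
  (1 - 2 * ratVar i) * (ratVar i ^ (-(n + k - (i.val + 1) : ℕ) : ℤ) *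
    (1 - ratVar i) ^ (-(n + k + 1 : ℕ) : ℤ))

theorem pairFactor_symm (p q : Fin k) : pairFactor q p = -pairFactor p q := by
  rw [pairFactor, pairFactor, mul_comm (ratVar q)]; ring

/-- The numerator is a Vandermonde product in the quantities `x_i (1 - x_i)`, because `(x_q -
x_p)(x_q + x_p - 1)` is the difference of two of them. -/
theorem magogResiduand_eq (n k : ℕ) :
    magogResiduand n k = (∏ i, varFactor n i) * pairProd pairFactor Finset.univ := by
  rw [magogResiduand, magogDelta, pairProd_univ]
  simp only [varFactor, pairFactor, Finset.prod_mul_distrib, Finset.prod_inv_distrib, zpow_neg,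
    zpow_natCast]
  have : ∀ p q : Fin k, (quad p - quad q : RatField k) =
      (ratVar q - ratVar p) * (ratVar q + ratVar p - 1) := fun p q => by
    rw [quad, quad]; ring
  simp only [this, Finset.prod_mul_distrib]
  rw [div_eq_mul_inv, mul_inv, mul_inv]
  ring

theorem quad_mem {S P Q : Finset (Fin k)} {i : Fin k} (hi : i ∈ S) : quad i ∈ poleAlg S P Q :=
  mul_mem (ratVar_mem hi) (sub_mem (one_mem _) (ratVar_mem hi))

theorem varFactor_mem {S P Q : Finset (Fin k)} {i : Fin k} (hS : i ∈ S) (hP : i ∈ P) (hQ : i ∈ Q)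
    (n : ℕ) : varFactor n i ∈ poleAlg S P Q :=
  mul_mem (sub_mem (one_mem _) (mul_mem (ofNat_mem _ 2) (ratVar_mem hS)))
    (mul_mem (zpow_mem_poleAlg hS hP _) (one_sub_zpow_mem_poleAlg hS hQ _))

theorem pairFactor_mem {S P Q : Finset (Fin k)} {p q : Fin k} (hpq : p ≠ q) (hp : p ∈ S)
    (hq : q ∈ S) : pairFactor p q ∈ poleAlg S P Q :=
  mul_mem (sub_mem (quad_mem hp) (quad_mem hq)) (inv_one_sub_mul_mem hpq.symm hq hp)

theorem pairProd_mem {S P Q : Finset (Fin k)} {f : Fin k → Fin k → RatField k}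
    (hf : ∀ p ∈ S, ∀ q ∈ S, p ≠ q → f p q ∈ poleAlg S P Q) : pairProd f S ∈ poleAlg S P Q := by
  refine prod_mem fun p hp => prod_mem fun q hq => ?_
  split_ifs with h
  · exact hf p hp q hq h.ne
  · exact one_mem _

theorem pairProd_pairFactor_mem {S P Q : Finset (Fin k)} :
    pairProd pairFactor S ∈ poleAlg S P Q :=
  pairProd_mem fun _ hp _ hq hpq => pairFactor_mem hpq hp hq

theorem magogResiduand_mem (n k : ℕ) :
    magogResiduand n k ∈ poleAlg (k := k) Finset.univ Finset.univ Finset.univ := by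
  rw [magogResiduand_eq]
  exact mul_mem (prod_mem fun i _ => varFactor_mem (by simp) (by simp) (by simp) n)
    pairProd_pairFactor_mem

/-- Polynomials with coefficients in a subalgebra. -/
noncomputable def coeffSubring (A : Subalgebra ℚ (RatField k)) :
    Subring (Polynomial (RatField k)) :=
  (Polynomial.mapRingHom (algebraMap A (RatField k))).range

theorem X_mem_coeffSubring (A : Subalgebra ℚ (RatField k)) : Polynomial.X ∈ coeffSubring A :=
  ⟨Polynomial.X, by simp⟩

theorem C_mem_coeffSubring {A : Subalgebra ℚ (RatField k)} {a : RatField k} (ha : a ∈ A) :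
    Polynomial.C a ∈ coeffSubring A :=
  ⟨Polynomial.C ⟨a, ha⟩, by simp⟩

theorem coeff_mem_of_mem_coeffSubring {A : Subalgebra ℚ (RatField k)}
    {N : Polynomial (RatField k)} (hN : N ∈ coeffSubring A) (d : ℕ) : N.coeff d ∈ A := by
  obtain ⟨M, rfl⟩ := hN
  rw [Polynomial.coe_mapRingHom, Polynomial.coeff_map]
  exact (M.coeff d).2

/-- The numerator of the residuand as a polynomial in `x_i`. -/
noncomputable def numPoly (i : Fin k) : Polynomial (RatField k) :=
  (1 - 2 * Polynomial.X) * ∏ m ∈ Finset.univ.erase i,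
    (Polynomial.X * (1 - Polynomial.X) - Polynomial.C (quad m))

theorem numPoly_eval (i : Fin k) (z : RatField k) :
    (numPoly i).eval z = (1 - 2 * z) * ∏ m ∈ Finset.univ.erase i, (z * (1 - z) - quad m) := by
  simp [numPoly, Polynomial.eval_prod]

theorem natDegree_prod_le_of_le {ι : Type*} (s : Finset ι) (f : ι → Polynomial (RatField k))
    (d : ℕ) (h : ∀ i ∈ s, (f i).natDegree ≤ d) : (∏ i ∈ s, f i).natDegree ≤ s.card * d := by
  refine (Polynomial.natDegree_prod_le s f).trans ?_
  rw [← smul_eq_mul]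
  exact Finset.sum_le_card_nsmul s _ d h

theorem numPoly_natDegree (i : Fin k) : (numPoly i).natDegree ≤ 2 * k - 1 := by
  have hk : 0 < k := i.pos
  refine Polynomial.natDegree_mul_le.trans ?_
  have h1 : (1 - 2 * Polynomial.X : Polynomial (RatField k)).natDegree ≤ 1 := by
    compute_degree
  have h2 := natDegree_prod_le_of_le (Finset.univ.erase i)
    (fun m => (Polynomial.X * (1 - Polynomial.X) - Polynomial.C (quad m) :
      Polynomial (RatField k))) 2 (fun m _ => by compute_degree)
  rw [Finset.card_erase_of_mem (by simp), Finset.card_univ, Fintype.card_fin] at h2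
  omega

theorem numPoly_mem (i : Fin k) : numPoly i ∈
    coeffSubring (poleAlg (Finset.univ.erase i) (Finset.univ.erase i) (Finset.univ.erase i)) :=
  mul_mem (sub_mem (one_mem _) (mul_mem (ofNat_mem _ 2) (X_mem_coeffSubring _)))
    (prod_mem fun _ hm => sub_mem (mul_mem (X_mem_coeffSubring _)
      (sub_mem (one_mem _) (X_mem_coeffSubring _))) (C_mem_coeffSubring (quad_mem hm)))

theorem numPoly_coeff_isFree (i : Fin k) (d : ℕ) : IsFree i ((numPoly i).coeff d) :=
  isFree_erase (coeff_mem_of_mem_coeffSubring (numPoly_mem i) d)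

/-- Partial fractions in `x_i`: the Lagrange basis polynomials at the nodes `1 / x_m` sum to `1`,
and this identity is divided by `∏ (1 - x_i x_m)`. -/
theorem prod_inv_eq_sum (i : Fin k) (hs : (Finset.univ.erase i).Nonempty) :
    ∏ m ∈ Finset.univ.erase i, (1 - ratVar i * ratVar m : RatField k)⁻¹ =
      ∑ j ∈ Finset.univ.erase i,
        (∏ m ∈ (Finset.univ.erase i).erase j, ratVar j / (ratVar j - ratVar m)) *
          (1 - ratVar j * ratVar i)⁻¹ := by
  have hinj : Set.InjOn (fun m : Fin k => (ratVar m)⁻¹) (Finset.univ.erase i : Finset (Fin k)) :=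
    (inv_injective.comp ratVar_injective).injOn
  have h := congrArg (Polynomial.eval (ratVar i)) (Lagrange.sum_basis hinj hs)
  rw [Polynomial.eval_finsetSum, Polynomial.eval_one] at h
  have h' := (mul_one (∏ m ∈ Finset.univ.erase i, (1 - ratVar i * ratVar m : RatField k)⁻¹)).symm
  rw [← congrArg (_ * ·) h, Finset.mul_sum] at h'
  rw [h']
  refine Finset.sum_congr rfl fun j hj => ?_
  rw [Lagrange.basis, Polynomial.eval_prod, ← Finset.mul_prod_erase _ _ hj, mul_right_comm,
    mul_assoc, ← Finset.prod_mul_distrib, mul_comm, mul_comm (ratVar i)]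
  congr 1
  refine Finset.prod_congr rfl fun m hm => ?_
  have hmi : i ≠ m := (Finset.ne_of_mem_erase (Finset.mem_of_mem_erase hm)).symm
  have h1 := one_sub_mul_ne_zero hmi
  have h2 := ratVar_ne_zero m
  have h3 := ratVar_ne_zero j
  have h4 : (ratVar j : RatField k) - ratVar m ≠ 0 :=
    sub_ne_zero.2 fun e => (Finset.ne_of_mem_erase hm).symm (ratVar_injective e)
  have h5 : (ratVar m : RatField k) - ratVar j ≠ 0 := by
    rw [← neg_sub]; exact neg_ne_zero.2 h4
  rw [Lagrange.basisDivisor]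
  simp only [Polynomial.eval_mul, Polynomial.eval_C, Polynomial.eval_sub, Polynomial.eval_X]
  have h6 : ((ratVar j)⁻¹ - (ratVar m)⁻¹ : RatField k)⁻¹ =
      ratVar j * ratVar m * (ratVar m - ratVar j)⁻¹ := by
    rw [inv_sub_inv h3 h2, inv_div, div_eq_mul_inv]
  have h7 : (ratVar m - ratVar j : RatField k)⁻¹ = - (ratVar j - ratVar m)⁻¹ := by
    rw [← inv_neg, neg_sub]
  rw [h6, h7, mul_comm (ratVar i) (ratVar m), div_eq_mul_inv]
  have h8 : (ratVar i - (ratVar m)⁻¹ : RatField k) =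
      -((1 - ratVar m * ratVar i) * (ratVar m)⁻¹) := by
    field_simp; ring
  rw [h8]
  generalize (ratVar j - ratVar m)⁻¹ = w
  have e1 := mul_inv_cancel₀ h1
  have e2 := mul_inv_cancel₀ h2
  generalize (1 - ratVar m * ratVar i) = v at *
  linear_combination ratVar j * w * ratVar m * (ratVar m)⁻¹ * e1 + ratVar j * w * e2

/-- The numerator of the residue at `x_i = 1 / x_j`, as a polynomial in `x_j`. -/
noncomputable def crossPoly (R : Finset (Fin k)) : Polynomial (RatField k) :=
  (1 - 2 * Polynomial.X) * (Polynomial.X - 2) * (Polynomial.X - 1) * (Polynomial.X ^ 3 + 1) *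
    ∏ m ∈ R, ((Polynomial.X + Polynomial.C (ratVar m - 1)) *
      (1 + Polynomial.C (ratVar m - 1) * Polynomial.X))

theorem crossPoly_natDegree (R : Finset (Fin k)) : (crossPoly R).natDegree ≤ 6 + R.card * 2 := by
  refine Polynomial.natDegree_mul_le.trans ?_
  refine add_le_add ?_ (natDegree_prod_le_of_le _ _ 2 fun m _ => ?_)
  · compute_degree
  · compute_degree

theorem crossPoly_mem {R P Q : Finset (Fin k)} : crossPoly R ∈ coeffSubring (poleAlg R P Q) := by
  have hX := X_mem_coeffSubring (poleAlg R P Q)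
  refine mul_mem (mul_mem (mul_mem (mul_mem (sub_mem (one_mem _) (mul_mem (ofNat_mem _ 2) hX))
    (sub_mem hX (ofNat_mem _ 2))) (sub_mem hX (one_mem _))) (add_mem (pow_mem hX 3) (one_mem _)))
    (prod_mem fun m hm => ?_)
  have hm' : Polynomial.C (ratVar m - 1) ∈ coeffSubring (poleAlg R P Q) :=
    C_mem_coeffSubring (sub_mem (ratVar_mem hm) (one_mem _))
  exact mul_mem (add_mem hX hm') (add_mem (one_mem _) (mul_mem hm' hX))

/-- The decisive cancellation: at `x_i = 1 / x_j` the numerator factor of the pair `(i, m)` contains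
`1 - x_j x_m`, and the factor `x_j - x_m` from the partial fractions divides the numerator of the
pair `(j, m)`. Only a power of `x_j` is left in the denominator. -/
theorem cross_pair {j m : Fin k} (hmj : m ≠ j) :
    pairFactor j m * (ratVar j / (ratVar j - ratVar m)) *
      ((ratVar j)⁻¹ * (1 - (ratVar j)⁻¹) - quad m) =
    (ratVar j)⁻¹ * ((ratVar j + (ratVar m - 1)) * (1 + (ratVar m - 1) * ratVar j)) := by
  have h1 := one_sub_mul_ne_zero hmj
  have h3 := ratVar_ne_zero j
  have h4 : (ratVar j : RatField k) - ratVar m ≠ 0 :=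
    sub_ne_zero.2 fun e => hmj.symm (ratVar_injective e)
  rw [pairFactor, quad, quad]
  generalize ratVar m = z at *
  generalize ratVar j = x at *
  have e1 : x * (1 - x) - z * (1 - z) = (x - z) * (1 - x - z) := by ring
  have e2 : x⁻¹ * (1 - x⁻¹) - z * (1 - z) = (1 - x * z) * (x - 1 - x * z) * (x⁻¹ * x⁻¹) := by
    field_simp; ring
  rw [e1, e2]
  generalize 1 - x * z = v at *
  generalize hw : x - z = w at *
  field_simp
  ring

/-- This collects the factors in `x_j` alone: those of `x_j` itself, those of `x_i` after `x_i = 1 /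
x_j`, and the numerator of the pair `(i, j)`. -/
theorem cross_var (n : ℕ) (j : Fin k) (a : ℕ) :
    varFactor n j * ((1 - 2 * (ratVar j)⁻¹) *
        ((ratVar j)⁻¹ * (1 - (ratVar j)⁻¹) - quad j)) *
      (ratVar j ^ ((a : ℤ) - 1) * (1 - (ratVar j)⁻¹) ^ (-(n + k + 1 : ℕ) : ℤ)) =
    (-1) ^ (n + k + 1) * ((1 - 2 * ratVar j) * (ratVar j - 2) * (ratVar j - 1) *
      (ratVar j ^ 3 + 1)) *
      (ratVar j ^ ((a : ℤ) - (n + k - (j.val + 1) : ℕ) + (n + k + 1 : ℕ) - 4) *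
        (1 - ratVar j) ^ (-(2 * (n + k + 1) : ℕ) : ℤ)) := by
  have h3 := ratVar_ne_zero j
  have h4 := one_sub_ratVar_ne_zero j
  rw [varFactor, quad]
  generalize (n + k - (j.val + 1) : ℕ) = c
  generalize (n + k + 1 : ℕ) = b
  generalize ratVar j = x at *
  have e1 : 1 - x⁻¹ = (-1) * (1 - x) * x⁻¹ := by field_simp; ring
  have e2 : x⁻¹ * (1 - x⁻¹) - x * (1 - x) = (x - 1) * (x ^ 3 + 1) * x ^ (-2 : ℤ) := by
    rw [zpow_neg]; field_simp; ring
  have e3 : 1 - 2 * x⁻¹ = (x - 2) * x ^ (-1 : ℤ) := by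
    rw [zpow_neg_one]; field_simp
  have e4 : ((-1) * (1 - x) * x⁻¹) ^ (-(b : ℤ)) =
      (-1) ^ b * (1 - x) ^ (-(b : ℤ)) * x ^ (b : ℤ) := by
    rw [mul_zpow, mul_zpow, inv_zpow, zpow_neg x, inv_inv, zpow_neg (-1), zpow_natCast, ← inv_pow]
    norm_num
  have e5 : x ^ ((a : ℤ) - c + b - 4) =
      x ^ (-(c : ℤ)) * x ^ (-1 : ℤ) * x ^ (-2 : ℤ) * x ^ ((a : ℤ) - 1) * x ^ (b : ℤ) := by
    rw [← zpow_add₀ h3, ← zpow_add₀ h3, ← zpow_add₀ h3, ← zpow_add₀ h3]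
    congr 1; ring
  have e6 : (1 - x) ^ (-(2 * b : ℕ) : ℤ) = (1 - x) ^ (-(b : ℤ)) * (1 - x) ^ (-(b : ℤ)) := by
    rw [← zpow_add₀ h4]; congr 1; push_cast; ring
  rw [e2, e3, e1, e4, e5, e6]
  ring

/-- After partial fractions in `x_i`, the contribution of the pole `x_i = 1 / x_j` is a function of
the other variables times a polynomial in `x_j` over a power of `1 - x_j`. Its residues in `x_j`
vanish at both `0` and `1`, so the points chosen in `l` do not matter. -/
theorem iterRes_resDiff_magogResiduand {n k : ℕ} (hkn : k ≤ n) (i : Fin k)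
    {l : List (Fin k × ℤˣ)} (hl : ∀ j, j ≠ i → ∃ p ∈ l, p.1 = j) :
    iterRes l (resDiff i (magogResiduand n k)) = 0 := by
  obtain ⟨u, hu⟩ := pairProd_erase (R := RatField k) pairFactor pairFactor_symm (Finset.mem_univ i)
  set E := Finset.univ.erase i with hE
  set a : ℕ := n + k - (i.val + 1) with ha
  set b : ℕ := n + k + 1 with hb
  have hcardE : E.card = k - 1 := by
    rw [hE, Finset.card_erase_of_mem (by simp), Finset.card_univ, Fintype.card_fin]
  set w : RatField k := u * ((∏ m ∈ E, varFactor n m) * pairProd pairFactor E) with hw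
  have hwmem : w ∈ poleAlg E E E := mul_mem (intCast_mem _ u)
    (mul_mem (prod_mem fun m hm => varFactor_mem hm hm hm n) pairProd_pairFactor_mem)
  have hwfree : IsFree i w := isFree_erase hwmem
  have hf : magogResiduand n k = w * ((numPoly i).eval (ratVar i) *
      (ratVar i ^ (-a : ℤ) * (1 - ratVar i) ^ (-b : ℤ)) *
        ∏ m ∈ E, (1 - ratVar i * ratVar m)⁻¹) := by
    rw [magogResiduand_eq, hu, ← Finset.mul_prod_erase _ _ (Finset.mem_univ i), varFactor,
      numPoly_eval]
    simp only [pairFactor, Finset.prod_mul_distrib, quad, hw]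
    ring
  have hi := i.2
  rcases E.eq_empty_or_nonempty with h0 | hne
  -- For a single variable there is no pole besides `0` and `1`.
  · rw [hf, h0, Finset.prod_empty, mul_one, resDiff_free_mul hwfree,
      resDiff_polynomial_mul (numPoly_coeff_isFree i), mul_zero, iterRes_zero]
    have := numPoly_natDegree i
    omega
  rw [hf, prod_inv_eq_sum i hne, Finset.mul_sum, resDiff_free_mul hwfree, resDiff_sum,
    Finset.mul_sum, iterRes_sum]
  refine Finset.sum_eq_zero fun j hj => ?_
  have hji : j ≠ i := Finset.ne_of_mem_erase hj
  have hlam : IsFree i (∏ m ∈ E.erase j, ratVar j / (ratVar j - ratVar m) : RatField k) := by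
    refine mem_freeSubfield.1 (prod_mem fun m hm => ?_)
    have h1 := mem_freeSubfield.2 (isFree_ratVar hji)
    have h2 := mem_freeSubfield.2 (isFree_ratVar
      (Finset.ne_of_mem_erase (Finset.mem_of_mem_erase hm)))
    exact div_mem h1 (sub_mem h1 h2)
  have e1 : (numPoly i).eval (ratVar i) * (ratVar i ^ (-a : ℤ) * (1 - ratVar i) ^ (-b : ℤ)) *
      ((∏ m ∈ E.erase j, ratVar j / (ratVar j - ratVar m)) * (1 - ratVar j * ratVar i)⁻¹) =
      (∏ m ∈ E.erase j, ratVar j / (ratVar j - ratVar m)) *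
        ((numPoly i).eval (ratVar i) * cross i j (-a) b) := by
    rw [cross]; ring
  rw [e1, resDiff_free_mul hlam, resDiff_polynomial_mul_cross hji.symm (numPoly_coeff_isFree i)
    (by have := numPoly_natDegree i; omega), numPoly_eval]
  obtain ⟨v, hv⟩ := pairProd_erase (R := RatField k) pairFactor pairFactor_symm hj
  set R := E.erase j with hR
  have hcardR : R.card = k - 2 := by
    rw [hR, Finset.card_erase_of_mem hj, hcardE]; omega
  set h : RatField k := (u * v * (-1) ^ b : ℤ) * ((∏ m ∈ R, varFactor n m) * pairProd pairFactor R)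
    with hh
  have hhmem : h ∈ poleAlg R R R := mul_mem (intCast_mem _ _)
    (mul_mem (prod_mem fun m hm => varFactor_mem hm hm hm n) pairProd_pairFactor_mem)
  have key : w * ((∏ m ∈ R, ratVar j / (ratVar j - ratVar m)) *
      (((1 - 2 * (ratVar j)⁻¹) * ∏ m ∈ E, ((ratVar j)⁻¹ * (1 - (ratVar j)⁻¹) - quad m)) *
        (ratVar j ^ ((a : ℤ) - 1) * (1 - (ratVar j)⁻¹) ^ (-b : ℤ)))) =
      h * ((crossPoly R).eval (ratVar j) *
        (ratVar j ^ ((a : ℤ) - (n + k - (j.val + 1) : ℕ) + b - 4 - R.card) *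
          (1 - ratVar j) ^ (-(2 * b : ℕ) : ℤ))) := by
    have e2 : (∏ m ∈ R, pairFactor j m) * (∏ m ∈ R, ratVar j / (ratVar j - ratVar m)) *
        ∏ m ∈ R, ((ratVar j)⁻¹ * (1 - (ratVar j)⁻¹) - quad m) =
        ratVar j ^ (-(R.card : ℤ)) * ∏ m ∈ R, ((ratVar j + (ratVar m - 1)) *
          (1 + (ratVar m - 1) * ratVar j)) := by
      rw [← Finset.prod_mul_distrib, ← Finset.prod_mul_distrib, zpow_neg, zpow_natCast, ← inv_pow,
        ← Finset.prod_const, ← Finset.prod_mul_distrib]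
      exact Finset.prod_congr rfl fun m hm => cross_pair (Finset.ne_of_mem_erase hm)
    have e3 := cross_var n j a
    have e4 : ratVar j ^ ((a : ℤ) - (n + k - (j.val + 1) : ℕ) + b - 4 - R.card) =
        ratVar j ^ ((a : ℤ) - (n + k - (j.val + 1) : ℕ) + b - 4) * ratVar j ^ (-(R.card : ℤ)) := by
      rw [← zpow_add₀ (ratVar_ne_zero j), sub_eq_add_neg _ (R.card : ℤ)]
    have e5 : (crossPoly R).eval (ratVar j) =
        (1 - 2 * ratVar j) * (ratVar j - 2) * (ratVar j - 1) * (ratVar j ^ 3 + 1) *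
          ∏ m ∈ R, ((ratVar j + (ratVar m - 1)) * (1 + (ratVar m - 1) * ratVar j)) := by
      simp [crossPoly, Polynomial.eval_prod]
    rw [e4, e5, hw, hh, hv, ← Finset.mul_prod_erase E _ hj, ← Finset.mul_prod_erase E _ hj, ← hR]
    simp only [← hb] at e3
    generalize (1 - ratVar j) ^ (-(2 * b : ℕ) : ℤ) = g9 at *
    push_cast
    generalize (∏ m ∈ R, ((ratVar j + (ratVar m - 1)) * (1 + (ratVar m - 1) * ratVar j))) = g1 at *
    generalize (∏ m ∈ R, pairFactor j m) = g2 at *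
    generalize (∏ m ∈ R, ratVar j / (ratVar j - ratVar m)) = g3 at *
    generalize (∏ m ∈ R, ((ratVar j)⁻¹ * (1 - (ratVar j)⁻¹) - quad m)) = g4 at *
    generalize (∏ m ∈ R, varFactor n m) = g5 at *
    generalize pairProd pairFactor R = g6 at *
    generalize ratVar j ^ ((a : ℤ) - (n + k - (j.val + 1) : ℕ) + b - 4) = g7 at *
    generalize ratVar j ^ (-(R.card : ℤ)) = g8 at *
    generalize (ratVar j ^ ((a : ℤ) - 1) * (1 - (ratVar j)⁻¹) ^ (-b : ℤ)) = g10 at *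
    generalize varFactor n j = g11 at *
    generalize (1 - 2 * (ratVar j)⁻¹) = g12 at *
    generalize ((ratVar j)⁻¹ * (1 - (ratVar j)⁻¹) - quad j) = g13 at *
    generalize ((1 - 2 * ratVar j) * (ratVar j - 2) * (ratVar j - 1) * (ratVar j ^ 3 + 1)) =
      g14 at *
    linear_combination (u * v * g5 * g6 * g11 * g12 * g13 * g10 : RatField k) * e2 +
      (u * v * g5 * g6 * g8 * g1 : RatField k) * e3
  have hj2 := j.2
  rw [key, Polynomial.eval_eq_sum_range, Finset.sum_mul, Finset.mul_sum, iterRes_sum]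
  refine Finset.sum_eq_zero fun d hd => ?_
  have hd2 : d ≤ 6 + R.card * 2 :=
    (Nat.lt_succ_iff.1 (Finset.mem_range.1 hd)).trans (crossPoly_natDegree R)
  have hk2 : 2 ≤ k := by
    have := i.2
    have : i.val ≠ j.val := fun e => hji (Fin.ext e.symm)
    omega
  set c : ℤ := (a : ℤ) - (n + k - (j.val + 1) : ℕ) + b - 4 - R.card with hc
  -- Since `j - i ≥ -(k - 1)` and `k ≤ n`, this is nonnegative: there is no pole at `x_j = 0`.
  have hcval : c = n - 1 + j.val - i.val := by
    rw [hc, hcardR, ha, hb]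
    push_cast [Nat.cast_sub (show j.val + 1 ≤ n + k by omega),
      Nat.cast_sub (show i.val + 1 ≤ n + k by omega), Nat.cast_sub hk2]
    ring
  have e6 : h * ((crossPoly R).coeff d * ratVar j ^ d *
      (ratVar j ^ c * (1 - ratVar j) ^ (-(2 * b : ℕ) : ℤ))) =
      h * (crossPoly R).coeff d *
        (ratVar j ^ (d + c) * (1 - ratVar j) ^ (-(2 * b : ℕ) : ℤ)) := by
    rw [zpow_add₀ (ratVar_ne_zero j), zpow_natCast]; ring
  rw [e6]
  refine iterRes_mul_eq_zero (j := j) (fun m hm => ?_) (fun s => ?_) l (hl j hji)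
    (S := R) (P := R) subset_rfl (by simp [hR])
    (mul_mem hhmem (coeff_mem_of_mem_coeffSubring crossPoly_mem d))
  · exact mem_freeSubfield.1 (mul_mem (zpow_mem (mem_freeSubfield.2 (isFree_ratVar hm.symm)) _)
      (zpow_mem (sub_mem (one_mem _) (mem_freeSubfield.2 (isFree_ratVar hm.symm))) _))
  -- The total degree is `d + c - 2 b ≤ j - i - n - 1 ≤ -2`, using `d ≤ 2 k + 2` and `j - i ≤ k - 1
  -- ≤ n - 1`.
  · refine res_monomial_eq_zero j (by omega) ?_ s
    rw [hcval, hb]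
    push_cast
    omega

end MagogResidue

namespace MagogResidue

/-! ### Invariance under signed permutations -/

/-- The residue taken first acts on `f_{n,k}` itself, so its point can be switched to the origin by
the vanishing of `resDiff`. It then commutes past the others and joins `m`, which leaves `f_{n,k}`
innermost for the next switch. -/
theorem iterRes₀_iterRes_magogResiduand {n k : ℕ} (hkn : k ≤ n) (l : List (Fin k × ℤˣ)) :
    ∀ m : List (Fin k), (m ++ l.map Prod.fst).Perm (List.finRange k) →
      iterRes₀ m (iterRes l (magogResiduand n k)) =
        iterRes₀ (m ++ l.map Prod.fst) (magogResiduand n k) := by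
  have hmem := magogResiduand_mem n k
  induction l using List.reverseRecOn with
  | nil => simp [iterRes_nil]
  | append_singleton l p ih =>
    intro m hm
    obtain ⟨i, s⟩ := p
    rw [List.map_append, List.map_singleton] at hm ⊢
    have hperm : (m ++ [i] ++ l.map Prod.fst).Perm (m ++ (l.map Prod.fst ++ [i])) := by
      rw [List.append_assoc]
      exact List.perm_append_comm.append_left m
    have hnodup := hm.nodup_iff.2 (List.nodup_finRange k)
    have hil : ∀ p ∈ l, i ≠ p.1 := by
      rintro p hp rfl
      have := (List.nodup_append.1 (List.nodup_append.1 hnodup).2.1).2.2 p.1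
        (List.mem_map_of_mem hp) p.1 (by simp)
      exact this rfl
    have hnull : iterRes₀ m (iterRes l (resDiff i (magogResiduand n k))) = 0 := by
      rw [iterRes₀, ← iterRes_append]
      refine iterRes_resDiff_magogResiduand hkn i fun j hj => ?_
      have := hm.mem_iff.2 (List.mem_finRange j)
      rcases List.mem_append.1 this with h | h
      · exact ⟨(j, 1), List.mem_append_left _ (List.mem_map_of_mem h), rfl⟩
      rcases List.mem_append.1 h with h | h
      · obtain ⟨q, hq, rfl⟩ := List.mem_map.1 h
        exact ⟨q, List.mem_append_right _ hq, rfl⟩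
      · exact absurd (List.mem_singleton.1 h) hj
    have hswitch : iterRes₀ m (iterRes l (res (i, s) (magogResiduand n k))) =
        iterRes₀ m (iterRes l (res (i, 1) (magogResiduand n k))) := by
      rcases Int.units_eq_one_or s with rfl | rfl
      · rfl
      · have : res (i, 1) (magogResiduand n k) =
            res (i, -1) (magogResiduand n k) + resDiff i (magogResiduand n k) := by
          rw [resDiff]; ring
        rw [this, iterRes_add, iterRes₀, iterRes₀, iterRes_add]
        rw [iterRes₀] at hnull
        rw [hnull, add_zero]
    rw [iterRes_append, iterRes_cons, iterRes_nil, hswitch,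
      iterRes_res_comm subset_rfl l hil hmem, ← iterRes₀_perm subset_rfl hperm hmem,
      ← ih (m ++ [i]) (hperm.trans hm), iterRes₀_append, iterRes₀_cons, res_one]
    rfl

theorem signAct_permAct {k : ℕ} (ε : Fin k → ℤˣ) (π : Equiv.Perm (Fin k)) (f : RatField k) :
    signAct ε (permAct π f) = permAct π (signAct (ε ∘ π) f) := by
  have : (signAct ε : RatField k →+* RatField k).comp (permAct π : RatField k →+* RatField k) =
      (permAct π : RatField k →+* RatField k).comp
        (signAct (ε ∘ π) : RatField k →+* RatField k) := by
    apply ratField_hom_ext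
    intro j
    by_cases h : ε (π j) = 1 <;> simp [signAct_ratVar, permAct_ratVar, h]
  exact RingHom.congr_fun this f

theorem iteratedResidue_signedAct_magogResiduand {n k : ℕ} (hkn : k ≤ n) (g : SignedPerm k) :
    iteratedResidue (signedAct g (magogResiduand n k)) = iteratedResidue (magogResiduand n k) := by
  have hmem := magogResiduand_mem n k
  obtain ⟨π, ε⟩ := g
  set l := (List.finRange k).map π.symm
  have hp : l.Perm (List.finRange k) := by
    refine (List.perm_ext_iff_of_nodup ((List.nodup_finRange k).map π.symm.injective)
      (List.nodup_finRange k)).2 fun i => ?_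
    simp only [List.mem_map, List.mem_finRange, true_and, iff_true]
    exact ⟨π i, π.symm_apply_apply i⟩
  obtain ⟨r, hr⟩ := iterRes_eq_ratCast (l := (List.finRange k).map fun i => (i, 1)) subset_rfl
    (fun i => ⟨(i, 1), by simp, rfl⟩) hmem
  have hr' : iterRes₀ (List.finRange k) (magogResiduand n k) = algebraMap ℚ (RatField k) r := hr
  have hmap : (l.map fun i => (i, (ε ∘ π) i)).map Prod.fst = l := by
    rw [List.map_map]
    exact List.map_id _
  have key := iterRes₀_iterRes_magogResiduand hkn (l.map fun i => (i, (ε ∘ π) i)) []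
    (by rw [List.nil_append, hmap]; exact hp)
  rw [List.nil_append, hmap, iterRes₀_perm subset_rfl hp hmem, hr'] at key
  rw [signedAct, signAct_permAct, ← iterRes₀_finRange, ← iterRes₀_finRange, iterRes₀_permAct,
    iterRes₀_signAct _ (hp.nodup_iff.2 (List.nodup_finRange k)), hr']
  have key' : iterRes (l.map fun i => (i, (ε ∘ π) i)) (magogResiduand n k) =
    algebraMap ℚ (RatField k) r := key
  refine (congrArg (fun x => permAct π (signAct _ x)) key').trans ?_
  rw [signAct_ratCast, permAct_ratCast]

end MagogResidue

namespace MagogResidue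

/-! ### Absence of a Laurent expansion -/

variable {k : ℕ}

/-- Substituting a formal curve through the origin into `(x_1 ⋯ x_k) ^ N P₀ = Q₀ S` is legitimate,
as its components have no constant term. The monomial factor does not vanish on it, as no component
is zero, so `P₀` vanishes wherever `Q₀` does. -/
theorem aeval_eq_zero_of_hasLaurentExpansion {F : RatField k} (hF : HasLaurentExpansion F)
    {P₀ Q₀ : MvPolynomial (Fin k) ℚ} (hQ₀ : Q₀ ≠ 0)
    (hF₀ : F = algebraMap _ (RatField k) P₀ / algebraMap _ (RatField k) Q₀)
    {a : Fin k → PowerSeries ℚ} (ha : ∀ i, PowerSeries.constantCoeff (a i) = 0)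
    (ha0 : ∀ i, a i ≠ 0) (hQ : MvPolynomial.aeval a Q₀ = 0) : MvPolynomial.aeval a P₀ = 0 := by
  obtain ⟨P, Q, N, S, hQ0, hPQ, hS⟩ := hF
  have hinj := IsFractionRing.injective (MvPolynomial (Fin k) ℚ) (RatField k)
  have hcross : P * Q₀ = P₀ * Q := by
    rw [hPQ, div_eq_div_iff ((map_ne_zero_iff _ hinj).2 hQ0) ((map_ne_zero_iff _ hinj).2 hQ₀),
      ← map_mul, ← map_mul] at hF₀
    exact hinj hF₀
  have hcross' : (P : MvPowerSeries (Fin k) ℚ) * Q₀ = P₀ * Q := by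
    rw [← MvPolynomial.coe_mul, hcross, MvPolynomial.coe_mul]
  have hQ' : (Q : MvPowerSeries (Fin k) ℚ) ≠ 0 := by
    rwa [Ne, MvPolynomial.coe_eq_zero_iff]
  have key : (∏ i : Fin k, MvPowerSeries.X i) ^ N * (P₀ : MvPowerSeries (Fin k) ℚ) =
      (Q₀ : MvPowerSeries (Fin k) ℚ) * S := by
    apply mul_right_cancel₀ hQ'
    rw [mul_assoc, ← hcross', ← mul_assoc, hS]
    ring
  have hsub : MvPowerSeries.HasSubst a := MvPowerSeries.hasSubst_of_constantCoeff_zero ha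
  have h := congrArg (MvPowerSeries.substAlgHom (R := ℚ) hsub) key
  rw [map_mul, map_mul, MvPowerSeries.substAlgHom_coe, MvPowerSeries.substAlgHom_coe, hQ, zero_mul,
    map_pow, map_prod] at h
  rcases mul_eq_zero.1 h with h | h
  · refine absurd h (pow_ne_zero _ (Finset.prod_ne_zero_iff.2 fun i _ => ?_))
    rw [MvPowerSeries.substAlgHom_X]
    exact ha0 i
  · exact h

/-- The numerator of the residuand. -/
noncomputable def magogNum (k : ℕ) : MvPolynomial (Fin k) ℚ :=
  (∏ i : Fin k, (1 - 2 * MvPolynomial.X i)) *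
    ∏ i : Fin k, ∏ j ∈ Finset.Ioi i, (MvPolynomial.X j - MvPolynomial.X i) *
      (MvPolynomial.X j + MvPolynomial.X i - 1)

/-- The denominator of the residuand. -/
noncomputable def magogDen (n k : ℕ) : MvPolynomial (Fin k) ℚ :=
  (∏ i : Fin k, (1 - MvPolynomial.X i) ^ (n + k + 1) *
      MvPolynomial.X i ^ (n + k - (i.val + 1))) *
    ∏ i : Fin k, ∏ j ∈ Finset.Ioi i, (1 - MvPolynomial.X i * MvPolynomial.X j)

theorem magogResiduand_eq_div (n k : ℕ) :
    magogResiduand n k = algebraMap _ (RatField k) (magogNum k) /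
      algebraMap _ (RatField k) (magogDen n k) := by
  simp only [magogResiduand, magogDelta, magogNum, magogDen, ratVar, map_mul, map_prod, map_sub,
    map_one, map_add, map_pow, map_ofNat]

theorem magogDen_ne_zero (n k : ℕ) : magogDen n k ≠ 0 := by
  intro h
  have h2 := congrArg (algebraMap _ (RatField k)) h
  simp only [magogDen, map_mul, map_prod, map_sub, map_one, map_pow, map_zero, mul_eq_zero,
    Finset.prod_eq_zero_iff] at h2
  rcases h2 with ⟨i, -, h2⟩ | ⟨i, -, j, hj, h2⟩
  · rcases h2 with h2 | h2
    · exact one_sub_ratVar_ne_zero i (eq_zero_of_pow_eq_zero h2)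
    · exact ratVar_ne_zero i (eq_zero_of_pow_eq_zero h2)
  · exact one_sub_mul_ne_zero (Finset.mem_Ioi.1 hj).ne' h2

theorem signAct_algebraMap (ε : Fin k → ℤˣ) (p : MvPolynomial (Fin k) ℚ) :
    signAct ε (algebraMap _ (RatField k) p) = algebraMap _ (RatField k) (signPoly ε p) := by
  rw [signAct, IsFractionRing.ringEquivOfRingEquiv_algebraMap]
  rfl

theorem permAct_one (f : RatField k) : permAct 1 f = f := by
  have : ((permAct 1 : RatField k ≃+* RatField k) : RatField k →+* RatField k) =
      RingHom.id _ := by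
    apply ratField_hom_ext
    intro j
    simp [permAct_ratVar]
  exact RingHom.congr_fun this f

theorem aeval_signPoly (a : Fin k → PowerSeries ℚ) (p : MvPolynomial (Fin k) ℚ) :
    MvPolynomial.aeval a (signPoly (fun _ => -1) p) = MvPolynomial.aeval (fun i => 1 - a i) p := by
  have : (MvPolynomial.aeval a).comp (signPoly fun _ : Fin k => -1) =
      MvPolynomial.aeval (R := ℚ) (fun i => 1 - a i) := by
    apply MvPolynomial.algHom_ext
    intro i
    simp [signPoly]
  exact DFunLike.congr_fun this p

/-- A curve on which `x_1 + x_2 - x_1 x_2` vanishes. -/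
noncomputable def curve (i : Fin k) : PowerSeries ℚ :=
  if i.val = 1 then 1 - PowerSeries.mk 1 else PowerSeries.X ^ (max i.val 1)

theorem curve_constantCoeff (i : Fin k) : PowerSeries.constantCoeff (curve i) = 0 := by
  unfold curve
  split_ifs
  · rw [← PowerSeries.coeff_zero_eq_constantCoeff_apply, map_sub, PowerSeries.coeff_mk]
    simp
  · simp

theorem curve_injective : Function.Injective (curve : Fin k → PowerSeries ℚ) := by
  have h1 : ∀ m, PowerSeries.X ^ max m 1 ≠ (1 - PowerSeries.mk 1 : PowerSeries ℚ) := by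
    intro m h
    have := congrArg (PowerSeries.coeff 1) h
    have h2 : PowerSeries.coeff 1 (1 - PowerSeries.mk 1 : PowerSeries ℚ) = -1 := by
      simp [PowerSeries.coeff_one]
    rw [PowerSeries.coeff_X_pow, h2] at this
    split_ifs at this <;> norm_num at this
  intro i j h
  unfold curve at h
  split_ifs at h with hi hj hj
  · exact Fin.ext (hi.trans hj.symm)
  · exact absurd h.symm (h1 _)
  · exact absurd h (h1 _)
  · have := congrArg (PowerSeries.coeff (max i.val 1)) h
    rw [PowerSeries.coeff_X_pow, PowerSeries.coeff_X_pow, if_pos rfl] at this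
    split_ifs at this with he
    · exact Fin.ext (by omega)
    · simp at this

theorem curve_ne_zero (i : Fin k) : curve i ≠ 0 := by
  unfold curve
  split_ifs
  · intro h
    have := congrArg (PowerSeries.coeff 1) h
    simp [PowerSeries.coeff_one] at this
  · exact pow_ne_zero _ PowerSeries.X_ne_zero

theorem not_hasLaurentExpansion_signedAct_magogResiduand (n : ℕ) {k : ℕ} (hk : 2 ≤ k) :
    ¬ HasLaurentExpansion (signedAct (1, fun _ => -1) (magogResiduand n k)) := by
  intro h
  have hne : ∀ f : PowerSeries ℚ, PowerSeries.constantCoeff f ≠ 0 → f ≠ 0 := by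
    rintro _ hf rfl
    exact hf (map_zero _)
  have key := aeval_eq_zero_of_hasLaurentExpansion h
    (P₀ := signPoly (fun _ => -1) (magogNum k)) (Q₀ := signPoly (fun _ => -1) (magogDen n k)) ?_
    (by rw [signedAct, permAct_one, magogResiduand_eq_div, map_div₀, signAct_algebraMap,
      signAct_algebraMap]) curve_constantCoeff curve_ne_zero ?_
  · rw [aeval_signPoly] at key
    revert key
    simp only [magogNum, map_mul, map_prod, map_sub, map_one, map_add, MvPolynomial.aeval_X,
      map_ofNat]
    refine mul_ne_zero (Finset.prod_ne_zero_iff.2 fun i _ => hne _ ?_)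
      (Finset.prod_ne_zero_iff.2 fun i _ => Finset.prod_ne_zero_iff.2 fun j hj =>
        mul_ne_zero ?_ (hne _ ?_))
    · simp only [map_sub, map_mul, map_one, curve_constantCoeff, map_ofNat]
      norm_num
    · rw [sub_sub_sub_cancel_left, sub_ne_zero]
      exact fun e => (Finset.mem_Ioi.1 hj).ne (curve_injective e)
    · simp only [map_sub, map_add, map_one, curve_constantCoeff]
      norm_num
  · intro h0
    apply magogDen_ne_zero n k
    have := DFunLike.congr_fun (signPoly_comp_self fun _ : Fin k => -1) (magogDen n k)
    rw [AlgHom.comp_apply, h0, map_zero] at this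
    exact this.symm
  · rw [aeval_signPoly]
    simp only [magogDen, map_mul, map_prod, map_sub, map_one, map_pow, MvPolynomial.aeval_X]
    -- The factor of the first two variables is `1 - (1 - x_1)(1 - x_2)`, and on the curve `1 - x_1
    -- = 1 - t`, `1 - x_2 = 1 / (1 - t)`.
    refine mul_eq_zero_of_right _ (Finset.prod_eq_zero (Finset.mem_univ (⟨0, by omega⟩ : Fin k))
      (Finset.prod_eq_zero (i := (⟨1, by omega⟩ : Fin k))
        (by simp) ?_))
    have := PowerSeries.mk_one_mul_one_sub_eq_one ℚ
    simp only [curve, if_true, max_self, Nat.zero_ne_one, if_false, zero_le,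
      sup_of_le_right, pow_one]
    linear_combination -this

end MagogResidue

namespace MagogResidue

/-! ### Ballot determinants -/

open HahnSeries

/-- The coefficient of `T ^ (-1)` in `(1 - 2 T) T ^ (-A) (1 - T) ^ (-B)`, a ballot number. -/
noncomputable def ballot (A B : ℤ) : ℚ :=
  HahnSeries.coeff ((1 - 2 * single 1 1) * (single 1 1 ^ (-A) * (1 - single 1 1) ^ (-B)) :
    LaurentSeries ℚ) (-1)

theorem residue_eq_ballot {k : ℕ} (i : Fin k) (A B : ℤ) :
    residue i ((1 - 2 * ratVar i) * (ratVar i ^ (-A) * (1 - ratVar i) ^ (-B))) =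
      algebraMap ℚ (RatField k) (ballot A B) := by
  have h1 : laurentMap (algebraMap ℚ (RatField k)) (single 1 1) = single 1 1 := by
    rw [laurentMap_single, RingHom.map_one (algebraMap ℚ (RatField k))]
  rw [residue_eq_coeff, ballot, ← laurentMap_coeff]
  simp only [map_mul, map_sub, map_zpow₀, h1, laurentIn_self, RingHom.map_one, map_ofNat]

theorem ballot_eq_zero_of_residue {A B : ℤ}
    (h : residue (0 : Fin 1) ((1 - 2 * ratVar 0) * (ratVar 0 ^ (-A) * (1 - ratVar 0) ^ (-B))) = 0) :
    ballot A B = 0 := by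
  rw [residue_eq_ballot] at h
  exact (map_eq_zero _).1 h

theorem single_one_sub_ne_zero : (1 - single 1 1 : LaurentSeries ℚ) ≠ 0 := by
  intro h
  have := congrArg (fun x => HahnSeries.coeff x 0) h
  simp at this

theorem ballot_sub (A B : ℤ) : ballot A B - ballot (A - 1) B = ballot A (B - 1) := by
  have hT : (single 1 1 : LaurentSeries ℚ) ≠ 0 := by simp
  rw [ballot, ballot, ballot, ← HahnSeries.coeff_sub]
  congr 1
  have h1 : (single 1 1 : LaurentSeries ℚ) ^ (-(A - 1)) = single 1 1 ^ (-A) * single 1 1 := by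
    rw [← zpow_add_one₀ hT]; congr 1; ring
  have h2 : (1 - single 1 1 : LaurentSeries ℚ) ^ (-(B - 1)) =
      (1 - single 1 1) ^ (-B) * (1 - single 1 1) := by
    rw [← zpow_add_one₀ single_one_sub_ne_zero]; congr 1; ring
  rw [h1, h2]
  ring

theorem varFactor_expand {k : ℕ} (i : Fin k) (a b : ℤ) :
    (1 - 2 * ratVar i) * (ratVar i ^ a * (1 - ratVar i) ^ b) =
      ratVar i ^ a * (1 - ratVar i) ^ b -
        (ratVar i ^ (a + 1) * (1 - ratVar i) ^ b + ratVar i ^ (a + 1) * (1 - ratVar i) ^ b) := by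
  rw [zpow_add_one₀ (ratVar_ne_zero i)]; ring

theorem ballot_of_nonpos {A B : ℤ} (hA : A ≤ 0) : ballot A B = 0 := by
  apply ballot_eq_zero_of_residue
  rw [varFactor_expand, ← res_one, res_sub, res_add, res_zero_eq_zero (by omega),
    res_zero_eq_zero (by omega)]
  simp

/-- For `A = B` the function is odd under `x ↦ 1 - x` because of the factor `1 - 2 x`, so its two
local residues are opposite. They are also equal, as there is no residue at infinity. -/
theorem ballot_self {N : ℤ} (hN : 2 ≤ N) : ballot N N = 0 := by
  apply ballot_eq_zero_of_residue
  set F : RatField 1 := (1 - 2 * ratVar 0) * (ratVar 0 ^ (-N) * (1 - ratVar 0) ^ (-N)) with hF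
  have h1 : resDiff 0 F = 0 := by
    rw [hF, varFactor_expand, resDiff_sub, resDiff_add, resDiff_monomial _ (by omega),
      resDiff_monomial _ (by omega)]
    simp
  have h2 : res (0, -1) F = -res (0, 1) F := by
    rw [res_eq_residue, res_one, ← res_one, ← res_one, ← res_neg]
    congr 1
    simp only [hF, map_mul, map_sub, map_one, map_zpow₀, signAct_ratVar, Pi.mulSingle_eq_same,
      map_ofNat]
    rw [if_neg (by simp), sub_sub_cancel]
    ring
  rw [resDiff, h2, sub_neg_eq_add, ← two_mul] at h1
  rw [← res_one]
  simpa using h1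

theorem ballot_one (B : ℤ) : ballot 1 B = 1 := by
  have key : ∀ b : ℤ, residue (0 : Fin 1) (ratVar 0 ^ (-1 : ℤ) * (1 - ratVar 0) ^ b) = 1 := by
    have hstep : ∀ b : ℤ, residue (0 : Fin 1) (ratVar 0 ^ (-1 : ℤ) * (1 - ratVar 0) ^ b) =
        residue (0 : Fin 1) (ratVar 0 ^ (-1 : ℤ) * (1 - ratVar 0) ^ (b + 1)) := fun b => by
      rw [monomial_split, ← res_one, ← res_one, res_add, res_zero_eq_zero (by norm_num), zero_add]
    intro b
    induction b using Int.induction_on with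
    | zero =>
      rw [zpow_zero, mul_one, ← res_one, res_zero_zpow, if_pos rfl]
    | succ b ih => rw [← hstep, ih]
    | pred b ih => rw [hstep, sub_add_cancel, ih]
  have := residue_eq_ballot (0 : Fin 1) 1 B
  rw [varFactor_expand, ← res_one, res_sub, res_add,
    res_zero_eq_zero (a := -1 + 1) (by norm_num), res_one, key, add_zero, sub_zero] at this
  exact ((map_eq_one_iff _ (algebraMap ℚ (RatField 1)).injective).1 this.symm)

variable {k : ℕ}

/-- A row of the ballot determinant. -/
noncomputable def ballotRow (k : ℕ) (n : ℕ) (e : ℤ) (j : Fin k) : ℚ := ballot (e + j) (n + 1 + j)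

/-- The ballot determinant. -/
noncomputable def ballotDet (n : ℕ) (a : Fin k → ℤ) : ℚ :=
  Matrix.det (Matrix.of fun i => ballotRow k n (a i - i))

theorem ballotRow_sub (n : ℕ) (e : ℤ) :
    ballotRow k (n + 1) e - ballotRow k (n + 1) (e - 1) = ballotRow k n e := by
  funext j
  simp only [ballotRow, Pi.sub_apply]
  rw [show e - 1 + (j : ℤ) = e + j - 1 by ring, ballot_sub]
  congr 1
  push_cast; ring

theorem sum_ballotRow (n : ℕ) (c : ℤ) {l u : ℤ} (h : l ≤ u + 1) :
    ∑ e ∈ Finset.Icc l u, ballotRow k n (e - c) =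
      ballotRow k (n + 1) (u - c) - ballotRow k (n + 1) (l - 1 - c) := by
  obtain ⟨m, rfl⟩ : ∃ m : ℕ, u = l - 1 + m := ⟨(u - (l - 1)).toNat, by omega⟩
  induction m with
  | zero => simp
  | succ m ih =>
    have hI : Finset.Icc l (l - 1 + (m + 1 : ℕ)) =
        insert (l - 1 + (m + 1 : ℕ)) (Finset.Icc l (l - 1 + m)) := by
      ext x; simp only [Finset.mem_Icc, Finset.mem_insert]; push_cast; omega
    rw [hI, Finset.sum_insert (by simp), ih (by omega), ← ballotRow_sub]
    rw [show l - 1 + ((m + 1 : ℕ) : ℤ) - c - 1 = l - 1 + m - c by push_cast; ring]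
    abel

/-- The next entry of a vector, with `1` after the last one. -/
def nextEntry (a : Fin k → ℤ) (i : Fin k) : ℤ :=
  if h : i.val + 1 < k then a ⟨i.val + 1, h⟩ else 1

/-- The vectors that interlace with `a`. -/
noncomputable def interlacing (a : Fin k → ℤ) : Finset (Fin k → ℤ) :=
  Fintype.piFinset fun i => Finset.Icc (nextEntry a i) (a i)

/-- The row operation is left multiplication by a unitriangular matrix. -/
theorem det_sub_next {R : Type*} [CommRing R] (M : Matrix (Fin k) (Fin k) R) :
    Matrix.det (Matrix.of fun i j => M i j -
      if h : i.val + 1 < k then M ⟨i.val + 1, h⟩ j else 0) = M.det := by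
  let U : Matrix (Fin k) (Fin k) R := Matrix.of fun i j =>
    if i = j then 1 else if i.val + 1 = j.val then -1 else 0
  have hU : U.det = 1 := by
    rw [Matrix.det_of_isUpperTriangular]
    · simp [U]
    · intro i j hij
      simp only [id] at hij
      simp only [U, Matrix.of_apply]
      rw [if_neg hij.ne', if_neg (by have := Fin.lt_def.1 hij; omega)]
  have hM : (Matrix.of fun i j => M i j -
      if h : i.val + 1 < k then M ⟨i.val + 1, h⟩ j else 0) = U * M := by
    ext i j
    rw [Matrix.mul_apply, Matrix.of_apply]
    have : ∀ l, U i l * M l j = (if l = i then M l j else 0) -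
        (if i.val + 1 = l.val then M l j else 0) := fun l => by
      simp only [U, Matrix.of_apply]
      by_cases h1 : i = l
      · subst h1; simp
      · by_cases h2 : i.val + 1 = l.val
        · simp [h1, h2, Ne.symm h1]
        · simp [h1, h2, Ne.symm h1]
    simp only [this, Finset.sum_sub_distrib, Finset.sum_ite_eq', Finset.mem_univ, if_true]
    congr 1
    split_ifs with h
    · rw [Finset.sum_eq_single ⟨i.val + 1, h⟩]
      · simp
      · intro l _ hl
        rw [if_neg fun e => hl (Fin.ext e.symm)]
      · simp
    · refine (Finset.sum_eq_zero fun l _ => if_neg fun e => h ?_).symm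
      rw [e]; exact l.2
  rw [hM, Matrix.det_mul, hU, one_mul]

theorem ballotDet_eq_zero_of_row (n : ℕ) {a : Fin k → ℤ} (i : Fin k)
    (h : ballotRow k n (a i - i) = 0) : ballotDet n a = 0 :=
  Matrix.det_eq_zero_of_row_eq_zero i fun j => congrFun h j

theorem ballotRow_of_nonpos (n : ℕ) {e : ℤ} (h : e + k ≤ 1) : ballotRow k n e = 0 := by
  funext j
  exact ballot_of_nonpos (by have := j.2; omega)

theorem ballotDet_top {n : ℕ} (hn : 1 ≤ n) {a : Fin k → ℤ} {i : Fin k} (hi : i.val = 0)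
    (h : a i = n + 1) : ballotDet n a = 0 := by
  refine ballotDet_eq_zero_of_row n i ?_
  funext j
  rw [ballotRow, h, hi]
  simp only [Nat.cast_zero, sub_zero]
  exact ballot_self (by omega)

theorem ballotDet_bottom {n : ℕ} {a : Fin k → ℤ} {i : Fin k} (hi : i.val + 1 = k)
    (h : a i ≤ 0) : ballotDet n a = 0 :=
  ballotDet_eq_zero_of_row n i (ballotRow_of_nonpos n (by omega))

theorem ballotDet_one : ballotDet 1 (fun _ : Fin k => 1) = 1 := by
  rw [ballotDet, Matrix.det_of_isUpperTriangular]
  · refine Finset.prod_eq_one fun i _ => ?_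
    simp only [Matrix.of_apply, ballotRow, sub_add_cancel]
    exact ballot_one _
  · intro i j hij
    simp only [id] at hij
    have := Fin.lt_def.1 hij
    exact ballot_of_nonpos (by omega)

/-- By multilinearity the sum over interlacing vectors is a determinant whose rows are sums over
intervals. These telescope to differences of consecutive rows of the larger determinant. For the
last row the subtracted term is zero, which is why `nextEntry` is `1` there. -/
theorem ballotDet_succ (n : ℕ) {a : Fin k → ℤ} (ha : Antitone a) (h1 : ∀ i, 1 ≤ a i) :
    ballotDet (n + 1) a = ∑ a' ∈ interlacing a, ballotDet n a' := by
  have hnext : ∀ i, nextEntry a i ≤ a i := fun i => by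
    unfold nextEntry
    split_ifs with h
    · exact ha (Fin.le_def.2 (by simp))
    · exact h1 i
  have := (Matrix.detRowAlternating (R := ℚ) (n := Fin k)).toMultilinearMap.map_sum_finset
    (fun i e => ballotRow k n (e - i)) (fun i => Finset.Icc (nextEntry a i) (a i))
  rw [interlacing]
  refine Eq.trans ?_ this
  rw [ballotDet, ← det_sub_next]
  change _ = Matrix.det _
  congr 1
  ext i j
  rw [sum_ballotRow n _ (by have := hnext i; omega), Matrix.of_apply, Pi.sub_apply]
  congr 1
  unfold nextEntry
  split_ifs with h
  · simp only [Matrix.of_apply]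
    congr 1
    push_cast; ring
  · rw [ballotRow_of_nonpos]
    · rfl
    · have := i.2; omega

end MagogResidue

namespace MagogResidue

/-! ### Magog trapezoids -/

variable {k : ℕ}

/-- The vector of last entries of the rows of an array, with `1` for an empty row. -/
def lastEntry {n : ℕ} (c : (i : Fin k) → Fin (n - i.val) → ℤ) (i : Fin k) : ℤ :=
  if h : 0 < n - i.val then c i ⟨n - i.val - 1, by omega⟩ else 1

/-- The trapezoids with prescribed last entries. -/
abbrev TrapezoidsWithLast (n : ℕ) (a : Fin k → ℤ) : Type :=
  {c : (i : Fin k) → Fin (n - i.val) → ℤ // IsMagogTrapezoid n k c ∧ lastEntry c = a}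

/-- Removal of the last entry of every row. -/
def truncArr {n : ℕ} (c : (i : Fin k) → Fin (n + 1 - i.val) → ℤ) (i : Fin k)
    (j : Fin (n - i.val)) : ℤ :=
  c i ⟨j.val, by have := j.2; omega⟩

/-- Addition of a last entry to every row. -/
def extendArr {n : ℕ} (c : (i : Fin k) → Fin (n - i.val) → ℤ) (a : Fin k → ℤ) (i : Fin k)
    (j : Fin (n + 1 - i.val)) : ℤ :=
  if h : j.val < n - i.val then c i ⟨j.val, h⟩ else a i

theorem lastEntry_of_pos {n : ℕ} (c : (i : Fin k) → Fin (n - i.val) → ℤ) {i : Fin k}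
    {j : Fin (n - i.val)} (h : j.val + 1 = n - i.val) : lastEntry c i = c i j := by
  rw [lastEntry, dif_pos (by omega)]
  congr 1
  exact Fin.ext (by simp; omega)

theorem lastEntry_of_nonpos {n : ℕ} (c : (i : Fin k) → Fin (n - i.val) → ℤ) {i : Fin k}
    (h : n ≤ i.val) : lastEntry c i = 1 := by
  rw [lastEntry, dif_neg (by omega)]

theorem isMagogTrapezoid_truncArr {n : ℕ} {c : (i : Fin k) → Fin (n + 1 - i.val) → ℤ}
    (hc : IsMagogTrapezoid (n + 1) k c) : IsMagogTrapezoid n k (truncArr c) where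
  bounds i _ := hc.bounds i _
  column i i' _ _ hi hj := hc.column i i' _ _ hi hj
  row i _ _ hj := hc.row i _ _ hj

/-- The last entry of row `i + 1` stands in the same column as the last entry of the truncated row
`i`, so the column condition gives the lower bound and the row condition the upper one. -/
theorem lastEntry_truncArr_mem {n : ℕ} {c : (i : Fin k) → Fin (n + 1 - i.val) → ℤ}
    (hc : IsMagogTrapezoid (n + 1) k c) :
    lastEntry (truncArr c) ∈ interlacing (lastEntry c) := by
  rw [interlacing, Fintype.mem_piFinset]
  intro i
  rw [Finset.mem_Icc]
  rcases lt_or_ge i.val n with hi | hi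
  · have e1 : lastEntry c i = c i ⟨n - i.val, by omega⟩ :=
      lastEntry_of_pos c (by simp; omega)
    have e2 : lastEntry (truncArr c) i = c i ⟨n - i.val - 1, by omega⟩ :=
      lastEntry_of_pos (truncArr c) (j := ⟨n - i.val - 1, by omega⟩) (by simp; omega)
    rw [e1, e2]
    refine ⟨?_, hc.row i _ _ (by simp; omega)⟩
    unfold nextEntry
    split_ifs with h
    · have e3 : lastEntry c ⟨i.val + 1, h⟩ = c ⟨i.val + 1, h⟩ ⟨n - i.val - 1, by simp; omega⟩ :=
        lastEntry_of_pos c (by simp; omega)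
      rw [e3]
      exact hc.column i _ _ _ rfl rfl
    · exact (hc.bounds _ _).1
  · rw [lastEntry_of_nonpos _ hi]
    constructor
    · unfold nextEntry
      split_ifs with h
      · exact (lastEntry_of_nonpos c (by simp; omega)).le
      · exact le_rfl
    · unfold lastEntry
      split_ifs with h
      · exact (hc.bounds _ _).1
      · exact le_rfl

/-- Only the first row needs an upper bound on its new entry; in every other row the new entry is
bounded by the entry above it. -/
theorem extendArr_spec {n : ℕ} {c : (i : Fin k) → Fin (n - i.val) → ℤ}
    (hc : IsMagogTrapezoid n k c) {a : Fin k → ℤ} (ha : lastEntry c ∈ interlacing a)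
    (h1 : ∀ i, 1 ≤ a i) (hn : ∀ i : Fin k, i.val = 0 → a i ≤ n + 1) :
    IsMagogTrapezoid (n + 1) k (extendArr c a) ∧ lastEntry (extendArr c a) = a := by
  rw [interlacing, Fintype.mem_piFinset] at ha
  simp only [Finset.mem_Icc] at ha
  have hnext : ∀ i i' : Fin k, i'.val = i.val + 1 → a i' ≤ lastEntry c i := fun i i' h => by
    have h2 := (ha i).1
    have e : i' = ⟨i.val + 1, h ▸ i'.2⟩ := Fin.ext h
    rw [nextEntry, dif_pos (h ▸ i'.2)] at h2
    rwa [e]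
  refine ⟨⟨fun i j => ?_, fun i i' j j' hi hj => ?_, fun i j j' hj => ?_⟩, ?_⟩
  · unfold extendArr
    split_ifs with h
    · exact hc.bounds i _
    · refine ⟨h1 i, ?_⟩
      have hj2 := j.2
      rcases Nat.eq_zero_or_pos i.val with h0 | h0
      · have := hn i h0
        omega
      · have h2 := hnext ⟨i.val - 1, by have := i.2; omega⟩ i (by simp; omega)
        rw [lastEntry_of_pos c (j := ⟨j.val, by simp; omega⟩) (by simp; omega)] at h2
        exact h2.trans (hc.bounds _ _).2
  · have hj2 := j'.2
    unfold extendArr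
    rw [dif_pos (show j.val < n - i.val by omega)]
    split_ifs with h
    · exact hc.column i i' _ _ hi hj
    · have h2 := hnext i i' hi
      rwa [lastEntry_of_pos c (j := ⟨j.val, by omega⟩) (by simp; omega)] at h2
  · have hj2 := j'.2
    unfold extendArr
    rw [dif_pos (show j.val < n - i.val by omega)]
    split_ifs with h
    · exact hc.row i _ _ hj
    · have h2 := (ha i).2
      rwa [lastEntry_of_pos c (j := ⟨j.val, by omega⟩) (by simp; omega)] at h2
  · funext i
    rcases lt_or_ge i.val (n + 1) with hi | hi
    · rw [lastEntry_of_pos _ (j := ⟨n - i.val, by omega⟩) (by simp; omega), extendArr,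
        dif_neg (by simp)]
    · rw [lastEntry_of_nonpos _ hi]
      have h2 := hnext ⟨i.val - 1, by have := i.2; omega⟩ i (by simp; omega)
      rw [lastEntry_of_nonpos c (by simp; omega)] at h2
      exact le_antisymm (h1 i) h2

theorem truncArr_extendArr {n : ℕ} (c : (i : Fin k) → Fin (n - i.val) → ℤ) (a : Fin k → ℤ) :
    truncArr (extendArr c a) = c := by
  funext i j
  rw [truncArr, extendArr, dif_pos j.2]

theorem extendArr_truncArr {n : ℕ} (c : (i : Fin k) → Fin (n + 1 - i.val) → ℤ) :
    extendArr (truncArr c) (lastEntry c) = c := by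
  funext i j
  rw [extendArr]
  split_ifs with h
  · rfl
  · exact lastEntry_of_pos c (by have := j.2; omega)

theorem finite_isMagogTrapezoid (n k : ℕ) :
    {c : (i : Fin k) → Fin (n - i.val) → ℤ | IsMagogTrapezoid n k c}.Finite := by
  refine (Set.finite_Icc (fun _ _ => 1) (fun _ j => (j.val : ℤ) + 1)).subset fun c hc => ?_
  exact ⟨fun i j => (hc.bounds i j).1, fun i j => (hc.bounds i j).2⟩

instance finite_trapezoidsWithLast (n : ℕ) (a : Fin k → ℤ) : Finite (TrapezoidsWithLast n a) :=
  ((finite_isMagogTrapezoid n k).subset fun _ hc => hc.1).to_subtype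

/-- Removal of the last entries, as an equivalence. -/
def trapezoidsWithLastEquiv {n : ℕ} {a : Fin k → ℤ} (h1 : ∀ i, 1 ≤ a i)
    (hn : ∀ i : Fin k, i.val = 0 → a i ≤ n + 1) :
    TrapezoidsWithLast (n + 1) a ≃ Σ a' : interlacing a, TrapezoidsWithLast n a'.1 where
  toFun c := ⟨⟨lastEntry (truncArr c.1), by
    have := lastEntry_truncArr_mem c.2.1
    rwa [c.2.2] at this⟩, truncArr c.1, isMagogTrapezoid_truncArr c.2.1, rfl⟩
  invFun x := ⟨extendArr x.2.1 a, extendArr_spec x.2.2.1 (by rw [x.2.2.2]; exact x.1.2) h1 hn⟩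
  left_inv c := by
    obtain ⟨c, hc, rfl⟩ := c
    exact Subtype.ext (extendArr_truncArr c)
  right_inv x := by
    obtain ⟨⟨a', ha'⟩, c, hc, hca⟩ := x
    simp only at hca
    subst hca
    have h (d : (i : Fin k) → Fin (n - i.val) → ℤ) (hd : d = c)
        (h' : lastEntry d ∈ interlacing a) (h'' : IsMagogTrapezoid n k d) :
        (⟨⟨lastEntry d, h'⟩, d, h'', rfl⟩ :
          Σ a' : interlacing a, TrapezoidsWithLast n a'.1) = ⟨⟨lastEntry c, ha'⟩, c, hc, rfl⟩ := by
      subst hd; rfl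
    have e := truncArr_extendArr c a
    exact h _ e (by rw [e]; exact ha') (by rw [e]; exact hc)

theorem card_trapezoidsWithLast_succ {n : ℕ} {a : Fin k → ℤ} (h1 : ∀ i, 1 ≤ a i)
    (hn : ∀ i : Fin k, i.val = 0 → a i ≤ n + 1) :
    Nat.card (TrapezoidsWithLast (n + 1) a) =
      ∑ a' ∈ interlacing a, Nat.card (TrapezoidsWithLast n a') := by
  rw [Nat.card_congr (trapezoidsWithLastEquiv h1 hn), Nat.card_sigma,
    Finset.sum_coe_sort (interlacing a) fun a' => Nat.card (TrapezoidsWithLast n a')]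

theorem card_trapezoidsWithLast_top {n : ℕ} {a : Fin k → ℤ} {i : Fin k} (hi : i.val = 0)
    (hn : 1 ≤ n) (h : n < a i) : Nat.card (TrapezoidsWithLast n a) = 0 := by
  rw [Nat.card_eq_zero]
  refine Or.inl ⟨fun c => ?_⟩
  obtain ⟨c, hc, rfl⟩ := c
  rw [lastEntry_of_pos c (j := ⟨n - 1, by omega⟩) (by simp; omega)] at h
  have := (hc.bounds i ⟨n - 1, by omega⟩).2
  simp only at this
  omega

theorem card_trapezoidsWithLast_one :
    Nat.card (TrapezoidsWithLast 1 (fun _ : Fin k => 1)) = 1 := by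
  rw [Nat.card_eq_one_iff_unique]
  refine ⟨⟨fun c d => Subtype.ext ?_⟩, ⟨fun _ _ => 1, ⟨fun i j => by simp, by simp, by simp⟩, ?_⟩⟩
  · funext i j
    have h1 := c.2.1.bounds i j
    have h2 := d.2.1.bounds i j
    have := j.2
    omega
  · funext i
    simp [lastEntry]

/-- Both sides satisfy the same recursion. The range of the first entry exceeds the possible values
by one, since interlacing vectors one size below reach that far; at the extra value both sides
vanish. -/
theorem card_trapezoidsWithLast_eq (n : ℕ) : ∀ {a : Fin k → ℤ}, Antitone a → (∀ i, 1 ≤ a i) →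
    (∀ i : Fin k, i.val = 0 → a i ≤ n + 2) →
    (Nat.card (TrapezoidsWithLast (n + 1) a) : ℚ) = ballotDet (n + 1) a := by
  induction n with
  | zero =>
    intro a ha h1 hn
    by_cases h : ∃ i : Fin k, i.val = 0 ∧ a i = 2
    · obtain ⟨i, hi, h⟩ := h
      rw [card_trapezoidsWithLast_top hi le_rfl (by rw [h]; norm_num),
        ballotDet_top le_rfl hi (by rw [h]; norm_num), Nat.cast_zero]
    · have : a = fun _ => 1 := by
        funext i
        have h0 : a i ≤ a ⟨0, i.pos⟩ := ha (Fin.le_def.2 (by simp))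
        have h2 := hn ⟨0, i.pos⟩ rfl
        have h3 : a ⟨0, i.pos⟩ ≠ 2 := fun e => h ⟨_, rfl, e⟩
        have h4 := h1 i
        simp only [Nat.cast_zero, zero_add] at h2
        omega
      rw [this]
      simp only [zero_add]
      rw [card_trapezoidsWithLast_one, ballotDet_one, Nat.cast_one]
  | succ n ih =>
    intro a ha h1 hn
    by_cases h : ∃ i : Fin k, i.val = 0 ∧ a i = (n + 1 : ℕ) + 2
    · obtain ⟨i, hi, h⟩ := h
      rw [card_trapezoidsWithLast_top hi (by omega) (by rw [h]; push_cast; omega),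
        ballotDet_top (by omega) hi (by rw [h]; push_cast; ring), Nat.cast_zero]
    · have hn' : ∀ i : Fin k, i.val = 0 → a i ≤ (n + 1 : ℕ) + 1 := fun i hi => by
        have h2 := hn i hi
        have h3 : a i ≠ (n + 1 : ℕ) + 2 := fun e => h ⟨i, hi, e⟩
        omega
      rw [card_trapezoidsWithLast_succ h1 hn', ballotDet_succ _ ha h1, Nat.cast_sum]
      refine Finset.sum_congr rfl fun a' ha' => ?_
      rw [interlacing, Fintype.mem_piFinset] at ha'
      simp only [Finset.mem_Icc] at ha'
      have hnext : ∀ i, 1 ≤ nextEntry a i := fun i => by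
        unfold nextEntry
        split_ifs
        · exact h1 _
        · exact le_rfl
      refine ih ?_ (fun i => (hnext i).trans (ha' i).1) fun i hi => ?_
      · intro i j hij
        rcases hij.eq_or_lt with rfl | hij
        · exact le_rfl
        · refine ((ha' j).2.trans ?_).trans (ha' i).1
          have hij := Fin.lt_def.1 hij
          rw [nextEntry, dif_pos (by have := j.2; omega)]
          exact ha (Fin.le_def.2 (by simp; omega))
      · have := (ha' i).2.trans (hn' i hi)
        push_cast at this
        omega

/-- The weakly decreasing vectors with entries from `1` to `n`. -/
noncomputable def lastVectors (n k : ℕ) : Finset (Fin k → ℤ) := by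
  classical
  exact (Fintype.piFinset fun _ => Finset.Icc 1 (n : ℤ)).filter Antitone

theorem mem_lastVectors {n : ℕ} {a : Fin k → ℤ} :
    a ∈ lastVectors n k ↔ (∀ i, 1 ≤ a i ∧ a i ≤ n) ∧ Antitone a := by
  simp [lastVectors, Fintype.mem_piFinset]

theorem lastEntry_mem_lastVectors {n : ℕ} (hkn : k ≤ n)
    {c : (i : Fin k) → Fin (n - i.val) → ℤ} (hc : IsMagogTrapezoid n k c) :
    lastEntry c ∈ lastVectors n k := by
  rw [mem_lastVectors]
  have e : ∀ i : Fin k, lastEntry c i = c i ⟨n - i.val - 1, by have := i.2; omega⟩ := fun i =>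
    lastEntry_of_pos c (by have := i.2; simp; omega)
  constructor
  · intro i
    rw [e]
    have := hc.bounds i ⟨n - i.val - 1, by have := i.2; omega⟩
    have hi := i.2
    simp only at this
    omega
  · cases k with
    | zero => exact fun i => i.elim0
    | succ k =>
      refine Fin.antitone_iff_succ_le.2 fun i => ?_
      have hi := i.2
      rw [e, e]
      refine (hc.column i.castSucc i.succ ⟨n - i.val - 2, by simp; omega⟩ _ (by simp)
        (by simp; omega)).trans (hc.row _ _ _ (by simp; omega))

theorem magogCount_eq_sum {n k : ℕ} (hk : 1 ≤ k) (hkn : k ≤ n) :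
    (magogCount n k : ℚ) = ∑ a ∈ lastVectors n k, ballotDet n a := by
  let e : {c : (i : Fin k) → Fin (n - i.val) → ℤ // IsMagogTrapezoid n k c} ≃
      Σ a : lastVectors n k, TrapezoidsWithLast n a.1 :=
    { toFun := fun c => ⟨⟨lastEntry c.1, lastEntry_mem_lastVectors hkn c.2⟩, c.1, c.2, rfl⟩
      invFun := fun x => ⟨x.2.1, x.2.2.1⟩
      left_inv := fun _ => rfl
      right_inv := by
        rintro ⟨⟨a, ha⟩, c, hc, hca⟩
        simp only at hca
        subst hca
        rfl }
  rw [magogCount, Nat.card_congr e, Nat.card_sigma,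
    Finset.sum_coe_sort (lastVectors n k) fun a => Nat.card (TrapezoidsWithLast n a),
    Nat.cast_sum]
  obtain ⟨n, rfl⟩ : ∃ m, n = m + 1 := ⟨n - 1, by omega⟩
  refine Finset.sum_congr rfl fun a ha => ?_
  rw [mem_lastVectors] at ha
  exact card_trapezoidsWithLast_eq n ha.2 (fun i => (ha.1 i).1)
    fun i _ => by have := (ha.1 i).2; push_cast at this; omega

end MagogResidue

namespace MagogResidue

variable {k : ℕ}

/-! ### Residues of determinants -/

theorem iterRes₀_mul_prod {φ : Fin k → RatField k} {r : Fin k → ℚ}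
    (hφ : ∀ i, φ i ∈ poleAlg {i} {i} {i})
    (hr : ∀ i, residue i (φ i) = algebraMap ℚ (RatField k) (r i)) {l : List (Fin k)}
    (hl : l.Nodup) : ∀ {h : RatField k}, (∀ i ∈ l, IsFree i h) →
      iterRes₀ l (h * (l.map φ).prod) = h * algebraMap ℚ (RatField k) (l.map r).prod := by
  induction l with
  | nil => intro h _; simp [iterRes₀, iterRes_nil]
  | cons i l ih =>
    intro h hh
    rw [List.nodup_cons] at hl
    rw [List.map_cons, List.prod_cons, ← mul_assoc, iterRes₀_cons, ih hl.2, mul_right_comm,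
      ← res_one, res_free_mul (p := (i, 1)), res_one, hr, List.map_cons, List.prod_cons, map_mul]
    · ring
    · exact mem_freeSubfield.1 (mul_mem (mem_freeSubfield.2 (hh i (by simp)))
        (mem_freeSubfield.2 (isFree_ratCast i _)))
    · intro j hj
      have hji : j ≠ i := fun e => hl.1 (e ▸ hj)
      refine mem_freeSubfield.1 (mul_mem (mem_freeSubfield.2 (hh j (by simp [hj])))
        (mem_freeSubfield.2 (isFree_of_mem_poleAlg ?_ ?_ ?_ (hφ i)))) <;> simpa using hji

theorem iteratedResidue_prod {φ : Fin k → RatField k} {r : Fin k → ℚ}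
    (hφ : ∀ i, φ i ∈ poleAlg {i} {i} {i})
    (hr : ∀ i, residue i (φ i) = algebraMap ℚ (RatField k) (r i)) :
    iteratedResidue (∏ i, φ i) = algebraMap ℚ (RatField k) (∏ i, r i) := by
  have := iterRes₀_mul_prod hφ hr (List.nodup_finRange k) (h := 1)
    (fun i _ => mem_freeSubfield.1 (one_mem _))
  rwa [one_mul, one_mul, iterRes₀_finRange, ← Fin.prod_univ_def, ← Fin.prod_univ_def] at this

theorem iteratedResidue_sum {ι : Type*} (s : Finset ι) (f : ι → RatField k) :
    iteratedResidue (∑ a ∈ s, f a) = ∑ a ∈ s, iteratedResidue (f a) := by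
  simp only [← iterRes₀_finRange, iterRes₀, iterRes_sum]

theorem iteratedResidue_ratCast_mul (r : ℚ) (F : RatField k) :
    iteratedResidue (algebraMap ℚ (RatField k) r * F) =
      algebraMap ℚ (RatField k) r * iteratedResidue F := by
  simp only [← iterRes₀_finRange]
  induction List.finRange k with
  | nil => rfl
  | cons i l ih =>
    rw [iterRes₀_cons, iterRes₀_cons, ih, ← res_one, ← res_one,
      res_free_mul (p := (i, 1)) (isFree_ratCast i r)]

/-- Row `i` involves only `x_i`, so each term of the Leibniz expansion is a product of functions of
separate variables. -/
theorem iteratedResidue_det {M : Matrix (Fin k) (Fin k) (RatField k)}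
    {B : Matrix (Fin k) (Fin k) ℚ} (hM : ∀ i j, M i j ∈ poleAlg {i} {i} {i})
    (hB : ∀ i j, residue i (M i j) = algebraMap ℚ (RatField k) (B i j)) :
    iteratedResidue M.det = algebraMap ℚ (RatField k) B.det := by
  -- The transposition lets the permutation act on columns, so that factor `i` of a term lies in row
  -- `i`.
  rw [← Matrix.det_transpose, Matrix.det_apply', ← Matrix.det_transpose B, Matrix.det_apply',
    iteratedResidue_sum, map_sum]
  refine Finset.sum_congr rfl fun σ _ => ?_
  have : (((Equiv.Perm.sign σ : ℤ) : RatField k)) =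
      algebraMap ℚ (RatField k) ((Equiv.Perm.sign σ : ℤ) : ℚ) := by simp
  rw [this, iteratedResidue_ratCast_mul, map_mul]
  congr 1
  exact iteratedResidue_prod (fun i => hM i (σ i)) (fun i => hB i (σ i))

/-- The product of the differences of the `x_i (1 - x_i)`. -/
noncomputable def quadDiff (k : ℕ) : RatField k :=
  ∏ i : Fin k, ∏ j ∈ Finset.Ioi i, (quad i - quad j)

/-- `quadDiff` is a Vandermonde determinant. Absorbing the remaining factors into its rows gives a
matrix whose entries have ballot numbers as residues. -/
theorem iteratedResidue_monomial (n : ℕ) (a : Fin k → ℤ) :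
    iteratedResidue ((∏ i, (1 - 2 * ratVar i) *
      (ratVar i ^ (-(a i + k - 1 - i)) * (1 - ratVar i) ^ (-(n + k : ℤ)))) * quadDiff k) =
      algebraMap ℚ (RatField k) (ballotDet n a) := by
  have hq : quadDiff k = (Matrix.projVandermonde (fun _ => 1) (quad (k := k))).det := by
    rw [Matrix.det_projVandermonde, quadDiff]
    simp
  have h1 : ∀ i j : Fin k, (1 - 2 * ratVar i) *
      (ratVar i ^ (-(a i + k - 1 - i)) * (1 - ratVar i) ^ (-(n + k : ℤ))) *
        Matrix.projVandermonde (fun _ => 1) (quad (k := k)) i j =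
      (1 - 2 * ratVar i) * (ratVar i ^ (-(a i - i + j)) * (1 - ratVar i) ^ (-(n + 1 + j : ℤ))) := by
    intro i j
    have hj := j.2
    have e : (j.rev.val : ℤ) = k - 1 - j := by rw [Fin.val_rev]; omega
    rw [Matrix.projVandermonde_apply, one_pow, one_mul, quad, mul_pow, ← zpow_natCast,
      ← zpow_natCast, e, show (-(a i - i + j) : ℤ) = -(a i + k - 1 - i) + (k - 1 - j) by ring,
      show (-(n + 1 + j : ℤ)) = -(n + k : ℤ) + (k - 1 - j) by ring,
      zpow_add₀ (ratVar_ne_zero i), zpow_add₀ (one_sub_ratVar_ne_zero i)]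
    ring
  rw [hq, ← Matrix.det_mul_column, ballotDet]
  refine iteratedResidue_det (fun i j => ?_) fun i j => ?_
  · rw [Matrix.of_apply, h1]
    exact mul_mem (sub_mem (one_mem _) (mul_mem (ofNat_mem _ 2) (ratVar_mem (by simp))))
      (mul_mem (zpow_mem_poleAlg (by simp) (by simp) _)
        (one_sub_zpow_mem_poleAlg (by simp) (by simp) _))
  · rw [Matrix.of_apply, h1, residue_eq_ballot, Matrix.of_apply, ballotRow]

/-! ### Expansion into monomials -/

theorem iteratedResidue_eq_zero {i : Fin k} (hi : i.val + 1 = k) {F : RatField k}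
    (hF : F ∈ regular (i, 1)) : iteratedResidue F = 0 := by
  cases k with
  | zero => exact i.elim0
  | succ k =>
    obtain rfl : i = Fin.last k := Fin.ext (by simpa using hi)
    rw [← iterRes₀_finRange, List.finRange_succ_last, iterRes₀_append, iterRes₀_cons, ← res_one]
    simp only [iterRes₀, List.map_nil, iterRes_nil]
    rw [res_regular hF, iterRes_zero]

theorem exists_prod_eq_add_mul {ι R : Type*} [CommRing R] (A : Subring R) {t : R} (ht : t ∈ A)
    (s : Finset ι) {f g : ι → R} (hg : ∀ i ∈ s, g i ∈ A)
    (hf : ∀ i ∈ s, ∃ y ∈ A, f i = g i + t * y) :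
    ∃ y ∈ A, ∏ i ∈ s, f i = ∏ i ∈ s, g i + t * y := by
  classical
  induction s using Finset.induction_on with
  | empty => exact ⟨0, zero_mem _, by simp⟩
  | insert i s his ih =>
    obtain ⟨y, hy, e⟩ := ih (fun j hj => hg j (Finset.mem_insert_of_mem hj))
      (fun j hj => hf j (Finset.mem_insert_of_mem hj))
    obtain ⟨z, hz, e'⟩ := hf i (Finset.mem_insert_self i s)
    refine ⟨g i * y + z * ∏ j ∈ s, g j + t * z * y, ?_, ?_⟩
    · have h1 := hg i (Finset.mem_insert_self i s)
      have h2 : ∏ j ∈ s, g j ∈ A := prod_mem fun j hj => hg j (Finset.mem_insert_of_mem hj)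
      exact add_mem (add_mem (mul_mem h1 hy) (mul_mem hz h2)) (mul_mem (mul_mem ht hz) hy)
    · rw [Finset.prod_insert his, Finset.prod_insert his, e, e']
      ring

/-- The product `x_i x_{i+1} ⋯ x_k`. -/
noncomputable def tailProd (i : Fin k) : RatField k := ∏ j ∈ Finset.Ici i, ratVar j

theorem one_sub_tailProd_ne_zero (i : Fin k) : 1 - tailProd i ≠ 0 :=
  one_sub_prod_ne_zero ⟨i, by simp⟩

theorem tailProd_mem {P Q : Finset (Fin k)} (i : Fin k) :
    tailProd i ∈ poleAlg Finset.univ P Q := prod_ratVar_mem (Finset.subset_univ _)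

theorem inv_one_sub_tailProd_mem {P : Finset (Fin k)} (i : Fin k) :
    (1 - tailProd i)⁻¹ ∈ poleAlg Finset.univ P Finset.univ := by
  by_cases h : 2 ≤ (Finset.Ici i).card
  · exact inv_one_sub_prod_mem (Finset.subset_univ _) h
  · have : (Finset.Ici i) = {i} := by
      symm
      refine Finset.eq_of_subset_of_card_le (by simp) ?_
      rw [Finset.card_singleton]; omega
    rw [tailProd, this, Finset.prod_singleton]
    exact inv_one_sub_ratVar_mem (Finset.mem_univ i)

theorem prod_tailProd_pow (m : Fin k → ℕ) :
    ∏ i, tailProd i ^ m i = ∏ j : Fin k, (ratVar j : RatField k) ^ ∑ i ∈ Finset.Iic j, m i := by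
  simp only [tailProd, ← Finset.prod_pow, ← Finset.prod_pow_eq_pow_sum]
  exact Finset.prod_comm' (by simp)

/-- A variant of the residuand, with the same sum over all permutations of the variables. -/
noncomputable def tailResiduand (n k : ℕ) : RatField k :=
  (∏ i : Fin k, (1 - 2 * ratVar i) *
    (ratVar i ^ (-((n : ℤ) + k - 1 - i)) * (1 - ratVar i) ^ (-(n + k : ℤ)))) * quadDiff k *
    ∏ i : Fin k, (1 - tailProd i)⁻¹

theorem quadDiff_mem {P Q : Finset (Fin k)} : quadDiff k ∈ poleAlg Finset.univ P Q :=
  prod_mem fun i _ => prod_mem fun j _ => sub_mem (quad_mem (Finset.mem_univ i))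
    (quad_mem (Finset.mem_univ j))

theorem one_sub_two_mul_mem {P Q : Finset (Fin k)} (i : Fin k) :
    1 - 2 * ratVar i ∈ poleAlg Finset.univ P Q :=
  sub_mem (one_mem _) (mul_mem (ofNat_mem _ 2) (ratVar_mem (Finset.mem_univ i)))

theorem tailResiduand_mem (n k : ℕ) :
    tailResiduand n k ∈ poleAlg Finset.univ Finset.univ Finset.univ :=
  mul_mem (mul_mem (prod_mem fun i _ => mul_mem (one_sub_two_mul_mem i)
    (mul_mem (zpow_mem_poleAlg (by simp) (by simp) _)
      (one_sub_zpow_mem_poleAlg (by simp) (by simp) _))) quadDiff_mem)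
    (prod_mem fun i _ => inv_one_sub_tailProd_mem i)

/-- Every `tailProd i` contains the last variable `x_t`, so truncating the geometric series at
exponent `n` leaves an error divisible by `x_t ^ n`. This cancels the pole at `x_t = 0`, and `x_t`
is the variable whose residue is taken first. -/
theorem iteratedResidue_tailResiduand_eq_sum (n : ℕ) (hk : 1 ≤ k) :
    iteratedResidue (tailResiduand n k) =
      ∑ m ∈ Fintype.piFinset fun _ : Fin k => Finset.range n,
        algebraMap ℚ (RatField k) (ballotDet n fun j => n - (∑ i ∈ Finset.Iic j, m i : ℕ)) := by
  let t : Fin k := ⟨k - 1, by omega⟩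
  have ht : t.val + 1 = k := by simp only [t]; omega
  have hti : ∀ i : Fin k, t ∈ Finset.Ici i := fun i =>
    Finset.mem_Ici.2 (Fin.le_def.2 (by have := i.2; omega))
  obtain ⟨y, hy, e⟩ := exists_prod_eq_add_mul
    (poleAlg (k := k) Finset.univ ∅ Finset.univ).toSubring (t := ratVar t ^ n)
    (pow_mem (ratVar_mem (Finset.mem_univ t)) n) Finset.univ
    (f := fun i => (1 - tailProd i)⁻¹) (g := fun i => ∑ m ∈ Finset.range n, tailProd i ^ m)
    (fun i _ => sum_mem fun m _ => pow_mem (tailProd_mem i) m) fun i _ => by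
      refine ⟨(∏ j ∈ (Finset.Ici i).erase t, ratVar j) ^ n * (1 - tailProd i)⁻¹,
        mul_mem (pow_mem (prod_ratVar_mem (Finset.subset_univ _)) n)
          (inv_one_sub_tailProd_mem i), ?_⟩
      rw [← mul_assoc, ← mul_pow, Finset.mul_prod_erase _ _ (hti i)]
      change _ = _ + tailProd i ^ n * _
      have h1 := geom_sum_mul_neg (tailProd i) n
      have h2 := mul_inv_cancel₀ (one_sub_tailProd_ne_zero i)
      generalize (1 - tailProd i)⁻¹ = w at *
      generalize ∑ m ∈ Finset.range n, tailProd i ^ m = s at *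
      linear_combination (-w) * h1 + s * h2
  have e' : tailResiduand n k = (∑ m ∈ Fintype.piFinset fun _ : Fin k => Finset.range n,
      (∏ i : Fin k, (1 - 2 * ratVar i) *
        (ratVar i ^ (-(((n : ℤ) - (∑ j ∈ Finset.Iic i, m j : ℕ)) + k - 1 - i)) *
          (1 - ratVar i) ^ (-(n + k : ℤ)))) * quadDiff k) +
      (∏ i : Fin k, (1 - 2 * ratVar i) *
        (ratVar i ^ (-((n : ℤ) + k - 1 - i)) * (1 - ratVar i) ^ (-(n + k : ℤ)))) *
          ratVar t ^ n * (quadDiff k * y) := by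
    rw [tailResiduand, e, Finset.prod_univ_sum, mul_add, Finset.mul_sum]
    congr 1
    · refine Finset.sum_congr rfl fun m _ => ?_
      rw [prod_tailProd_pow, mul_right_comm, ← Finset.prod_mul_distrib]
      congr 1
      refine Finset.prod_congr rfl fun i _ => ?_
      rw [show (-(((n : ℤ) - (∑ j ∈ Finset.Iic i, m j : ℕ)) + k - 1 - i)) =
        -((n : ℤ) + k - 1 - i) + (∑ j ∈ Finset.Iic i, m j : ℕ) by ring,
        zpow_add₀ (ratVar_ne_zero i), zpow_natCast]
      ring
    · ring
  have hadd : ∀ F G : RatField k,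
      iteratedResidue (F + G) = iteratedResidue F + iteratedResidue G := fun F G => by
    simp only [← iterRes₀_finRange, iterRes₀, iterRes_add]
  rw [e', hadd, iteratedResidue_sum, iteratedResidue_eq_zero ht, add_zero]
  · exact Finset.sum_congr rfl fun m _ => iteratedResidue_monomial n _
  · refine mem_regular_zero (S := Finset.univ) (P := Finset.univ.erase t) (Q := Finset.univ)
      (by simp) (mul_mem ?_ (mul_mem quadDiff_mem
        (poleAlg_mono subset_rfl (Finset.empty_subset _) subset_rfl hy)))
    rw [← Finset.mul_prod_erase _ _ (Finset.mem_univ t), mul_right_comm]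
    refine mul_mem ?_ (prod_mem fun i hi => mul_mem (one_sub_two_mul_mem i)
      (mul_mem (zpow_mem_poleAlg (by simp) hi _)
        (one_sub_zpow_mem_poleAlg (by simp) (by simp) _)))
    -- As `t = k - 1`, the pole in `x_t` has order exactly `n`.
    have : (-((n : ℤ) + k - 1 - t)) = -(n : ℤ) := by omega
    rw [this, zpow_neg, zpow_natCast, mul_assoc, mul_right_comm _ _ (ratVar t ^ n),
      inv_mul_cancel₀ (pow_ne_zero _ (ratVar_ne_zero t)), one_mul]
    exact mul_mem (one_sub_two_mul_mem t) (one_sub_zpow_mem_poleAlg (by simp) (by simp) _)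

/-! ### Partial sums -/

theorem sum_Iic_zero (m : Fin k → ℕ) {j : Fin k} (h : j.val = 0) :
    ∑ i ∈ Finset.Iic j, m i = m j := by
  have : Finset.Iic j = {j} := by
    ext i; simp only [Finset.mem_Iic, Finset.mem_singleton, Fin.le_def, Fin.ext_iff]; omega
  rw [this, Finset.sum_singleton]

theorem sum_Iic_succ (m : Fin k → ℕ) {i j : Fin k} (h : j.val = i.val + 1) :
    ∑ l ∈ Finset.Iic j, m l = ∑ l ∈ Finset.Iic i, m l + m j := by
  have : Finset.Iic j = insert j (Finset.Iic i) := by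
    ext l; simp only [Finset.mem_Iic, Finset.mem_insert, Fin.le_def, Fin.ext_iff]; omega
  rw [this, Finset.sum_insert (by simp [Fin.le_def, h]), add_comm]

theorem sum_Iic_injective {m m' : Fin k → ℕ}
    (h : ∀ j, ∑ i ∈ Finset.Iic j, m i = ∑ i ∈ Finset.Iic j, m' i) : m = m' := by
  funext j
  rcases Nat.eq_zero_or_pos j.val with h0 | h0
  · simpa only [sum_Iic_zero _ h0] using h j
  · have hi : j.val = (⟨j.val - 1, by have := j.2; omega⟩ : Fin k).val + 1 := by simp; omega
    have h1 := h j
    rw [sum_Iic_succ m hi, sum_Iic_succ m' hi, h] at h1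
    omega

theorem exists_sum_Iic_eq {s : Fin k → ℕ} (hs : Monotone s) :
    ∃ m : Fin k → ℕ, ∀ j, ∑ i ∈ Finset.Iic j, m i = s j := by
  refine ⟨fun j => s j - if h : 0 < j.val then s ⟨j.val - 1, by have := j.2; omega⟩ else 0, ?_⟩
  intro j
  induction hd : j.val generalizing j with
  | zero =>
    rw [sum_Iic_zero _ hd, dif_neg (by omega), Nat.sub_zero]
  | succ d ih =>
    have hi : j.val = (⟨j.val - 1, by have := j.2; omega⟩ : Fin k).val + 1 := by simp; omega
    rw [sum_Iic_succ _ hi, ih _ (by simp; omega), dif_pos (by omega)]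
    exact Nat.add_sub_cancel' (hs (Fin.le_def.2 (by simp)))

/-- The exponents `m` are the successive drops of a weakly decreasing vector starting from `n`.
Those whose vector ends at a value `≤ 0` contribute nothing, by `ballotDet_bottom`. -/
theorem iteratedResidue_tailResiduand {n : ℕ} (hk : 1 ≤ k) (hkn : k ≤ n) :
    iteratedResidue (tailResiduand n k) = (magogCount n k : RatField k) := by
  let t : Fin k := ⟨k - 1, by omega⟩
  have ht : t.val + 1 = k := by simp only [t]; omega
  rw [iteratedResidue_tailResiduand_eq_sum n hk, ← map_sum,
    ← map_natCast (algebraMap ℚ (RatField k)), magogCount_eq_sum hk hkn]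
  congr 1
  refine Finset.sum_bij_ne_zero
    (fun m _ _ j => (n : ℤ) - (∑ i ∈ Finset.Iic j, m i : ℕ)) ?_ ?_ ?_ ?_
  · intro m hm h0
    have hmono : Monotone fun j : Fin k => ∑ i ∈ Finset.Iic j, m i := fun i j hij =>
      Finset.sum_le_sum_of_subset (Finset.Iic_subset_Iic.2 hij)
    have hlast : ∑ i ∈ Finset.Iic t, m i < n := by
      by_contra hlt
      exact h0 (ballotDet_bottom ht (by omega))
    rw [mem_lastVectors]
    refine ⟨fun i => ?_, fun i j hij => ?_⟩
    · have := hmono (show i ≤ t from Fin.le_def.2 (by have := i.2; omega))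
      simp only at this
      omega
    · have := hmono hij
      change (n : ℤ) - (∑ l ∈ Finset.Iic j, m l : ℕ) ≤ n - (∑ l ∈ Finset.Iic i, m l : ℕ)
      simp only at this
      omega
  · intro m _ _ m' _ _ h
    refine sum_Iic_injective fun j => ?_
    have := congrFun h j
    omega
  · intro a ha h0
    rw [mem_lastVectors] at ha
    obtain ⟨m, hm⟩ := exists_sum_Iic_eq (s := fun j => (n - a j).toNat) (fun i j hij => by
      exact Int.toNat_le_toNat (sub_le_sub_left (ha.2 hij) _))
    have e : (fun j => (n : ℤ) - (∑ i ∈ Finset.Iic j, m i : ℕ)) = a := by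
      funext j
      have := (ha.1 j).2
      rw [hm]
      omega
    refine ⟨m, ?_, by rwa [e], e⟩
    rw [Fintype.mem_piFinset]
    intro j
    have h1 : m j ≤ ∑ i ∈ Finset.Iic j, m i :=
      Finset.single_le_sum (fun _ _ => Nat.zero_le _) (by simp)
    have h2 := (ha.1 j).1
    rw [hm] at h1
    rw [Finset.mem_range]
    omega
  · intro m _ _; rfl

end MagogResidue

namespace MagogResidue

/-! ### A sum over the symmetric group -/

theorem prod_swap_succ {k : ℕ} {M : Type*} [CommMonoid M] (p : Fin (k + 1))
    (g : Fin (k + 1) → M) :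
    ∏ j : Fin k, g (Equiv.swap 0 p j.succ) = ∏ m ∈ Finset.univ.erase p, g m := by
  have h : ∏ m ∈ Finset.univ.erase p, g m = ∏ m, if m = p then 1 else g m := by
    rw [← Finset.prod_erase (a := p) Finset.univ (by simp)]
    refine Finset.prod_congr rfl fun m hm => ?_
    rw [if_neg (Finset.ne_of_mem_erase hm)]
  rw [h, ← Equiv.prod_comp (Equiv.swap 0 p), Fin.prod_univ_succ, Equiv.swap_apply_left, if_pos rfl,
    one_mul]
  refine Finset.prod_congr rfl fun j _ => ?_
  rw [if_neg]
  intro e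
  have := (Equiv.swap 0 p).injective (e.trans (Equiv.swap_apply_left 0 p).symm)
  exact Fin.succ_ne_zero j this

variable {L : Type*} [Field L]

/-- The polynomial `∏ (1 - v_i x) - ∏ (v_i - x)` vanishes at `x = -1`; its quotient `G` by `x + 1`
has degree below the number of nodes. Lagrange interpolation of `G` at the `v_r`, evaluated at `0`,
is the identity. -/
theorem sum_one_sub_mul_prod {ι : Type*} [Fintype ι] [DecidableEq ι] (v : ι → L)
    (hv : Function.Injective v) (h1 : ∀ i, v i ≠ -1) :
    ∑ r, (1 - v r) * ∏ m ∈ Finset.univ.erase r, v m * (1 - v r * v m) * (v m - v r)⁻¹ =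
      1 - ∏ i, v i := by
  classical
  set P : Polynomial L := ∏ i, (1 - Polynomial.C (v i) * Polynomial.X) -
    ∏ i, (Polynomial.C (v i) - Polynomial.X) with hP
  have heval : ∀ x, P.eval x = ∏ i, (1 - v i * x) - ∏ i, (v i - x) := fun x => by
    simp [hP, Polynomial.eval_prod]
  obtain ⟨G, hG⟩ : (Polynomial.X - Polynomial.C (-1)) ∣ P := by
    rw [Polynomial.dvd_iff_isRoot, Polynomial.IsRoot, heval, sub_eq_zero]
    exact Finset.prod_congr rfl fun i _ => by ring
  have hGeval : ∀ x, P.eval x = (x + 1) * G.eval x := fun x => by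
    rw [hG]; simp
  have hdeg : P.degree ≤ Fintype.card ι := by
    refine (Polynomial.degree_sub_le _ _).trans (max_le ?_ ?_)
    · refine (Polynomial.degree_prod_le _ _).trans ?_
      refine (Finset.sum_le_card_nsmul _ _ 1 fun i _ => by compute_degree).trans ?_
      simp
    · refine (Polynomial.degree_prod_le _ _).trans ?_
      refine (Finset.sum_le_card_nsmul _ _ 1 fun i _ => by compute_degree).trans ?_
      simp
  have hGdeg : G.degree < (Finset.univ : Finset ι).card := by
    rw [Finset.card_univ]
    rcases eq_or_ne G 0 with h0 | h0
    · rw [h0, Polynomial.degree_zero]; exact WithBot.bot_lt_coe _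
    · rw [hG, Polynomial.degree_mul, Polynomial.degree_X_sub_C,
        Polynomial.degree_eq_natDegree h0] at hdeg
      rw [Polynomial.degree_eq_natDegree h0]
      norm_cast at hdeg ⊢
      omega
  have hint := congrArg (Polynomial.eval 0) (Lagrange.eq_interpolate hv.injOn hGdeg)
  have h0 := hGeval 0
  rw [heval, zero_add, one_mul] at h0
  simp only [mul_zero, sub_zero, Finset.prod_const_one] at h0
  rw [h0, hint, Lagrange.interpolate_apply, Polynomial.eval_finsetSum]
  refine Finset.sum_congr rfl fun r _ => ?_
  have hr : G.eval (v r) = (1 - v r) * ∏ m ∈ Finset.univ.erase r, (1 - v r * v m) := by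
    have h2 := hGeval (v r)
    rw [heval, Finset.prod_eq_zero (i := r) (f := fun i => v i - v r) (by simp) (sub_self _),
      sub_zero, ← Finset.mul_prod_erase _ _ (Finset.mem_univ r)] at h2
    have h3 : v r + 1 ≠ 0 := fun e => h1 r (eq_neg_of_add_eq_zero_left e)
    apply mul_left_cancel₀ h3
    rw [← h2]
    simp only [mul_comm (v r)]
    ring
  rw [Polynomial.eval_mul, Polynomial.eval_C, hr, Lagrange.basis, Polynomial.eval_prod, mul_assoc,
    ← Finset.prod_mul_distrib]
  congr 1
  refine Finset.prod_congr rfl fun m hm => ?_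
  rw [Lagrange.basisDivisor]
  simp only [Polynomial.eval_mul, Polynomial.eval_C, Polynomial.eval_sub, Polynomial.eval_X]
  rw [← neg_sub (v m) (v r), inv_neg]
  ring

/-- A Vandermonde-type product over pairs. -/
def pairQuot {k : ℕ} (v : Fin k → L) : L :=
  ∏ i, ∏ j ∈ Finset.Ioi i, (v j - v i) * (1 - v i * v j)⁻¹

theorem pairQuot_perm {k : ℕ} (v : Fin k → L) (σ : Equiv.Perm (Fin k)) :
    pairQuot (v ∘ σ) = (Equiv.Perm.sign σ : ℤ) * pairQuot v := by
  have := Equiv.Perm.prod_Ioi_comp_eq_sign_mul_prod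
    (f := fun i j => (v j - v i) * (1 - v i * v j)⁻¹) (σ := σ)
    (fun i j => by rw [mul_comm (v i)]; ring)
  exact this

theorem pairQuot_succ {k : ℕ} (v : Fin (k + 1) → L) :
    pairQuot v = (∏ j : Fin k, (v j.succ - v 0) * (1 - v 0 * v j.succ)⁻¹) *
      pairQuot (v ∘ Fin.succ) := by
  rw [pairQuot, Fin.prod_univ_succ, Fin.prod_Ioi_zero]
  congr 1
  refine Finset.prod_congr rfl fun i _ => ?_
  rw [Fin.prod_Ioi_succ]
  rfl

/-- Induction on `k`, grouping the permutations by `p = σ 0`. The inner sums are instances for the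
variables other than `v p`, and `sum_one_sub_mul_prod` adds them up. -/
theorem sum_perm_prod_inv_one_sub {k : ℕ} : ∀ (v : Fin k → L), Function.Injective v →
    (∀ i, v i ≠ -1) → (∀ T : Finset (Fin k), T.Nonempty → 1 - ∏ i ∈ T, v i ≠ 0) →
    ∑ σ : Equiv.Perm (Fin k), ((Equiv.Perm.sign σ : ℤ) : L) *
        ∏ i, (v (σ i) ^ i.val * (1 - ∏ j ∈ Finset.Ici i, v (σ j))⁻¹) =
      (∏ i, (1 - v i)⁻¹) * pairQuot v := by
  induction k with
  | zero => intro v _ _ _; simp [pairQuot]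
  | succ k ih =>
    intro v hv h1 hT
    have hall : 1 - ∏ i, v i ≠ 0 := hT Finset.univ Finset.univ_nonempty
    have hone : ∀ i, 1 - v i ≠ 0 := fun i => by simpa using hT {i} (by simp)
    have hpair : ∀ i j, i ≠ j → 1 - v i * v j ≠ 0 := fun i j hij => by
      simpa [Finset.prod_pair hij] using hT {i, j} (by simp)
    -- The factor at `0` is the symmetric `(1 - ∏ v i)⁻¹`; lowering the other exponents by one
    -- releases the product of the remaining variables.
    have hterm : ∀ (p : Fin (k + 1)) (e : Equiv.Perm (Fin k)),
        ((Equiv.Perm.sign (Equiv.Perm.decomposeFin.symm (p, e)) : ℤ) : L) *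
          ∏ i, (v (Equiv.Perm.decomposeFin.symm (p, e) i) ^ i.val *
            (1 - ∏ j ∈ Finset.Ici i, v (Equiv.Perm.decomposeFin.symm (p, e) j))⁻¹) =
        (1 - ∏ i, v i)⁻¹ * ((Equiv.Perm.sign (Equiv.swap 0 p) : ℤ) : L) *
          (∏ j, (v ∘ Equiv.swap 0 p ∘ Fin.succ) j) * (((Equiv.Perm.sign e : ℤ) : L) *
          ∏ i, ((v ∘ Equiv.swap 0 p ∘ Fin.succ) (e i) ^ i.val *
            (1 - ∏ j ∈ Finset.Ici i, (v ∘ Equiv.swap 0 p ∘ Fin.succ) (e j))⁻¹)) := fun p e => by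
      have hs : (Equiv.Perm.sign (Equiv.Perm.decomposeFin.symm (p, e)) : ℤ) =
          (Equiv.Perm.sign (Equiv.swap 0 p) : ℤ) * (Equiv.Perm.sign e : ℤ) := by
        rw [Equiv.Perm.decomposeFin.symm_sign, Equiv.Perm.sign_swap']
        by_cases hp : p = 0
        · simp [hp]
        · simp [hp, Ne.symm hp]
      rw [hs, Fin.prod_univ_succ,
        ← Equiv.prod_comp e fun j => (v ∘ Equiv.swap 0 p ∘ Fin.succ) j]
      have hI : (Finset.Ici (0 : Fin (k + 1))) = Finset.univ := by
        ext i; simp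
      have hI' : ∀ i : Fin k, Finset.Ici i.succ = (Finset.Ici i).map (Fin.succEmb k) := fun i => by
        ext j; refine Fin.cases ?_ (fun j => ?_) j <;> simp
      simp only [hI, hI', Finset.prod_map, Fin.coe_succEmb,
        Equiv.prod_comp (Equiv.Perm.decomposeFin.symm (p, e)) v,
        Equiv.Perm.decomposeFin_symm_apply_succ, Function.comp_apply, Fin.val_zero, pow_zero,
        one_mul, Fin.val_succ, pow_succ, Finset.prod_mul_distrib]
      push_cast
      ring
    rw [← Equiv.sum_comp Equiv.Perm.decomposeFin.symm, Fintype.sum_prod_type]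
    simp only [hterm, ← Finset.mul_sum]
    have hw : ∀ p : Fin (k + 1), Function.Injective (Equiv.swap 0 p ∘ (Fin.succ (n := k))) :=
      fun p => (Equiv.injective _).comp (Fin.succ_injective k)
    have hIH : ∀ p : Fin (k + 1), _ := fun p => ih (v ∘ Equiv.swap 0 p ∘ Fin.succ)
      (hv.comp (hw p)) (fun i => h1 _) (fun T hne => by
        have := hT (T.map ⟨_, hw p⟩) (by simpa using hne)
        rwa [Finset.prod_map] at this)
    simp only [hIH]
    have hmain : ∀ p : Fin (k + 1),
        (1 - ∏ i, v i)⁻¹ * ((Equiv.Perm.sign (Equiv.swap 0 p) : ℤ) : L) *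
          (∏ j, (v ∘ Equiv.swap 0 p ∘ Fin.succ) j) *
          ((∏ i, (1 - (v ∘ Equiv.swap 0 p ∘ Fin.succ) i)⁻¹) *
            pairQuot (v ∘ Equiv.swap 0 p ∘ Fin.succ)) =
        (1 - ∏ i, v i)⁻¹ * ((∏ i, (1 - v i)⁻¹) * pairQuot v) * ((1 - v p) *
          ∏ m ∈ Finset.univ.erase p, v m * (1 - v p * v m) * (v m - v p)⁻¹) := fun p => by
      have e1 := pairQuot_succ (v ∘ Equiv.swap 0 p)
      rw [pairQuot_perm] at e1
      have e2 : ∀ g : L → L, ∏ j : Fin k, g ((v ∘ Equiv.swap 0 p ∘ Fin.succ) j) =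
          ∏ m ∈ Finset.univ.erase p, g (v m) := fun g => prod_swap_succ p fun m => g (v m)
      have e3 : ∏ j : Fin k, (((v ∘ Equiv.swap 0 p) j.succ - (v ∘ Equiv.swap 0 p) 0) *
          (1 - (v ∘ Equiv.swap 0 p) 0 * (v ∘ Equiv.swap 0 p) j.succ)⁻¹) =
          ∏ m ∈ Finset.univ.erase p, ((v m - v p) * (1 - v p * v m)⁻¹) := by
        rw [← e2 fun x => (x - v p) * (1 - v p * x)⁻¹]
        simp
      rw [e3] at e1
      have e4 : (v ∘ Equiv.swap 0 p) ∘ Fin.succ = v ∘ Equiv.swap 0 p ∘ Fin.succ := rfl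
      rw [e4] at e1
      have e5 := e2 fun x => x
      have e6 := e2 fun x => (1 - x)⁻¹
      have e7 : (∏ m ∈ Finset.univ.erase p, ((v m - v p) * (1 - v p * v m)⁻¹)) *
          ∏ m ∈ Finset.univ.erase p, v m * (1 - v p * v m) * (v m - v p)⁻¹ =
          ∏ m ∈ Finset.univ.erase p, v m := by
        rw [← Finset.prod_mul_distrib]
        refine Finset.prod_congr rfl fun m hm => ?_
        have hmp := Finset.ne_of_mem_erase hm
        have f1 := hpair p m hmp.symm
        have f2 : v m - v p ≠ 0 := sub_ne_zero.2 fun e => hmp (hv e)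
        have f3 := mul_inv_cancel₀ f1
        have f4 := mul_inv_cancel₀ f2
        linear_combination v m * ((v m - v p) * (v m - v p)⁻¹) * f3 + v m * f4
      have e8 : (1 - v p) * ∏ i, (1 - v i)⁻¹ = ∏ m ∈ Finset.univ.erase p, (1 - v m)⁻¹ := by
        rw [← Finset.mul_prod_erase _ _ (Finset.mem_univ p), mul_inv_cancel_left₀ (hone p)]
      have e9 : ((Equiv.Perm.sign (Equiv.swap 0 p) : ℤ) : L) *
          ((Equiv.Perm.sign (Equiv.swap 0 p) : ℤ) : L) = 1 := by
        rw [← Int.cast_mul, ← Units.val_mul, Int.units_mul_self]; simp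
      rw [e5, e6, ← e7, ← e8]
      generalize ((Equiv.Perm.sign (Equiv.swap 0 p) : ℤ) : L) = s at *
      linear_combination (- (1 - ∏ i, v i)⁻¹ * s * (1 - v p) * (∏ i, (1 - v i)⁻¹) *
        ∏ m ∈ Finset.univ.erase p, v m * (1 - v p * v m) * (v m - v p)⁻¹) * e1 +
        (1 - ∏ i, v i)⁻¹ * (1 - v p) * (∏ i, (1 - v i)⁻¹) * pairQuot v *
        (∏ m ∈ Finset.univ.erase p, v m * (1 - v p * v m) * (v m - v p)⁻¹) * e9
    simp only [hmain]
    rw [← Finset.mul_sum, sum_one_sub_mul_prod v hv h1, mul_comm, mul_inv_cancel_left₀ hall]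

end MagogResidue

namespace MagogResidue

/-! ### Comparison of the residuands -/

variable {k : ℕ}

theorem permAct_prod_Ioi (σ : Equiv.Perm (Fin k)) {Q : Fin k → Fin k → RatField k}
    (hQ : ∀ p q, Q p q = -Q q p) (h : ∀ p q, permAct σ (Q p q) = Q (σ p) (σ q)) :
    permAct σ (∏ p, ∏ q ∈ Finset.Ioi p, Q p q) =
      ((Equiv.Perm.sign σ : ℤ) : RatField k) * ∏ p, ∏ q ∈ Finset.Ioi p, Q p q := by
  simp only [map_prod, h]
  exact Equiv.Perm.prod_Ioi_comp_eq_sign_mul_prod σ hQ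

theorem permAct_quad (σ : Equiv.Perm (Fin k)) (i : Fin k) :
    permAct σ (quad i) = quad (σ i) := by
  simp [quad, permAct_ratVar]

/-- The symmetric factor that the two residuands share. -/
noncomputable def commonFactor (n k : ℕ) : RatField k :=
  ∏ i : Fin k, (1 - 2 * ratVar i) *
    (ratVar i ^ (-((n : ℤ) + k - 1)) * (1 - ratVar i) ^ (-(n + k : ℤ)))

theorem permAct_commonFactor (n : ℕ) (σ : Equiv.Perm (Fin k)) :
    permAct σ (commonFactor n k) = commonFactor n k := by
  rw [commonFactor, map_prod, ← Equiv.prod_comp σ fun i : Fin k => (1 - 2 * ratVar i) *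
    (ratVar i ^ (-((n : ℤ) + k - 1)) * (1 - ratVar i) ^ (-(n + k : ℤ)) : RatField k)]
  refine Finset.prod_congr rfl fun i _ => ?_
  simp only [map_mul, map_sub, map_one, map_ofNat, map_zpow₀, permAct_ratVar]

theorem tailResiduand_eq (n k : ℕ) :
    tailResiduand n k = commonFactor n k * quadDiff k *
      ∏ i : Fin k, ratVar i ^ i.val * (1 - tailProd i)⁻¹ := by
  rw [tailResiduand, commonFactor, mul_right_comm, mul_right_comm _ (quadDiff k),
    ← Finset.prod_mul_distrib, ← Finset.prod_mul_distrib]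
  congr 1
  refine Finset.prod_congr rfl fun i _ => ?_
  rw [show -((n : ℤ) + k - 1 - i) = -((n : ℤ) + k - 1) + (i.val : ℕ) by ring,
    zpow_add₀ (ratVar_ne_zero i), zpow_natCast]
  ring

theorem magogResiduand_eq_commonFactor (n k : ℕ) :
    magogResiduand n k = commonFactor n k * (∏ i : Fin k, (1 - ratVar i)⁻¹) *
      (∏ p : Fin k, ∏ q ∈ Finset.Ioi p, pairFactor p q) * ∏ i : Fin k, ratVar i ^ i.val := by
  have h : ∏ i, varFactor n i = commonFactor n k * (∏ i : Fin k, (1 - ratVar i)⁻¹) *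
      ∏ i : Fin k, ratVar i ^ i.val := by
    rw [commonFactor, ← Finset.prod_mul_distrib, ← Finset.prod_mul_distrib]
    refine Finset.prod_congr rfl fun i _ => ?_
    have hi := i.2
    rw [varFactor,
      show (-(n + k - (i.val + 1) : ℕ) : ℤ) = -((n : ℤ) + k - 1) + (i.val : ℕ) by omega,
      show (-(n + k + 1 : ℕ) : ℤ) = -(n + k : ℤ) + -1 by push_cast; ring,
      zpow_add₀ (ratVar_ne_zero i), zpow_natCast, zpow_add₀ (one_sub_ratVar_ne_zero i),
      zpow_neg_one]
    ring
  rw [magogResiduand_eq, pairProd_univ, h, mul_right_comm]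

theorem ratVar_ne_neg_one (i : Fin k) : ratVar i ≠ -1 := by
  intro h
  have h1 := congrArg (signAct fun _ => -1) h
  simp only [map_neg, map_one, signAct_ratVar] at h1
  rw [if_neg (by simp), h] at h1
  norm_num at h1

theorem prod_pairFactor_mul (k : ℕ) :
    (∏ p : Fin k, ∏ q ∈ Finset.Ioi p, pairFactor p q) *
        ∏ p : Fin k, ∏ q ∈ Finset.Ioi p, (ratVar q - ratVar p) =
      quadDiff k * pairQuot (ratVar : Fin k → RatField k) := by
  simp only [quadDiff, pairQuot, pairFactor, Finset.prod_mul_distrib]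
  ring

/-- Up to symmetric factors and a sign, the two functions differ only in their last products.
Antisymmetrising `∏ x_i ^ i` gives the Vandermonde determinant, and antisymmetrising the product
with the geometric series is `sum_perm_prod_inv_one_sub`. -/
theorem sum_permAct_tailResiduand (n k : ℕ) :
    ∑ σ : Equiv.Perm (Fin k), permAct σ (tailResiduand n k) =
      ∑ σ : Equiv.Perm (Fin k), permAct σ (magogResiduand n k) := by
  have h1 : ∀ σ : Equiv.Perm (Fin k), permAct σ (tailResiduand n k) =
      commonFactor n k * quadDiff k * (((Equiv.Perm.sign σ : ℤ) : RatField k) *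
        ∏ i, (ratVar (σ i) ^ i.val * (1 - ∏ j ∈ Finset.Ici i, ratVar (σ j))⁻¹)) := fun σ => by
    have hq : permAct σ (quadDiff k) = ((Equiv.Perm.sign σ : ℤ) : RatField k) * quadDiff k :=
      permAct_prod_Ioi σ (Q := fun p q => quad p - quad q) (fun p q => by ring)
        fun p q => by rw [map_sub, permAct_quad, permAct_quad]
    rw [tailResiduand_eq, map_mul, map_mul, permAct_commonFactor, hq]
    simp only [map_prod, map_mul, map_pow, map_inv₀, map_sub, map_one, tailProd, permAct_ratVar]
    ring
  have h2 : ∀ σ : Equiv.Perm (Fin k), permAct σ (magogResiduand n k) =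
      commonFactor n k * (∏ i : Fin k, (1 - ratVar i)⁻¹) *
        (∏ p : Fin k, ∏ q ∈ Finset.Ioi p, pairFactor p q) *
        (((Equiv.Perm.sign σ : ℤ) : RatField k) *
          ∏ i, Matrix.vandermonde (ratVar : Fin k → RatField k) (σ i) i) := fun σ => by
    have hq := permAct_prod_Ioi σ (Q := pairFactor) (fun p q => pairFactor_symm q p)
      fun p q => by simp [pairFactor, permAct_quad, permAct_ratVar]
    have h3 : ∏ i : Fin k, (1 - ratVar (σ i) : RatField k)⁻¹ = ∏ i : Fin k, (1 - ratVar i)⁻¹ :=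
      Equiv.prod_comp σ fun i : Fin k => (1 - ratVar i : RatField k)⁻¹
    rw [magogResiduand_eq_commonFactor, map_mul, map_mul, map_mul, permAct_commonFactor, hq]
    simp only [map_prod, map_pow, map_inv₀, map_sub, map_one, permAct_ratVar, h3,
      Matrix.vandermonde_apply]
    ring
  simp only [h1, h2, ← Finset.mul_sum]
  rw [← Matrix.det_apply', Matrix.det_vandermonde,
    sum_perm_prod_inv_one_sub _ ratVar_injective ratVar_ne_neg_one fun _ => one_sub_prod_ne_zero]
  linear_combination -(commonFactor n k * ∏ i : Fin k, (1 - ratVar i)⁻¹) * prod_pairFactor_mul k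

/-- All `k!` terms of either symmetrised sum have the same iterated residue, so the factor `k!`
cancels. -/
theorem iteratedResidue_magogResiduand {n : ℕ} (hk : 1 ≤ k) (hkn : k ≤ n) :
    iteratedResidue (magogResiduand n k) = (magogCount n k : RatField k) := by
  have h := congrArg iteratedResidue (sum_permAct_tailResiduand n k)
  simp only [iteratedResidue_sum,
    iteratedResidue_permAct _ subset_rfl (tailResiduand_mem n k),
    iteratedResidue_permAct _ subset_rfl (magogResiduand_mem n k), Finset.sum_const,
    Finset.card_univ, Fintype.card_perm, Fintype.card_fin, nsmul_eq_mul] at h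
  rw [← iteratedResidue_tailResiduand hk hkn]
  exact (mul_left_cancel₀ (Nat.cast_ne_zero.2 (Nat.factorial_ne_zero k)) h).symm

end MagogResidue

theorem mainTheorem6 (n k : ℕ) (hk : 1 ≤ k) (hkn : k ≤ n) :
    (∀ g : SignedPerm k,
      iteratedResidue (signedAct g (magogResiduand n k)) =
        iteratedResidue (magogResiduand n k)) ∧
    iteratedResidue (magogResiduand n k) = (magogCount n k : RatField k) ∧
    (2 ≤ k → ∃ g : SignedPerm k,
      ¬ HasLaurentExpansion (signedAct g (magogResiduand n k))) :=
  ⟨MagogResidue.iteratedResidue_signedAct_magogResiduand hkn,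
    MagogResidue.iteratedResidue_magogResiduand hk hkn,
    fun h2 => ⟨(1, fun _ => -1),
      MagogResidue.not_hasLaurentExpansion_signedAct_magogResiduand n h2⟩⟩
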